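/- Let $(\mathcal{G},\otimes)$ be any closed symmetric monoidal Grothendieck category, and let $\mathrm{Ch}(\mathcal{G})$ be the category of ($\mathbb{Z}$-graded) chain complexes in $\mathcal{G}$, with tensor product $(X\otimes Y)_n=\bigoplus_{i+j=n}X_i\otimes Y_j$ and differential $d\otimes 1+(-1)^i\,1\otimes d$ on $X_i\otimes Y_j$. A complex $X$ is called K-flat if $E\otimes X$ is acyclic for every acyclic complex $E$. Then the class of all K-flat complexes is a covering class in $\mathrm{Ch}(\mathcal{G})$: for every complex $Y$ there is a chain map $p\colon X\to Y$ with $X$ K-flat such that every chain map $X'\to Y$ with $X'$ K-flat factors through $p$, and every $g\colon X\to X$ with $pg=p$ is an isomorphism (such a $p$ is called a K-flat cover of $Y$). In particular, for any scheme $\mathbb{X}$, every chain complex of quasi-coherent sheaves on $\mathbb{X}$ has a K-flat cover in the category of chain complexes of quasi-coherent sheaves, where K-flatness is taken with respect to the tensor product over $\mathcal{O}_{\mathbb{X}}$ and acyclic complexes of quasi-coherent sheaves. -/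

import Mathlib

universe v u w

open CategoryTheory Limits MonoidalCategory

noncomputable section

/-! ### Covers and covering classes -/

section Covers

variable {A : Type*} [Category A]

/-- `p : F ⟶ Y` is a `P`-precover of `Y`: the object `F` belongs to the class `P`, and every
morphism to `Y` from an object of `P` factors through `p`. -/
structure IsPrecover (P : ObjectProperty A) {F Y : A} (p : F ⟶ Y) : Prop where
  mem : P F
  exists_lift (F' : A) (hF' : P F') (f : F' ⟶ Y) : ∃ g : F' ⟶ F, g ≫ p = f

/-- `p : F ⟶ Y` is a `P`-cover of `Y`: it is a `P`-precover, and every endomorphism `g` of `F`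
with `p ∘ g = p` is an automorphism. -/
structure IsCover (P : ObjectProperty A) {F Y : A} (p : F ⟶ Y) : Prop
    extends IsPrecover P p where
  isIso_of_comp_eq (g : F ⟶ F) (hg : g ≫ p = p) : IsIso g

/-- The class `P` is covering: every object has a `P`-cover. -/
def IsCoveringClass (P : ObjectProperty A) : Prop :=
  ∀ Y : A, ∃ (F : A) (p : F ⟶ Y), IsCover P p

end Covers

/-! ### Signs for tensor products of `ℤ`-graded chain complexes -/

/-- The sign `(-1)^i`, so that the differential of `X ⊗ Y` on the summand `X_i ⊗ Y_j` is
`d ⊗ 1 + (-1)^i (1 ⊗ d)`. -/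
instance instTensorSignsDownInt : (ComplexShape.down ℤ).TensorSigns where
  ε' := MonoidHom.mk' Int.negOnePow Int.negOnePow_add
  rel_add p q r (hpq : q + 1 = p) := by
    change q + r + 1 = p + r
    lia
  add_rel p q r (hpq : q + 1 = p) := by
    change r + q + 1 = r + p
    lia
  ε'_succ := by
    rintro _ q rfl
    change Int.negOnePow q = - Int.negOnePow (q + 1)
    rw [Int.negOnePow_succ, neg_neg]

/-- Total complexes of bicomplexes obtained from a bifunctor and two chain complexes exist when
the target has countable coproducts. -/
lemma hasMapBifunctor_of_countable {A₁ A₂ B : Type*} [Category A₁] [Category A₂] [Category B]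
    [HasZeroMorphisms A₁] [HasZeroMorphisms A₂] [Preadditive B] [HasCountableCoproducts B]
    (K₁ : ChainComplex A₁ ℤ) (K₂ : ChainComplex A₂ ℤ) (T : A₁ ⥤ A₂ ⥤ B)
    [T.PreservesZeroMorphisms] [∀ M, (T.obj M).PreservesZeroMorphisms] :
    HomologicalComplex.HasMapBifunctor K₁ K₂ T (ComplexShape.down ℤ) :=
  fun _ => inferInstance

/-! ### K-flat complexes in a closed symmetric monoidal Grothendieck category -/

section Monoidal

variable (G : Type u) [Category.{v} G] [Abelian G] [IsGrothendieckAbelian.{v} G]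
  [MonoidalCategory G] [SymmetricCategory G] [MonoidalClosed G]

/-- In a closed symmetric monoidal abelian category the tensor product is automatically biadditive,
since `M ⊗ -` and `- ⊗ M` are left adjoints. -/
lemma monoidalPreadditive_of_closed (G : Type u) [Category.{v} G] [Abelian G]
    [MonoidalCategory G] [SymmetricCategory G] [MonoidalClosed G] : MonoidalPreadditive G := by
  have hl (M : G) : (tensorLeft M).Additive :=
    have := preservesBinaryBiproducts_of_preservesBinaryCoproducts (tensorLeft M)
    Functor.additive_of_preservesBinaryBiproducts _
  have hr (M : G) : (tensorRight M).Additive :=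
    have := hl M
    Functor.additive_of_iso (BraidedCategory.tensorLeftIsoTensorRight M)
  exact
    { whiskerLeft_zero := fun {M _ _} => (tensorLeft M).map_zero _ _
      zero_whiskerRight := fun {M _ _} => (tensorRight M).map_zero _ _
      whiskerLeft_add := fun {M _ _} _ _ => (tensorLeft M).map_add
      add_whiskerRight := fun {M _ _} _ _ => (tensorRight M).map_add }

variable {G} in
/-- The tensor product of chain complexes: `(X ⊗ Y)_n` is the coproduct of the `X_i ⊗ Y_j` with
`i + j = n`, with differential `d ⊗ 1 + (-1)^i (1 ⊗ d)` on `X_i ⊗ Y_j`. -/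
def tensorComplex (X Y : ChainComplex G ℤ) : ChainComplex G ℤ :=
  haveI := monoidalPreadditive_of_closed G
  haveI := hasMapBifunctor_of_countable X Y (curriedTensor G)
  HomologicalComplex.tensorObj X Y

/-- The class of K-flat complexes: those `X` such that `E ⊗ X` is acyclic for every acyclic `E`. -/
def kFlat : ObjectProperty (ChainComplex G ℤ) := fun X =>
  ∀ E : ChainComplex G ℤ, E.Acyclic → (tensorComplex E X).Acyclic

end Monoidal

/-! ### K-flat complexes of quasi-coherent sheaves on a scheme -/

section Schemes

open AlgebraicGeometry

instance instMonoidalPreadditivePresheafOfModules {C : Type*} [Category C]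
    (R : Cᵒᵖ ⥤ CommRingCat.{w}) :
    MonoidalPreadditive (PresheafOfModules.{w} (R ⋙ forget₂ CommRingCat RingCat)) where
  whiskerLeft_zero := by
    intros
    ext1 U
    exact MonoidalPreadditive.whiskerLeft_zero (C := ModuleCat (R.obj U))
  zero_whiskerRight := by
    intros
    ext1 U
    exact MonoidalPreadditive.zero_whiskerRight (C := ModuleCat (R.obj U))
  whiskerLeft_add := by
    intros
    ext1 U
    exact MonoidalPreadditive.whiskerLeft_add (C := ModuleCat (R.obj U)) _ _
  add_whiskerRight := by
    intros
    ext1 U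
    exact MonoidalPreadditive.add_whiskerRight (C := ModuleCat (R.obj U)) _ _

variable (X : Scheme.{w})

/-- The tensor product of presheaves of `𝒪_X`-modules, as a bifunctor. -/
def presheafTensor : X.PresheafOfModules ⥤ X.PresheafOfModules ⥤ X.PresheafOfModules :=
  curriedTensor (PresheafOfModules.{w} (X.presheaf ⋙ forget₂ CommRingCat RingCat))

/-- The sheaf of `𝒪_X`-modules associated with a presheaf of `𝒪_X`-modules. -/
def modulesSheafification : X.PresheafOfModules ⥤ X.Modules :=
  PresheafOfModules.sheafification (𝟙 X.ringCatSheaf.obj)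

/-- The tensor product `M ⊗ N` over `𝒪_X` of sheaves of modules, as a bifunctor: the sheaf
associated with `U ↦ M(U) ⊗ N(U)`, the tensor product being over `𝒪_X(U)`. -/
def sheafTensor : X.Modules ⥤ X.Modules ⥤ X.Modules :=
  Scheme.Modules.toPresheafOfModules X ⋙ presheafTensor X ⋙
    (Functor.whiskeringLeft _ _ _).obj (Scheme.Modules.toPresheafOfModules X) ⋙
    (Functor.whiskeringRight _ _ _).obj (modulesSheafification X)

/-- The category of quasi-coherent sheaves on `X`, a full subcategory of the category of sheaves
of `𝒪_X`-modules. -/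
abbrev QCoh : Type (w + 1) :=
  ObjectProperty.FullSubcategory (fun M : X.Modules => SheafOfModules.IsQuasicoherent M)

instance instPreservesZeroModulesSheafification :
    (modulesSheafification X).PreservesZeroMorphisms :=
  haveI : (modulesSheafification X).IsLeftAdjoint :=
    (PresheafOfModules.sheafificationAdjunction (𝟙 X.ringCatSheaf.obj)).isLeftAdjoint
  Functor.preservesZeroMorphisms_of_isLeftAdjoint _

instance instPreservesZeroToPresheafOfModules :
    (Scheme.Modules.toPresheafOfModules X).PreservesZeroMorphisms :=
  Functor.preservesZeroMorphisms_of_isRightAdjoint _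

instance instPreservesZeroPresheafTensor : (presheafTensor X).PreservesZeroMorphisms :=
  inferInstanceAs (curriedTensor (PresheafOfModules.{w}
    (X.presheaf ⋙ forget₂ CommRingCat RingCat))).PreservesZeroMorphisms

instance instPreservesZeroPresheafTensorObj (M : X.PresheafOfModules) :
    ((presheafTensor X).obj M).PreservesZeroMorphisms where
  map_zero _ _ := MonoidalPreadditive.whiskerLeft_zero (C := PresheafOfModules.{w}
    (X.presheaf ⋙ forget₂ CommRingCat RingCat))

instance instPreservesZeroSheafTensor : (sheafTensor X).PreservesZeroMorphisms where
  map_zero M N := by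
    ext1
    ext1 K
    change (modulesSheafification X).map (((presheafTensor X).map
      ((Scheme.Modules.toPresheafOfModules X).map 0)).app _) = 0
    rw [Functor.map_zero, Functor.map_zero, zero_app, Functor.map_zero]

instance instPreservesZeroSheafTensorObj (M : X.Modules) :
    ((sheafTensor X).obj M).PreservesZeroMorphisms where
  map_zero N K := by
    change (modulesSheafification X).map (((presheafTensor X).obj _).map
      ((Scheme.Modules.toPresheafOfModules X).map 0)) = 0
    rw [Functor.map_zero, Functor.map_zero, Functor.map_zero]

variable {X} in
/-- The complex of sheaves of `𝒪_X`-modules underlying a complex of quasi-coherent sheaves. -/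
def underlyingComplex (E : ChainComplex (QCoh X) ℤ) : ChainComplex X.Modules ℤ :=
  ((ObjectProperty.ι _).mapHomologicalComplex _).obj E

variable {X} in
/-- The tensor product over `𝒪_X` of two chain complexes of sheaves of `𝒪_X`-modules:
`(E ⊗ F)_n` is the direct sum of the `E_i ⊗ F_j` with `i + j = n`, with differential
`d ⊗ 1 + (-1)^i (1 ⊗ d)` on `E_i ⊗ F_j`. -/
def sheafTensorComplex (E F : ChainComplex X.Modules ℤ) : ChainComplex X.Modules ℤ :=
  haveI := hasMapBifunctor_of_countable E F (sheafTensor X)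
  HomologicalComplex.mapBifunctor E F (sheafTensor X) (ComplexShape.down ℤ)

/-- The class of K-flat complexes of quasi-coherent sheaves on `X`: those `F` such that `E ⊗ F` is
acyclic for every acyclic complex `E` of quasi-coherent sheaves. Quasi-coherent sheaves are closed
under kernels, cokernels, direct sums and tensor products in sheaves of `𝒪_X`-modules, so acyclicity
and tensor products may be, and here are, formed in sheaves of `𝒪_X`-modules. -/
def kFlatQCoh : ObjectProperty (ChainComplex (QCoh X) ℤ) := fun F =>
  ∀ E : ChainComplex (QCoh X) ℤ, (underlyingComplex E).Acyclic →
    (sheafTensorComplex (underlyingComplex E) (underlyingComplex F)).Acyclic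

end Schemes

end

-- Call an object small when it is a quotient of one fixed object `Q`; up to isomorphism such
-- objects form a set.
--
-- Reduction to a set of tests. An acyclic complex `E` is a filtered union of small subobjects, each
-- contained in a small acyclic subcomplex `N`. Tensoring with `X` commutes with this union, and the
-- map from each piece factors through `N ⊗ X`. Hence K-flatness of `X` can be tested on a set of
-- acyclic complexes `E s` (`exists_forall_acyclic_iff`), and the K-flat complexes are the objects
-- made acyclic by a set of cocontinuous functors `T s = E s ⊗ -`. The covering property is proved
-- for any such class.
--
-- Precovers. Factor `0 ⟶ Y` by the small object argument for the set of small monomorphisms which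
-- every `T s` sends to a monomorphism with acyclic cokernel. The middle object lies in the class.
-- To lift a map `X' ⟶ Y`, with `X'` in the class, through the second factor, apply Zorn's lemma to
-- lifts defined on subobjects `A` of `X'` that lie in the class and for which `T s A ⟶ T s X'` is
-- monic. As `T s` need not be left exact, this monicity has to be arranged: a Löwenheim–Skolem
-- argument (`exists_subobject_mono_map`) closes a small subobject up to a small one whose inclusion
-- stays monic on the terms and on the opcycles of all `T s`. Monicity on opcycles transfers
-- acyclicity to the subobject. This allows every proper `A` to be enlarged by a pushout of a small
-- map (`exists_larger_acyclicSubobject`), over which the lift extends.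
--
-- Covers. The class is closed under filtered colimits, because these are exact. A precover of `Y`
-- is a weakly terminal object in the category of maps to `Y` from objects of the class. Transfinite
-- iterations, stopped by the bounded number of subobjects, produce a weakly terminal object all of
-- whose endomorphisms are invertible (`exists_weaklyTerminal_isIso`), that is, a cover.
--
-- Schemes. The same argument applies to quasi-coherent sheaves once they are known to form a
-- Grothendieck category (`QCoh.isSeparating_generator`) and the tensor product is known to be
-- cocontinuous. The latter holds because sheafification inverts the tensor product of any presheaf
-- of modules with a unit `P ⟶ P⁺` of sheafification (`isIso_presheafTensor_unit`).

universe v' u'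

/-! ### Subobjects, size bounds and a Löwenheim–Skolem theorem -/

noncomputable section

namespace CategoryTheory

namespace Subobject

variable {C : Type u} [Category.{v} C] [Abelian C] {X : C}

/-- The cocone given by the inclusions of the members of a diagram of subobjects of `X` into a
subobject containing them. -/
def coconeOfLE {J : Type w} [Category.{v'} J] (S : J ⥤ Subobject X) (A : Subobject X)
    (h : ∀ j, S.obj j ≤ A) : Cocone (S ⋙ Subobject.underlying) where
  pt := (A : C)
  ι :=
    { app j := Subobject.ofLE _ _ (h j)
      naturality i j f := by
        simp [← cancel_mono A.arrow] }

/-- The union of a filtered diagram of subobjects is its colimit. -/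
def isColimitCoconeOfLE [IsGrothendieckAbelian.{w} C] {J : Type w} [SmallCategory J] [IsFiltered J]
    (S : J ⥤ Subobject X) (A : Subobject X) (h : ∀ j, S.obj j ≤ A) (hA : A = ⨆ j, S.obj j) :
    IsColimit (coconeOfLE S A h) := by
  let F : J ⥤ MonoOver X := S ⋙ Subobject.representative
  let c : Cocone (F ⋙ MonoOver.forget _) :=
    { pt := Over.mk A.arrow
      ι :=
        { app j := Over.homMk (Subobject.ofLE _ _ (h j)) (by
            dsimp; exact Subobject.ofLE_arrow _)
          naturality i j f := by
            ext1
            exact (coconeOfLE S A h).ι.naturality f } }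
  have : Mono c.pt.hom := inferInstanceAs (Mono A.arrow)
  refine IsGrothendieckAbelian.isColimitMapCoconeOfSubobjectMkEqISup F c ?_
  dsimp [c, F]
  rw [Subobject.mk_arrow, hA]
  exact iSup_congr fun j ↦ (Subobject.mk_arrow (S.obj j)).symm

lemma ofLE_comp_underlying_map {A B B' : Subobject X} (h : A ≤ B) (φ : B ⟶ B') :
    Subobject.ofLE A B h ≫ Subobject.underlying.map φ =
      Subobject.ofLE A B' (h.trans (leOfHom φ)) := by
  simp [← cancel_mono B'.arrow]

lemma iSup_mk_image_eq_top [IsGrothendieckAbelian.{w} C] {G : C} (hG : IsSeparator G) :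
    ⨆ f : Shrink.{w} (G ⟶ X), imageSubobject ((equivShrink _).symm f) = (⊤ : Subobject X) := by
  set A : Subobject X := ⨆ f : Shrink.{w} (G ⟶ X), imageSubobject ((equivShrink _).symm f)
  rw [← Subobject.isIso_arrow_iff_eq_top, hG.isDetector.isIso_iff_of_mono]
  simp only [ObjectProperty.singleton_iff, Function.Surjective, Functor.flip_obj_map, forall_eq']
  intro f
  have : imageSubobject f ≤ A := by
    simpa using le_iSup (fun f : Shrink.{w} (G ⟶ X) ↦ imageSubobject ((equivShrink _).symm f))
      (equivShrink _ f)
  exact ⟨A.factorThru f (Subobject.factors_of_le f this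
    ((Subobject.factors_iff _ _).2 ⟨factorThruImageSubobject f, by simp⟩)), by simp⟩


/-- The kernel of `g`, viewed as a subobject of `X`, contains every `A i` and hence their union `B`.
-/
lemma eq_zero_of_eq_iSup [IsGrothendieckAbelian.{w} C] {ι : Type w} {A : ι → Subobject X}
    {B : Subobject X} (hB : B = ⨆ i, A i) {Z : C} (g : (B : C) ⟶ Z)
    (h : ∀ i, Subobject.ofLE (A i) B (hB ▸ le_iSup A i) ≫ g = 0) : g = 0 := by
  have hM : B ≤ Subobject.mk (kernel.ι g ≫ B.arrow) := by
    conv_lhs => rw [hB]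
    exact iSup_le fun i ↦ Subobject.le_mk_of_comm (kernel.lift g _ (h i)) (by simp)
  have : Subobject.ofLEMk _ _ hM ≫ kernel.ι g = 𝟙 _ := by
    rw [← cancel_mono B.arrow, Category.assoc, Subobject.ofLEMk_comp, Category.id_comp]
  rw [← Category.id_comp g, ← this, Category.assoc, kernel.condition, comp_zero]

lemma epi_of_eq_iSup [IsGrothendieckAbelian.{w} C] {ι : Type w} {A : ι → Subobject X}
    {B : Subobject X} (hB : B = ⨆ i, A i) {Z : C} (p : Z ⟶ B)
    (h : ∀ i, ∃ (W : C) (q : W ⟶ A i) (r : W ⟶ Z),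
      Epi q ∧ q ≫ Subobject.ofLE (A i) B (hB ▸ le_iSup A i) = r ≫ p) : Epi p := by
  refine Preadditive.epi_of_cancel_zero _ fun {T} g hg ↦ eq_zero_of_eq_iSup hB g fun i ↦ ?_
  obtain ⟨W, q, r, _, hq⟩ := h i
  rw [← cancel_epi q, ← Category.assoc, hq, Category.assoc, hg, comp_zero, comp_zero]

end Subobject

/-- `N` is a quotient of `Q`. -/
def IsQuotientOf {C : Type u} [Category.{v} C] (Q N : C) : Prop := ∃ f : Q ⟶ N, Epi f

namespace IsQuotientOf

variable {C : Type u} [Category.{v} C]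

lemma of_epi {Q N : C} (f : Q ⟶ N) [Epi f] : IsQuotientOf Q N := ⟨f, inferInstance⟩

lemma trans {Q N M : C} (h : IsQuotientOf Q N) (h' : IsQuotientOf N M) : IsQuotientOf Q M := by
  obtain ⟨f, _⟩ := h
  obtain ⟨g, _⟩ := h'
  exact ⟨f ≫ g, epi_comp _ _⟩

/-- This makes "quotient of `Q`" a smallness condition: up to isomorphism the quotients of `Q` are
indexed by the subobjects of `Q`, which form a small type in a Grothendieck category. -/
lemma exists_iso_cokernel [Abelian C] {Q N : C} (h : IsQuotientOf Q N) :
    ∃ R : Subobject Q, Nonempty (cokernel R.arrow ≅ N) := by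
  obtain ⟨f, _⟩ := h
  let e : cokernel (Subobject.mk (kernel.ι f)).arrow ≅ cokernel (kernel.ι f) :=
    cokernel.mapIso _ _ (Subobject.underlyingIso _) (Iso.refl _) (by simp)
  exact ⟨Subobject.mk (kernel.ι f), ⟨e ≪≫ (colimit.isColimit _).coconePointUniqueUpToIso
    (Abelian.epiIsCokernelOfKernel _ (kernelIsKernel f))⟩⟩

lemma sigma_of_injective [HasZeroMorphisms C] {S : Type w} {T : Type w} (e : S → T)
    (he : Function.Injective e) (Q : C) [HasCoproducts.{w} C] :
    IsQuotientOf (∐ fun _ : T ↦ Q) (∐ fun _ : S ↦ Q) := by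
  classical
  let p : (∐ fun _ : T ↦ Q) ⟶ ∐ fun _ : S ↦ Q :=
    Limits.Sigma.desc fun t ↦
      if h : ∃ s, e s = t then Limits.Sigma.ι (fun _ : S ↦ Q) h.choose else 0
  let i : (∐ fun _ : S ↦ Q) ⟶ ∐ fun _ : T ↦ Q :=
    Limits.Sigma.desc fun s ↦ Limits.Sigma.ι (fun _ : T ↦ Q) (e s)
  have hip : i ≫ p = 𝟙 _ := by
    ext s
    have h : ∃ s', e s' = e s := ⟨s, rfl⟩
    simp [i, p, he h.choose_spec]
  have := SplitEpi.epi ⟨i, hip⟩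
  exact of_epi p

lemma iSup [Abelian C] [IsGrothendieckAbelian.{w} C] {ι : Type w} {X : C} {Q : ι → C}
    {A : ι → Subobject X} (h : ∀ i, IsQuotientOf (Q i) (A i : C)) :
    IsQuotientOf (∐ Q) ((⨆ i, A i : Subobject X) : C) := by
  choose f hf using h
  have : Epi (Limits.Sigma.desc fun i ↦ f i ≫ Subobject.ofLE _ _ (le_iSup A i)) :=
    Subobject.epi_of_eq_iSup rfl _ fun i ↦ ⟨Q i, f i, Limits.Sigma.ι Q i, hf i, by simp⟩
  exact of_epi (Limits.Sigma.desc fun i ↦ f i ≫ Subobject.ofLE _ _ (le_iSup A i))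

lemma sup [Abelian C] [IsGrothendieckAbelian.{w} C] {X : C} {Q Q' : C}
    {A A' : Subobject X} (h : IsQuotientOf Q (A : C)) (h' : IsQuotientOf Q' (A' : C)) :
    IsQuotientOf (Q ⨿ Q') ((A ⊔ A' : Subobject X) : C) := by
  obtain ⟨f, _⟩ := h
  obtain ⟨f', _⟩ := h'
  have hA : A ⊔ A' = ⨆ i : ULift.{w} Bool, if i.down then A else A' := by
    rw [← (Equiv.ulift.{w} (α := Bool)).symm.iSup_comp, iSup_bool_eq]
    simp
  have : Epi (coprod.desc (f ≫ Subobject.ofLE _ _ le_sup_left)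
      (f' ≫ Subobject.ofLE _ (A ⊔ A') le_sup_right)) :=
    Subobject.epi_of_eq_iSup hA _ (by
      rintro ⟨_ | _⟩
      · exact ⟨Q', f', coprod.inr, inferInstance, (coprod.inr_desc _ _).symm⟩
      · exact ⟨Q, f, coprod.inl, inferInstance, (coprod.inl_desc _ _).symm⟩)
  exact of_epi (coprod.desc (f ≫ Subobject.ofLE _ _ le_sup_left)
      (f' ≫ Subobject.ofLE _ (A ⊔ A') le_sup_right))

lemma imageSubobject [Abelian C] {Q X : C} (f : Q ⟶ X) :
    IsQuotientOf Q (imageSubobject f : C) :=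
  of_epi (factorThruImageSubobject f)

end IsQuotientOf

section

variable {C : Type u} [Category.{v} C] [Abelian C] [IsGrothendieckAbelian.{w} C]
  {D : Type u'} [Category.{v'} D] [Abelian D] [IsGrothendieckAbelian.{w} D]

/-- Since the quotients of `Q` form a set up to isomorphism, one cardinal bounds the subobjects of
all their images under all `F i`. -/
lemma exists_regular_cardinal_subobject {ι : Type w} (F : ι → C ⥤ D) (Q : C) :
    ∃ (κ : Cardinal.{w}) (_ : Fact κ.IsRegular), HasCardinalLT ι κ ∧
      ∀ (i : ι) (N : C), IsQuotientOf Q N → HasCardinalLT (Subobject ((F i).obj N)) κ := by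
  obtain ⟨κ, hκ, h⟩ := HasCardinalLT.exists_regular_cardinal.{w}
    (Σ p : Subobject Q × ι, Subobject ((F p.2).obj (cokernel p.1.arrow)))
  refine ⟨κ, ⟨hκ⟩, h.of_injective (fun i ↦ ⟨(⊥, i), ⊥⟩) (fun i j hij ↦ ?_), fun i N hN ↦ ?_⟩
  · simp only [Sigma.mk.injEq, Prod.mk.injEq, true_and] at hij
    exact hij.1
  · obtain ⟨R, ⟨e⟩⟩ := hN.exists_iso_cokernel
    refine h.of_injective (fun A ↦ ⟨(R, i), (Subobject.mapIsoToOrderIso ((F i).mapIso e)).symm A⟩)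
      (fun A B hAB ↦ ?_)
    simpa using hAB

lemma monotone_sup_iSup {α ι : Type*} [CompleteLattice α] (N : α) (A : ι → α) :
    Monotone (fun S : Set ι ↦ N ⊔ ⨆ i : S, A i) := fun S S' h ↦
  sup_le_sup_left (iSup_le fun i : S ↦ le_iSup (fun i : S' ↦ A i) (⟨i.1, h i.2⟩ : S')) _

lemma le_sup_iSup {α ι : Type*} [CompleteLattice α] (N : α) (A : ι → α) {S : Set ι} {i : ι}
    (hi : i ∈ S) : A i ≤ N ⊔ ⨆ i : S, A i :=
  (le_iSup (fun i : S ↦ A i) ⟨i, hi⟩).trans le_sup_right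

/-- Enlarging a subobject within a bounded size so as to kill the elements of `F i N` which vanish
in `F i X`. -/
lemma exists_subobject_kill_kernel {ι : Type w} (F : ι → C ⥤ D)
    [∀ i, PreservesFilteredColimitsOfSize.{w, w} (F i)] (Q : C) :
    ∃ Q' : C, ∀ (X : C) (N : Subobject X), IsQuotientOf Q (N : C) →
      ∃ (N' : Subobject X) (h : N ≤ N'), IsQuotientOf Q' (N' : C) ∧
        ∀ (i : ι) (W : D) (a : W ⟶ (F i).obj (N : C)), a ≫ (F i).map N.arrow = 0 →
          a ≫ (F i).map (Subobject.ofLE N N' h) = 0 := by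
  obtain ⟨κ, _, hι, hκ⟩ := exists_regular_cardinal_subobject F Q
  let G := separator C
  have hG : IsSeparator G := isSeparator_separator C
  refine ⟨Q ⨿ ∐ (fun _ : κ.ord.ToType ↦ G), fun X N hN ↦ ?_⟩
  -- `X` is the `κ`-filtered union of the subobjects generated by `N` and fewer than `κ` maps from
  -- the separator. Each of these is still small, with a bound independent of `X`.
  let J := CardinalDirectedPoset.SetCardinalLT κ (Shrink.{w} (G ⟶ X))
  have hJ : IsFiltered J := isFiltered_of_isCardinalFiltered _ κ
  let A (f : Shrink.{w} (G ⟶ X)) : Subobject X := imageSubobject ((equivShrink _).symm f)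
  let S : J ⥤ Subobject X :=
    ((monotone_sup_iSup N A).comp (Subtype.mono_coe _)).functor
  have hS : (⊤ : Subobject X) = ⨆ j, S.obj j := by
    refine (top_le_iff.1 ?_).symm
    rw [← Subobject.iSup_mk_image_eq_top hG]
    exact iSup_le fun f ↦ le_trans (le_sup_iSup N A (Set.mem_singleton f))
      (le_iSup S.obj (CardinalDirectedPoset.SetCardinalLT.singleton κ f))
  let hc := Subobject.isColimitCoconeOfLE S ⊤ (fun _ ↦ le_top) hS
  have hN₀ (j : J) : N ≤ S.obj j := le_sup_left
  let j₀ : J := hJ.nonempty.some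
  have H (i : ι) : ∃ j : J, kernel.ι ((F i).map N.arrow) ≫
      (F i).map (Subobject.ofLE N (S.obj j) (hN₀ j)) = 0 := by
    -- The kernel of `F i N ⟶ F i X` has fewer than `κ` subobjects, so a map from it which vanishes
    -- in the `κ`-filtered colimit vanishes at a single stage. As there are fewer than `κ` indices
    -- `i`, one stage then serves them all.
    obtain ⟨j, φ, h⟩ := IsGrothendieckAbelian.IsPresentable.injectivity₀ (κ := κ)
      (isColimitOfPreserves (F i) hc)
      (Subobject.hasCardinalLT_of_mono (hκ i _ hN) (kernel.ι ((F i).map N.arrow)))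
      (j₀ := j₀) (kernel.ι ((F i).map N.arrow) ≫
        (F i).map (Subobject.ofLE N (S.obj j₀) (hN₀ j₀))) (by
          have : IsIso (⊤ : Subobject X).arrow := by infer_instance
          refine (cancel_mono ((F i).map (⊤ : Subobject X).arrow)).1 ?_
          have : (F i).map (Subobject.ofLE N (S.obj j₀) (hN₀ j₀)) ≫
              (F i).map (Subobject.ofLE (S.obj j₀) ⊤ le_top) ≫
                (F i).map (⊤ : Subobject X).arrow = (F i).map N.arrow := by
            simp only [← Functor.map_comp, Subobject.ofLE_arrow]
          refine Eq.trans ?_ ((kernel.condition ((F i).map N.arrow)).trans zero_comp.symm)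
          exact (Category.assoc _ _ _).trans ((Category.assoc _ _ _).trans
            (congr_arg (kernel.ι ((F i).map N.arrow) ≫ ·) this)))
    refine ⟨j, ?_⟩
    rw [Category.assoc] at h
    rw [← h, ← Subobject.ofLE_comp_underlying_map (hN₀ j₀) (S.map φ), Functor.map_comp]
    rfl
  choose j hj using H
  let j' : J := IsCardinalFiltered.max j hι
  refine ⟨S.obj j', hN₀ j', ?_, fun i W a ha ↦ ?_⟩
  · obtain ⟨e⟩ : Nonempty (j'.1 ↪ κ.ord.ToType) := by
      have := j'.2
      rw [hasCardinalLT_iff_cardinal_mk_lt] at this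
      rw [← Cardinal.le_def]
      simpa using this.le
    exact hN.sup ((IsQuotientOf.sigma_of_injective e e.injective G).trans
      (.iSup fun f ↦ .imageSubobject _))
  · have : Subobject.ofLE N (S.obj j') (hN₀ j') = Subobject.ofLE N (S.obj (j i)) (hN₀ _) ≫
        Subobject.ofLE _ _ (leOfHom (S.map (IsCardinalFiltered.toMax j hι i))) := by
      simp [j']
    rw [this, Functor.map_comp, ← kernel.lift_ι _ a ha, Category.assoc, reassoc_of% (hj i),
      zero_comp, comp_zero]

/-- By exactness of filtered colimits, the kernel of `f` is covered by the colimit of the kernels of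
`Y j ⟶ Z`, and the hypothesis says that these map to zero in `c.pt`. -/
lemma mono_of_isColimit_of_comp_eq_zero {J : Type w} [SmallCategory J] [IsFiltered J]
    {Y : J ⥤ D} {c : Cocone Y} (hc : IsColimit c) {Z : D} (f : c.pt ⟶ Z)
    (h : ∀ (j : J) (W : D) (a : W ⟶ Y.obj j), a ≫ c.ι.app j ≫ f = 0 → a ≫ c.ι.app j = 0) :
    Mono f := by
  have := IsFiltered.isConnected J
  let α : Y ⟶ (Functor.const J).obj Z :=
    { app j := c.ι.app j ≫ f
      naturality i j φ := by simp }
  have hS : (ShortComplex.mk _ _ (kernel.condition α)).Exact :=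
    ShortComplex.exact_of_f_is_kernel _ (kernelIsKernel α)
  refine (colim.exact_mapShortComplex hS (colimit.isColimit _) hc (isColimitConstCocone J Z)
    0 f (fun j ↦ ?_) (fun j ↦ ?_)).mono_g rfl
  · have : (kernel.ι α).app j ≫ (c.ι.app j ≫ f) = 0 :=
      NatTrans.congr_app (kernel.condition α) j
    rw [comp_zero]
    exact (h j _ _ this).symm
  · exact (Category.comp_id _).symm

/-- A Löwenheim–Skolem theorem: if the functors `F i` preserve filtered colimits, any subobject `N`
of bounded size of an object `X` is contained in a subobject `N'` of bounded size such that all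
the maps `F i N' ⟶ F i X` are monomorphisms. -/
theorem exists_subobject_mono_map {ι : Type w} (F : ι → C ⥤ D)
    [∀ i, PreservesFilteredColimitsOfSize.{w, w} (F i)] (Q : C) :
    ∃ Q' : C, ∀ (X : C) (N : Subobject X), IsQuotientOf Q (N : C) →
      ∃ (N' : Subobject X), N ≤ N' ∧ IsQuotientOf Q' (N' : C) ∧
        ∀ i, Mono ((F i).map N'.arrow) := by
  choose next hnext using exists_subobject_kill_kernel F
  -- Kill kernels countably many times and take the union. The bound at step `n` depends on `n` and
  -- `Q` only, so the coproduct of these bounds works for all `X` and `N`.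
  let Qs (n : ℕ) : C := next^[n] Q
  refine ⟨∐ fun n : ULift.{w} ℕ ↦ Qs n.down, fun X N hN ↦ ?_⟩
  choose g hg₁ hg₂ hg₃ using fun (n : ℕ) (M : {M : Subobject X // IsQuotientOf (Qs n) (M : C)}) ↦
    hnext (Qs n) X M.1 M.2
  let T (n : ℕ) : {M : Subobject X // IsQuotientOf (Qs n) (M : C)} :=
    Nat.rec ⟨N, hN⟩ (fun n M ↦ ⟨g n M, by
      simpa only [Qs, Function.iterate_succ_apply'] using hg₂ n M⟩) n
  have hT : Monotone fun n ↦ (T n).1 := monotone_nat_of_le_succ fun n ↦ hg₁ n (T n)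
  let S : ULift.{w} ℕ ⥤ Subobject X :=
    (hT.comp (f := (ULift.down : ULift.{w} ℕ → ℕ)) fun _ _ h ↦ h).functor
  let A : Subobject X := ⨆ n : ULift.{w} ℕ, (T n.down).1
  have hA (n) : S.obj n ≤ A := le_iSup (fun n : ULift.{w} ℕ ↦ (T n.down).1) n
  refine ⟨A, hA ⟨0⟩, IsQuotientOf.iSup fun n ↦ (T n.down).2, fun i ↦ ?_⟩
  let hc := Subobject.isColimitCoconeOfLE S A hA rfl
  refine mono_of_isColimit_of_comp_eq_zero (isColimitOfPreserves (F i) hc)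
    ((F i).map A.arrow) ?_
  have hA' (n : ℕ) : (T n).1 ≤ A := hA ⟨n⟩
  -- What dies in `F i X` from stage `n` already dies at stage `n + 1`, hence in the union.
  have key (n : ℕ) (W : D) (a : W ⟶ (F i).obj ((T n).1 : C))
      (ha : a ≫ (F i).map (Subobject.ofLE (T n).1 A (hA' n)) ≫ (F i).map A.arrow = 0) :
      a ≫ (F i).map (Subobject.ofLE (T n).1 A (hA' n)) = 0 := by
    rw [← Functor.map_comp, Subobject.ofLE_arrow] at ha
    rw [← Subobject.ofLE_comp_ofLE (T n).1 (T (n + 1)).1 A (hg₁ n (T n)) (hA' (n + 1)),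
      Functor.map_comp]
    have := hg₃ n (T n) i W a ha
    exact (Category.assoc _ _ _).symm.trans ((congr_arg (· ≫ _) this).trans zero_comp)
  exact fun n ↦ key n.down

end

end CategoryTheory

end

/-! ### Opcycles, acyclicity and monomorphic quasi-isomorphisms -/

noncomputable section

namespace HomologicalComplex

variable {B : Type u} [Category.{v} B] [Abelian B] {ι : Type*} {c : ComplexShape ι}

section

variable {J : Type*} [Category J]

/-- Opcycles are cokernels of differentials, so they commute with every colimit that is computed
degreewise. -/
instance preservesColimit_opcyclesFunctor (F : J ⥤ HomologicalComplex B c) (i : ι)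
    [∀ i, PreservesColimit F (eval B c i)] :
    PreservesColimit F (opcyclesFunctor B c i) where
  preserves {cc} hcc := by
    let h (i) := isColimitOfPreserves (eval B c i) hcc
    have hd (s : Cocone (F ⋙ opcyclesFunctor B c i)) : ∃ φ : cc.pt.opcycles i ⟶ s.pt,
        ∀ j, (cc.ι.app j).f i ≫ cc.pt.pOpcycles i ≫ φ =
          (F.obj j).pOpcycles i ≫ s.ι.app j := by
      let s' : Cocone (F ⋙ eval B c i) :=
        { pt := s.pt
          ι :=
            { app j := (F.obj j).pOpcycles i ≫ s.ι.app j
              naturality j j' f := by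
                have h₁ : opcyclesMap (F.map f) i ≫ s.ι.app j' = s.ι.app j := s.w f
                have h₂ := p_opcyclesMap_assoc (F.map f) i (s.ι.app j')
                rw [h₁] at h₂
                exact h₂.symm.trans (Category.comp_id _).symm } }
      have hs' (j : J) : (cc.ι.app j).f i ≫ (h i).desc s' = (F.obj j).pOpcycles i ≫ s.ι.app j :=
        (h i).fac s' j
      have hd' (k : cc.pt.X i ⟶ s.pt) (hk : ∀ j, (cc.ι.app j).f i ≫ k =
          (F.obj j).pOpcycles i ≫ s.ι.app j) : cc.pt.d (c.prev i) i ≫ k = 0 :=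
        (h _).hom_ext fun j ↦ by
          refine ((cc.ι.app j).comm_assoc _ _ k).trans ?_
          refine Eq.trans ?_ comp_zero.symm
          rw [hk]
          exact (((F.obj j).d_pOpcycles_assoc _ _ _).trans zero_comp)
      refine ⟨cc.pt.descOpcycles ((h i).desc s') (c.prev i) rfl (hd' _ hs'), fun j ↦ ?_⟩
      exact (congr_arg _ (p_descOpcycles _ _ _ _ _)).trans (hs' j)
    choose φ hφ using hd
    exact
      ⟨{desc := φ
        fac s j := by
          refine (cancel_epi ((F.obj j).pOpcycles i)).1 ?_
          exact (p_opcyclesMap_assoc _ _ _).trans (hφ s j)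
        uniq s m hm := by
          refine (cancel_epi (cc.pt.pOpcycles i)).1 ((h i).hom_ext fun j ↦ ?_)
          refine Eq.trans ?_ (hφ s j).symm
          rw [← hm j]
          exact (p_opcyclesMap_assoc _ _ _).symm }⟩

instance preservesColimitsOfShape_opcyclesFunctor (i : ι) [HasColimitsOfShape J B] :
    PreservesColimitsOfShape J (opcyclesFunctor B c i) where

end

lemma exactAt_iff_mono_fromOpcycles (K : HomologicalComplex B c) (i : ι) :
    K.ExactAt i ↔ Mono (K.fromOpcycles i (c.next i)) :=
  ShortComplex.exact_iff_mono_fromOpcycles _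

@[simp]
lemma opcyclesMap_fromOpcycles {K L : HomologicalComplex B c} (f : K ⟶ L) (i j : ι) :
    opcyclesMap f i ≫ L.fromOpcycles i j = K.fromOpcycles i j ≫ f.f j := by
  simp [← cancel_epi (K.pOpcycles i)]

/-- Acyclicity means that opcycles embed in the next term. The composite of the map on opcycles with
the embedding for `L` is monic and factors through the map for `K`. Thus a subobject closed up for
the opcycles functors inherits acyclicity. -/
lemma Acyclic.of_mono_opcyclesMap {K L : HomologicalComplex B c} (hL : L.Acyclic) (f : K ⟶ L)
    [∀ i, Mono (opcyclesMap f i)] : K.Acyclic := fun i ↦ by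
  have := (exactAt_iff_mono_fromOpcycles L i).1 (hL i)
  rw [exactAt_iff_mono_fromOpcycles]
  have fac : K.fromOpcycles i (c.next i) ≫ f.f _ = opcyclesMap f i ≫ L.fromOpcycles i _ := by
    simp
  have : Mono (K.fromOpcycles i (c.next i) ≫ f.f _) := by
    rw [fac]
    infer_instance
  exact mono_of_mono _ (f.f _)

lemma Acyclic.of_isColimit {J : Type*} [Category J] [HasColimitsOfShape J B]
    [(colim : (J ⥤ B) ⥤ B).PreservesMonomorphisms]
    {F : J ⥤ HomologicalComplex B c} {cc : Cocone F}
    (hcc : IsColimit cc) (hF : ∀ j, (F.obj j).Acyclic) : cc.pt.Acyclic := fun i ↦ by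
  have hF' (j : J) := (exactAt_iff_mono_fromOpcycles _ i).1 (hF j i)
  rw [exactAt_iff_mono_fromOpcycles]
  let τ : F ⋙ opcyclesFunctor B c i ⟶ F ⋙ eval B c (c.next i) :=
    { app j := (F.obj j).fromOpcycles i (c.next i)
      naturality j j' f := opcyclesMap_fromOpcycles _ _ _ }
  have : ∀ j, Mono (τ.app j) := hF'
  have := NatTrans.mono_of_mono_app τ
  refine colim.map_mono' τ (isColimitOfPreserves (opcyclesFunctor B c i) hcc)
    (isColimitOfPreserves (eval B c (c.next i)) hcc) _
    fun j ↦ opcyclesMap_fromOpcycles _ _ _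

lemma Acyclic.of_iso {K L : HomologicalComplex B c} (e : K ≅ L) (hK : K.Acyclic) : L.Acyclic :=
  fun i ↦ (exactAt_iff_of_quasiIsoAt e.hom i).1 (hK i)

lemma Acyclic.of_isZero {K : HomologicalComplex B c} (hK : IsZero K) : K.Acyclic := fun i ↦ by
  rw [exactAt_iff_isZero_homology]
  exact (homologyFunctor _ _ i).map_isZero hK

lemma acyclic_X₃_iff_quasiIso {S : ShortComplex (HomologicalComplex B c)} (hS : S.ShortExact) :
    S.X₃.Acyclic ↔ QuasiIso S.f := by
  refine ⟨fun h ↦ ⟨fun i ↦ ?_⟩, hS.acyclic_X₃⟩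
  have h (i) := (exactAt_iff_isZero_homology _ _).1 (h i)
  rw [quasiIsoAt_iff_isIso_homologyMap]
  have : Epi (homologyMap S.f i) := (hS.homology_exact₂ i).epi_f ((h i).eq_of_tgt _ _)
  have : Mono (homologyMap S.f i) := by
    by_cases! hi : ∃ j, c.Rel j i
    · obtain ⟨j, hij⟩ := hi
      exact (hS.homology_exact₁ j i hij).mono_g ((h j).eq_of_src _ _)
    · have := hS.mono_f
      exact HomologicalComplex.mono_homologyMap_of_mono_of_not_rel S.f i hi
  exact isIso_of_mono_of_epi _

/-- Quasi-isomorphisms which are monomorphisms. -/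
def monoQuasiIso (B : Type u) [Category.{v} B] [Abelian B] (c : ComplexShape ι) :
    MorphismProperty (HomologicalComplex B c) :=
  MorphismProperty.monomorphisms _ ⊓ quasiIso B c

lemma monoQuasiIso_iff {K L : HomologicalComplex B c} (f : K ⟶ L) :
    monoQuasiIso B c f ↔ Mono f ∧ (cokernel f).Acyclic := by
  refine and_congr_right fun (h : Mono f) ↦ ?_
  exact (acyclic_X₃_iff_quasiIso (S := .mk _ _ (cokernel.condition f))
    { exact := ShortComplex.exact_of_g_is_cokernel _ (cokernelIsCokernel f) }).symm

namespace monoQuasiIso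

instance : (monoQuasiIso B c).IsMultiplicative := by
  dsimp [monoQuasiIso]; infer_instance

instance : (monoQuasiIso B c).IsStableUnderRetracts := by
  dsimp [monoQuasiIso]; infer_instance

instance : (monoQuasiIso B c).RespectsIso := by
  dsimp [monoQuasiIso]; infer_instance

/-- A pushout square induces an isomorphism on cokernels, so acyclicity of the cokernel is
preserved. -/
instance : (monoQuasiIso B c).IsStableUnderCobaseChange where
  of_isPushout {_ _ _ _ f g f' g'} sq hl := by
    rw [monoQuasiIso_iff] at hl ⊢
    have := isIso_cokernel_map_of_isPushout sq.flip
    exact ⟨(MorphismProperty.monomorphisms _).of_isPushout sq hl.1,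
      hl.2.of_iso (asIso (cokernel.map f f' g g' sq.w.symm))⟩

instance {J : Type*} [Category J] [HasColimitsOfShape J B] [HasExactColimitsOfShape J B] :
    (monoQuasiIso B c).IsStableUnderColimitsOfShape J where
  condition X₁ X₂ c₁ c₂ hc₁ hc₂ f hf φ hφ := by
    have hf' (j) := (monoQuasiIso_iff _).1 (hf j)
    have (j : J) : Mono (f.app j) := (hf' j).1
    have : Mono φ := by
      refine mono_of_mono_f _ fun i ↦ ?_
      have : Mono (Functor.whiskerRight f (eval B c i)) := by
        have (j : J) : Mono ((Functor.whiskerRight f (eval B c i)).app j) := by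
          dsimp; infer_instance
        exact NatTrans.mono_of_mono_app _
      exact colim.map_mono' (Functor.whiskerRight f (eval B c i))
        (isColimitOfPreserves (eval B c i) hc₁) (isColimitOfPreserves (eval B c i) hc₂) (φ.f i)
        fun j ↦ congr_arg (fun k ↦ k.f i) (hφ j)
    -- Cokernels commute with colimits, so the cokernel of `φ` is the colimit of the acyclic
    -- cokernels of the `f.app j`.
    let c₃ := colimit.cocone (cokernel f)
    let hc₃ : IsColimit c₃ := colimit.isColimit _
    let g : c₂.pt ⟶ c₃.pt := hc₂.desc ((Cocone.precompose (cokernel.π f)).obj c₃)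
    have hg (j) : c₂.ι.app j ≫ g = (cokernel.π f).app j ≫ c₃.ι.app j := hc₂.fac _ j
    have hφ' (j) : c₁.ι.app j ≫ φ = f.app j ≫ c₂.ι.app j := by simp [hφ]
    have zero : φ ≫ g = 0 := hc₁.hom_ext fun j ↦ by
      rw [reassoc_of% hφ', hg, comp_zero]
      have := NatTrans.congr_app (cokernel.condition f) j
      dsimp at this
      rw [reassoc_of% this, zero_comp]
    have : Epi g := ⟨fun a b h ↦ hc₃.hom_ext fun j ↦ by
      rw [← cancel_epi ((cokernel.π f).app j), ← reassoc_of% hg, h, reassoc_of% hg]⟩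
    have hS : (ShortComplex.mk φ g zero).ShortExact :=
      { exact := by
          have (Z) (k : c₂.pt ⟶ Z) (hk : φ ≫ k = 0) : ∃ l : c₃.pt ⟶ Z, g ≫ l = k := by
            let m : X₂ ⟶ (Functor.const J).obj Z :=
              { app j := c₂.ι.app j ≫ k
                naturality := by simp }
            have hm : f ≫ m = 0 := by
              ext j : 2
              dsimp [m]
              rw [← reassoc_of% hφ', hk, comp_zero]
            refine ⟨hc₃.desc ⟨Z, cokernel.desc f m hm⟩, hc₂.hom_ext fun j ↦ ?_⟩
            rw [reassoc_of% hg, hc₃.fac]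
            exact NatTrans.congr_app (cokernel.π_desc f m hm) j
          choose l hl using this
          exact ShortComplex.exact_of_g_is_cokernel _ (CokernelCofork.IsColimit.ofπ' _ _
            fun k hk ↦ ⟨l _ k hk, hl _ k hk⟩) }
    refine ⟨‹Mono φ›, (acyclic_X₃_iff_quasiIso hS).1 (Acyclic.of_isColimit hc₃ fun j ↦
      (hf' j).2.of_iso ?_)⟩
    exact (PreservesCokernel.iso ((evaluation _ _).obj j) f).symm

instance [HasFilteredColimitsOfSize.{w, w} B] [AB5OfSize.{w, w} B] :
    MorphismProperty.IsStableUnderFilteredColimits.{w, w} (monoQuasiIso B c) where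
  isStableUnderColimitsOfShape J _ _ := by infer_instance

end monoQuasiIso

end HomologicalComplex

end

/-! ### Further size bounds -/

noncomputable section

namespace CategoryTheory

section

variable {C : Type u} [Category.{v} C] [Abelian C]

/-- The cokernel of `inl` agrees with the cokernel of `i`, which is `N`. -/
lemma exact_of_isPushout {A₀ A B₀ B N : C} {f : A₀ ⟶ A} {i : A₀ ⟶ B₀} {inl : A ⟶ B}
    {inr : B₀ ⟶ B} (sq : IsPushout f i inl inr) {q : B₀ ⟶ N} [Epi q] {w : i ≫ q = 0}
    (hq : (ShortComplex.mk i q w).Exact) (r : B ⟶ N) (hr : inr ≫ r = q) (w' : inl ≫ r = 0) :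
    (ShortComplex.mk inl r w').Exact := by
  have := epi_of_epi_fac hr
  have H (Z : C) (k : B ⟶ Z) (hk : inl ≫ k = 0) : ∃ l : N ⟶ Z, r ≫ l = k := by
    have h : i ≫ inr ≫ k = 0 := by rw [← sq.w_assoc, hk, comp_zero]
    have : Epi (ShortComplex.mk i q w).g := ‹Epi q›
    refine ⟨hq.desc _ h, sq.hom_ext ?_ ?_⟩
    · rw [reassoc_of% w', hk, zero_comp]
    · rw [reassoc_of% hr]
      exact hq.g_desc _ h
  choose l hl using H
  exact ShortComplex.exact_of_g_is_cokernel _ (CokernelCofork.IsColimit.ofπ' _ _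
    fun k hk ↦ ⟨l _ k hk, hl _ k hk⟩)

namespace IsQuotientOf

lemma of_coprod {Q Q' A B Z : C} (h : IsQuotientOf Q A) (h' : IsQuotientOf Q' B)
    (a : A ⟶ Z) (b : B ⟶ Z) (hab : ∀ (W : C) (k : Z ⟶ W), a ≫ k = 0 → b ≫ k = 0 → k = 0) :
    IsQuotientOf (Q ⨿ Q') Z := by
  obtain ⟨f, _⟩ := h
  obtain ⟨f', _⟩ := h'
  have : Epi (coprod.desc (f ≫ a) (f' ≫ b)) := Preadditive.epi_of_cancel_zero _ fun k hk ↦ by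
    have h₁ := coprod.inl ≫= hk
    have h₂ := coprod.inr ≫= hk
    rw [coprod.inl_desc_assoc, Category.assoc, comp_zero] at h₁
    rw [coprod.inr_desc_assoc, Category.assoc, comp_zero] at h₂
    refine hab _ k ?_ ?_
    · rwa [← comp_zero (f := f), cancel_epi] at h₁
    · rwa [← comp_zero (f := f'), cancel_epi] at h₂
  exact .of_epi (coprod.desc (f ≫ a) (f' ≫ b))

variable [IsGrothendieckAbelian.{w} C]

/-- Epimorphisms onto objects of bounded size can be covered by an object of bounded size. -/
lemma exists_epi_comp (Q : C) : ∃ Q' : C, ∀ (P N : C) (p : P ⟶ N) [Epi p], IsQuotientOf Q N →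
    ∃ k : Q' ⟶ P, Epi (k ≫ p) := by
  let G := separator C
  have hG : IsSeparator G := isSeparator_separator C
  refine ⟨∐ fun _ : Shrink.{w} (Subobject Q) ↦ G, fun P N p _ ⟨f, _⟩ ↦ ?_⟩
  let q (R : Subobject Q) : N ⟶ cokernel (R.arrow ≫ f) := cokernel.π _
  -- For each `R`, one map from the separator detects whether the image of `R` in `N` is proper. The
  -- sum of these maps over the small set of all `R` is the required `k`.
  have hg (R : Subobject Q) : ∃ g : G ⟶ P, p ≫ q R ≠ 0 → g ≫ p ≫ q R ≠ 0 := by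
    by_cases! h : p ≫ q R = 0
    · exact ⟨0, fun h' ↦ (h' h).elim⟩
    · by_contra! h'
      exact h ((Preadditive.isSeparator_iff _).1 hG _ fun g ↦ (h' g).2)
  choose g hg using hg
  refine ⟨Limits.Sigma.desc fun R ↦ g ((equivShrink _).symm R),
    Abelian.epi_of_cokernel_π_eq_zero _ ?_⟩
  set k : (∐ fun _ : Shrink.{w} (Subobject Q) ↦ G) ⟶ P :=
    Limits.Sigma.desc fun R ↦ g ((equivShrink _).symm R) with hk
  let c := cokernel.π (k ≫ p)
  have hc : k ≫ p ≫ c = 0 := by rw [← Category.assoc]; exact cokernel.condition _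
  let t : kernel (f ≫ c) ⟶ Q := kernel.ι (f ≫ c)
  -- Take for `R` the preimage in `Q` of the image of `k ≫ p`. If that image were proper, `g R`
  -- would leave it, although `g R` is a component of `k`.
  let R : Subobject Q := Subobject.mk t
  have hg' : g R ≫ p ≫ c = 0 := by
    have := Limits.Sigma.ι (fun _ : Shrink.{w} (Subobject Q) ↦ G) (equivShrink _ R) ≫= hc
    simpa [hk] using this
  have hR : R.arrow ≫ f ≫ c = 0 := by
    rw [← cancel_epi (Subobject.underlyingIso t).inv]
    simp [R, t]
  have ht : t ≫ f ≫ q R = 0 := by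
    have : t = (Subobject.underlyingIso t).inv ≫ R.arrow := by simp [R]
    rw [this, Category.assoc, ← Category.assoc R.arrow]
    simp [q]
  have : Epi (f ≫ c) := epi_comp _ _
  have hl : c ≫ Abelian.epiDesc (f ≫ c) (f ≫ q R) ht = q R := by
    rw [← cancel_epi f, ← Category.assoc]
    exact Abelian.comp_epiDesc (f ≫ c) (f ≫ q R) ht
  have h₁ : p ≫ q R = 0 := by
    by_contra h
    refine hg R h ?_
    rw [← hl, reassoc_of% hg', zero_comp]
  rw [← comp_zero (f := p), cancel_epi] at h₁
  have : Epi (R.arrow ≫ f) := Abelian.epi_of_cokernel_π_eq_zero _ h₁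
  rw [← cancel_epi (R.arrow ≫ f), Category.assoc]
  simpa using hR

/-- A subobject of a quotient of `Q` is a quotient of its preimage in `Q`. The coproduct of all
subobjects of `Q` projects onto each of them. -/
lemma exists_of_mono (Q : C) : ∃ Q' : C, ∀ (Z A : C) (i : A ⟶ Z) [Mono i], IsQuotientOf Q Z →
    IsQuotientOf Q' A := by
  classical
  let o (R : Shrink.{w} (Subobject Q)) : C :=
    (((equivShrink (Subobject Q)).symm R : Subobject Q) : C)
  refine ⟨∐ o, fun Z A i _ ⟨f, _⟩ ↦ ?_⟩
  let R : Subobject Q := Subobject.mk (pullback.snd i f)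
  refine .trans (.of_epi (Limits.Sigma.π o (equivShrink _ R)))
    (.of_epi (eqToHom (by simp [o, R]) ≫ (Subobject.underlyingIso (pullback.snd i f)).hom ≫
      pullback.fst i f))

end IsQuotientOf

end

section

variable {C : Type u} [Category.{v} C] [Abelian C] [IsGrothendieckAbelian.{w} C]
  {B : Type u'} [Category.{v'} B] [Abelian B] [IsGrothendieckAbelian.{w} B] {σ : Type w}

open HomologicalComplex

/-- Löwenheim–Skolem for the terms and the opcycles of all `T s` at once. Monicity on terms turns
sequences into short exact ones after applying `T s`; monicity on opcycles makes `T s N'` acyclic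
when `T s X` is. -/
lemma exists_subobject_mono_opcyclesMap (T : σ → C ⥤ ChainComplex B ℤ)
    [∀ s, PreservesFilteredColimitsOfSize.{w, w} (T s)] (Q : C) :
    ∃ Q' : C, ∀ (X : C) (N : Subobject X), IsQuotientOf Q (N : C) →
      ∃ N' : Subobject X, N ≤ N' ∧ IsQuotientOf Q' (N' : C) ∧
        ∀ s, Mono ((T s).map N'.arrow) ∧ ∀ i, Mono (opcyclesMap ((T s).map N'.arrow) i) := by
  let F (i : ULift.{w} ((σ × ℤ) ⊕ (σ × ℤ))) : C ⥤ B :=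
    Sum.elim (fun p : σ × ℤ ↦ T p.1 ⋙ HomologicalComplex.eval B (ComplexShape.down ℤ) p.2)
      (fun p : σ × ℤ ↦ T p.1 ⋙ opcyclesFunctor B _ p.2) i.down
  have (i : ULift.{w} ((σ × ℤ) ⊕ (σ × ℤ))) : PreservesFilteredColimitsOfSize.{w, w} (F i) := by
    obtain ⟨⟨s, n⟩ | ⟨s, n⟩⟩ := i
    · exact ⟨fun J _ _ ↦ inferInstanceAs (PreservesColimitsOfShape J
        (T s ⋙ HomologicalComplex.eval B (ComplexShape.down ℤ) n))⟩
    · exact ⟨fun J _ _ ↦ inferInstanceAs (PreservesColimitsOfShape J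
        (T s ⋙ opcyclesFunctor B _ n))⟩
  obtain ⟨Q', hQ'⟩ := exists_subobject_mono_map F Q
  refine ⟨Q', fun X N hN ↦ ?_⟩
  obtain ⟨N', h₁, h₂, h₃⟩ := hQ' X N hN
  refine ⟨N', h₁, h₂, fun s ↦ ⟨?_, fun i ↦ h₃ ⟨Sum.inr (s, i)⟩⟩⟩
  have (i : ℤ) : Mono (((T s).map N'.arrow).f i) := h₃ ⟨Sum.inl (s, i)⟩
  exact mono_of_mono_f _ this

end

end CategoryTheory

end

/-! ### Enlarging acyclic subobjects by small pushouts -/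

noncomputable section

namespace CategoryTheory

open HomologicalComplex

section

variable {C : Type u} [Category.{v} C] [Abelian C]
  {B : Type u'} [Category.{v'} B] [Abelian B] {σ : Type w}
  (T : σ → C ⥤ ChainComplex B ℤ)

/-- The objects all of whose images under a family of functors are acyclic. -/
def jointlyAcyclic : ObjectProperty C := fun X ↦ ∀ s, ((T s).obj X).Acyclic

/-- The morphisms all of whose images under a family of functors are monomorphisms with acyclic
cokernel. -/
def jointlyMonoQuasiIso : MorphismProperty C := fun _ _ f ↦
  ∀ s, monoQuasiIso B (ComplexShape.down ℤ) ((T s).map f)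

/-- Acyclic subobjects, for a family of functors, whose inclusions become monomorphisms. -/
structure IsAcyclicSubobject {X : C} (A : Subobject X) : Prop where
  mono s : Mono ((T s).map A.arrow)
  acyclic : jointlyAcyclic T (A : C)

variable {T}

section

variable [∀ s, (T s).PreservesZeroMorphisms] [∀ s, PreservesFiniteColimits (T s)]

/-- `T s` is only right exact; monicity of the image of `S.f` supplies the missing exactness on the
left. -/
lemma shortExact_map {S : ShortComplex C} (hS : S.Exact) [Epi S.g] (s : σ)
    [Mono ((T s).map S.f)] : (S.map (T s)).ShortExact where
  exact := hS.map_of_epi_of_preservesCokernel (T s) inferInstance inferInstance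
  mono_f := inferInstanceAs (Mono ((T s).map S.f))
  epi_g := inferInstanceAs (Epi ((T s).map S.g))

lemma acyclic_map_X₃ {S : ShortComplex C} (hS : S.Exact) [Epi S.g] (s : σ)
    [Mono ((T s).map S.f)] (h₁ : ((T s).obj S.X₁).Acyclic) (h₂ : ((T s).obj S.X₂).Acyclic) :
    ((T s).obj S.X₃).Acyclic := by
  refine (shortExact_map hS s).acyclic_X₃ ⟨fun i ↦ ?_⟩
  exact (quasiIsoAt_iff_exactAt ((T s).map S.f) i (h₁ i)).2 (h₂ i)

end

end

section

variable {C : Type u} [Category.{w} C] [Abelian C]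
  {B : Type u'} [Category.{v'} B] [Abelian B] {σ : Type w}
  (T : σ → C ⥤ ChainComplex B ℤ)

/-- Morphisms between cokernels of subobjects of a fixed object `Q` which are monomorphisms and
whose images under a family of functors are monomorphisms with acyclic cokernel. -/
def boundedMonoQuasiIso (Q : C) : MorphismProperty C :=
  MorphismProperty.ofHoms
    (fun (t : Σ (R R' : Subobject Q),
      { f : cokernel R.arrow ⟶ cokernel R'.arrow // Mono f ∧ jointlyMonoQuasiIso T f }) ↦ t.2.2.1)

instance [IsGrothendieckAbelian.{w} C] (Q : C) :
    MorphismProperty.IsSmall.{w} (boundedMonoQuasiIso T Q) := by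
  dsimp only [boundedMonoQuasiIso]
  infer_instance

lemma boundedMonoQuasiIso_le_monomorphisms (Q : C) :
    boundedMonoQuasiIso T Q ≤ MorphismProperty.monomorphisms C := by
  rintro _ _ _ ⟨t⟩
  exact t.2.2.2.1

lemma boundedMonoQuasiIso_le (Q : C) : boundedMonoQuasiIso T Q ≤ jointlyMonoQuasiIso T := by
  rintro _ _ _ ⟨t⟩
  exact t.2.2.2.2

variable {T}

lemma pushouts_boundedMonoQuasiIso {Q A' B' A Z : C} {i : A' ⟶ B'} {f : A' ⟶ A} {g : B' ⟶ Z}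
    {j : A ⟶ Z} (sq : IsPushout f i j g) [Mono i] (hi : jointlyMonoQuasiIso T i)
    (hA' : IsQuotientOf Q A') (hB' : IsQuotientOf Q B') :
    (boundedMonoQuasiIso T Q).pushouts j := by
  obtain ⟨R, ⟨e⟩⟩ := hA'.exists_iso_cokernel
  obtain ⟨R', ⟨e'⟩⟩ := hB'.exists_iso_cokernel
  have hi' : jointlyMonoQuasiIso T (e.hom ≫ i ≫ e'.inv) := fun s ↦ by
    refine ((monoQuasiIso _ _).arrow_mk_iso_iff ?_).2 (hi s)
    exact Arrow.isoMk ((T s).mapIso e) ((T s).mapIso e') (by simp [← Functor.map_comp])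
  refine ⟨_, _, _, e.hom ≫ f, e'.hom ≫ g, ⟨(⟨R, R', ⟨e.hom ≫ i ≫ e'.inv, inferInstance, hi'⟩⟩ :
      Σ (R R' : Subobject Q),
        { f : cokernel R.arrow ⟶ cokernel R'.arrow // Mono f ∧ jointlyMonoQuasiIso T f })⟩, ?_⟩
  exact sq.of_iso e.symm (Iso.refl _) e'.symm (Iso.refl _) (by simp) (by simp) (by simp) (by simp)

section

variable [IsGrothendieckAbelian.{w} C] [IsGrothendieckAbelian.{w} B]
  [∀ s, PreservesColimitsOfSize.{w, w} (T s)]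

variable (T) in
/-- If `X` is an object all of whose images under a family of functors are acyclic, a proper acyclic
subobject of `X` can be enlarged by pushing out a morphism of bounded size. -/
lemma exists_larger_acyclicSubobject [∀ s, PreservesFiniteColimits (T s)]
    [∀ s, (T s).PreservesZeroMorphisms] :
    ∃ Q : C, ∀ (X : C) (_ : jointlyAcyclic T X) (A : Subobject X) (_ : IsAcyclicSubobject T A)
      (_ : A ≠ ⊤), ∃ (A' : Subobject X) (h : A < A'), IsAcyclicSubobject T A' ∧
        (boundedMonoQuasiIso T Q).pushouts (Subobject.ofLE A A' h.le) := by
  -- `Q₁` bounds an acyclic nonzero piece `N` of `X / A`, `Q₂` a subobject `B₀` of `X` mapping onto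
  -- `N`, `Q₃` the intersection of `B₀` with `A`, and `Q₄` an acyclic subobject `A'` of `A`
  -- containing this intersection.
  obtain ⟨Q₁, hQ₁⟩ := exists_subobject_mono_opcyclesMap T (separator C)
  obtain ⟨Q₂, hQ₂⟩ := IsQuotientOf.exists_epi_comp Q₁
  obtain ⟨Q₃, hQ₃⟩ := IsQuotientOf.exists_of_mono Q₂
  obtain ⟨Q₄, hQ₄⟩ := exists_subobject_mono_opcyclesMap T Q₃
  refine ⟨Q₄ ⨿ Q₂, fun X hX A hA hA' ↦ ?_⟩
  have := hA.mono
  let π := cokernel.π A.arrow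
  have hπ : (ShortComplex.mk _ _ (cokernel.condition A.arrow)).Exact :=
    ShortComplex.exact_of_g_is_cokernel _ (cokernelIsCokernel _)
  have hY : jointlyAcyclic T (cokernel A.arrow) := fun s ↦
    acyclic_map_X₃ hπ s (hA.acyclic s) (hX s)
  obtain ⟨g, hg⟩ : ∃ g : separator C ⟶ X, g ≫ π ≠ 0 := by
    by_contra! h
    have h := (Preadditive.isSeparator_iff _).1 (isSeparator_separator C) _ h
    have : Epi A.arrow := Abelian.epi_of_cokernel_π_eq_zero _ h
    exact hA' ((Subobject.isIso_arrow_iff_eq_top A).1 (isIso_of_mono_of_epi _))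
  obtain ⟨N, hN₁, hN₂, hN₃⟩ := hQ₁ _ _ (IsQuotientOf.imageSubobject (g ≫ π))
  have hN (s) := (hN₃ s).1
  have hN' : jointlyAcyclic T (N : C) := fun s ↦ by
    have := (hN₃ s).2
    exact Acyclic.of_mono_opcyclesMap (hY s) ((T s).map N.arrow)
  obtain ⟨k, _⟩ := hQ₂ _ _ (pullback.snd π N.arrow) hN₂
  let B₀ : Subobject X := imageSubobject (k ≫ pullback.fst π N.arrow)
  let e : Q₂ ⟶ B₀ := factorThruImageSubobject _
  have he : e ≫ B₀.arrow = k ≫ pullback.fst π N.arrow := imageSubobject_arrow_comp _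
  have hB₀ : B₀.arrow ≫ π ≫ cokernel.π N.arrow = 0 := by
    rw [← cancel_epi e, reassoc_of% he, pullback.condition_assoc]
    simp
  let q : (B₀ : C) ⟶ N := Abelian.monoLift N.arrow (B₀.arrow ≫ π) (by simpa using hB₀)
  have hq : q ≫ N.arrow = B₀.arrow ≫ π := Abelian.monoLift_comp _ _ _
  have : Epi q := by
    have : e ≫ q = k ≫ pullback.snd π N.arrow := by
      rw [← cancel_mono N.arrow, Category.assoc, hq, reassoc_of% he, pullback.condition,
        Category.assoc]
    exact epi_of_epi_fac this
  let i := kernel.ι q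
  have hi : (ShortComplex.mk i q (kernel.condition q)).Exact :=
    ShortComplex.exact_of_f_is_kernel _ (kernelIsKernel q)
  let j : kernel q ⟶ A := Abelian.monoLift A.arrow (i ≫ B₀.arrow) (by
    change _ ≫ π = 0
    rw [Category.assoc, ← hq, kernel.condition_assoc, zero_comp])
  have hj : j ≫ A.arrow = i ≫ B₀.arrow := Abelian.monoLift_comp _ _ _
  have : Mono j := by
    have : Mono (j ≫ A.arrow) := by rw [hj]; infer_instance
    exact mono_of_mono _ A.arrow
  -- The kernel of `q` is the intersection of `A` and `B₀`. It need not be acyclic, so it is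
  -- enlarged inside `A`.
  obtain ⟨A', hA'₁, hA'₂, hA'₃⟩ := hQ₄ _ (Subobject.mk j) (by
    exact (hQ₃ _ _ i (.of_epi e)).trans (.of_epi (Subobject.underlyingIso j).inv))
  have hA'₄ : jointlyAcyclic T (A' : C) := fun s ↦ by
    have := (hA'₃ s).2
    exact Acyclic.of_mono_opcyclesMap (hA.acyclic s) ((T s).map A'.arrow)
  have hA'₅ (s : σ) := (hA'₃ s).1
  let f : kernel q ⟶ A' := (Subobject.underlyingIso j).inv ≫ Subobject.ofLE _ _ hA'₁
  have hf : f ≫ A'.arrow = j := by simp [f]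
  -- The pushout over `A` is the sum of `A` and `B₀`, i.e. the preimage of `N` in `X`. The pushout
  -- over `A'` is a small extension of `N` by `A'`. Pasting (`sq₂`) exhibits `A ⟶ A + B₀` as a
  -- pushout of the small map `inl'`, whose cokernel is the acyclic `N`.
  have sq₀ := IsPushout.of_hasPushout f i
  have sq₁ := IsPushout.of_hasPushout j i
  set inl' : (A' : C) ⟶ pushout f i := pushout.inl f i
  set inr' : (B₀ : C) ⟶ pushout f i := pushout.inr f i
  set inl : (A : C) ⟶ pushout j i := pushout.inl j i
  set inr : (B₀ : C) ⟶ pushout j i := pushout.inr j i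
  let u : pushout f i ⟶ pushout j i := sq₀.desc (A'.arrow ≫ inl) inr (by
    rw [reassoc_of% hf, sq₁.w])
  have hu : inl' ≫ u = A'.arrow ≫ inl := sq₀.inl_desc _ _ _
  have hu' : inr' ≫ u = inr := sq₀.inr_desc _ _ _
  have sq₂ : IsPushout A'.arrow inl' inl u :=
    .of_left (by rwa [hf, hu']) hu.symm sq₀
  let β : pushout j i ⟶ X := sq₁.desc A.arrow B₀.arrow hj
  have hβ : inl ≫ β = A.arrow := sq₁.inl_desc _ _ _
  have hβ' : inr ≫ β = B₀.arrow := sq₁.inr_desc _ _ _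
  have sq₃ : IsPullback j i A.arrow B₀.arrow := by
    refine ⟨⟨hj⟩, ⟨PullbackCone.IsLimit.mk _
      (fun c ↦ kernel.lift q c.snd ?_) (fun c ↦ ?_) (fun c ↦ kernel.lift_ι _ _ _)
      (fun c m _ h ↦ ?_)⟩⟩
    · rw [← cancel_mono N.arrow, Category.assoc, hq, ← PullbackCone.condition_assoc]
      simp [π]
    · rw [← cancel_mono A.arrow, Category.assoc, hj, PullbackCone.condition,
        kernel.lift_ι_assoc]
    · rw [← cancel_mono i, h, kernel.lift_ι]
  have : Mono β := sq₁.mono_of_isPullback_of_mono sq₃ β hβ hβ'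
  let r : pushout j i ⟶ N := sq₁.desc 0 q (by rw [comp_zero, kernel.condition])
  have hr : inr ≫ r = q := sq₁.inr_desc _ _ _
  have wr : inl ≫ r = 0 := sq₁.inl_desc _ _ _
  have hr' : (ShortComplex.mk _ _ wr).Exact := exact_of_isPushout sq₁ hi r hr wr
  have : Epi r := epi_of_epi_fac hr
  have hrβ : β ≫ π = r ≫ N.arrow := sq₁.hom_ext
    (by rw [reassoc_of% hβ, reassoc_of% wr, zero_comp]; exact cokernel.condition _)
    (by rw [reassoc_of% hβ', reassoc_of% hr, hq])
  have wr₀ : inl' ≫ u ≫ r = 0 := by rw [reassoc_of% hu, wr, comp_zero]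
  have hr₀ : (ShortComplex.mk _ _ wr₀).Exact :=
    exact_of_isPushout sq₀ hi (u ≫ r) (by rw [reassoc_of% hu', hr]) wr₀
  have : Epi (u ≫ r) := by
    have : inr' ≫ u ≫ r = q := by rw [reassoc_of% hu', hr]
    exact epi_of_epi_fac this
  have fac : inl' ≫ u ≫ β = A'.arrow ≫ A.arrow := by rw [reassoc_of% hu, hβ]
  have : Mono inl' := mono_of_mono_fac fac
  have hinl (s : σ) : Mono ((T s).map inl) := by
    have := (T s).congr_map hβ
    rw [Functor.map_comp] at this
    exact mono_of_mono_fac this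
  have hinl' (s : σ) : Mono ((T s).map inl') := by
    have : (T s).map inl' ≫ (T s).map (u ≫ β) = (T s).map A'.arrow ≫ (T s).map A.arrow := by
      rw [← Functor.map_comp, ← Functor.map_comp, fac]
    have h : Mono ((T s).map inl' ≫ (T s).map (u ≫ β)) := by
      rw [this]
      infer_instance
    exact mono_of_mono _ ((T s).map (u ≫ β))
  have hinl'' : jointlyMonoQuasiIso T inl' := fun s ↦
    ⟨hinl' s, (acyclic_X₃_iff_quasiIso (shortExact_map hr₀ s)).1 (hN' s)⟩
  -- Four lemma: after `T s`, the extension of `N` by `A` maps to the extension of `X / A` by `A`,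
  -- and the outer maps are monic.
  have hβT (s : σ) : Mono ((T s).map β) := by
    have h := hr'.map_of_epi_of_preservesCokernel (T s) inferInstance inferInstance
    let φ₀ : ShortComplex.mk _ _ wr ⟶ ShortComplex.mk _ _ (cokernel.condition A.arrow) :=
      { τ₁ := 𝟙 _
        τ₂ := β
        τ₃ := N.arrow
        comm₁₂ := by simp [hβ] }
    let φ := (T s).mapShortComplex.map φ₀
    have : Mono ((T s).mapShortComplex.obj (ShortComplex.mk _ _ wr)).f := hinl s
    have : Mono ((T s).mapShortComplex.obj
      (ShortComplex.mk _ _ (cokernel.condition A.arrow))).f := hA.mono s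
    have : Mono φ.τ₁ := inferInstanceAs (Mono ((T s).map (𝟙 (A : C))))
    have : Mono φ.τ₃ := hN s
    exact ShortComplex.mono_τ₂_of_exact_of_mono φ h
  have hBT (s : σ) : ((T s).obj (pushout j i)).Acyclic :=
    (shortExact_map hr' s).acyclic_X₂ (hA.acyclic s) (hN' s)
  let e' := Subobject.underlyingIso β
  have hle : A ≤ Subobject.mk β := Subobject.le_mk_of_comm inl hβ
  have hlt : A < Subobject.mk β := by
    refine lt_of_le_not_ge hle fun h ↦ hg ?_
    have h₁ : β ≫ π = 0 := by
      rw [← Subobject.ofMkLE_arrow h, Category.assoc]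
      simp [π]
    have h₂ : N.arrow = 0 := by
      rw [← cancel_epi r, ← hrβ, h₁, comp_zero]
    rw [← imageSubobject_arrow_comp (g ≫ π), ← Subobject.ofLE_arrow hN₁, h₂, comp_zero, comp_zero]
  refine ⟨Subobject.mk β, hlt, ⟨fun s ↦ ?_, fun s ↦ (hBT s).of_iso ((T s).mapIso e'.symm)⟩, ?_⟩
  · have : e'.hom ≫ β = (Subobject.mk β).arrow := Subobject.underlyingIso_hom_comp_eq_mk β
    rw [← this, Functor.map_comp]
    infer_instance
  · have sq₄ : IsPushout A'.arrow inl' (Subobject.ofLE _ _ hlt.le) (u ≫ e'.inv) :=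
      sq₂.of_iso (Iso.refl _) (Iso.refl _) (Iso.refl _) e'.symm (by simp) (by simp)
        (by simp [← cancel_mono (Subobject.mk β).arrow, hβ, e']) (by simp)
    refine pushouts_boundedMonoQuasiIso sq₄ hinl'' ?_ ?_
    · exact .of_coprod hA'₂ (.of_epi (𝟙 Q₂)) (𝟙 _) 0 fun W k h₁ _ ↦ by simpa using h₁
    · exact .of_coprod hA'₂ (.of_epi e) inl' inr' fun W k h₁ h₂ ↦
        sq₀.hom_ext (by rw [h₁, comp_zero]) (by rw [h₂, comp_zero])

end

end

end CategoryTheory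

end

/-! ### Precovers: Zorn's lemma and the small object argument -/

noncomputable section

namespace CategoryTheory

open HomologicalComplex ZeroObject

section

variable {C : Type u} [Category.{w} C] [Abelian C] {B : Type u'} [Category.{v'} B] [Abelian B]
  {σ : Type w} (T : σ → C ⥤ ChainComplex B ℤ)

/-- A partial lifting, defined on an acyclic subobject, of `f` along `p`. -/
structure PartialLift {X Y Z : C} (p : Z ⟶ Y) (f : X ⟶ Y) where
  /-- the subobject on which the lifting is defined -/
  dom : Subobject X
  isAcyclicSubobject : IsAcyclicSubobject T dom
  /-- the lifting -/
  lift : (dom : C) ⟶ Z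
  w : lift ≫ p = dom.arrow ≫ f

namespace PartialLift

variable {T} {X Y Z : C} {p : Z ⟶ Y} {f : X ⟶ Y}

instance : Preorder (PartialLift T p f) where
  le a b := ∃ h : a.dom ≤ b.dom, Subobject.ofLE _ _ h ≫ b.lift = a.lift
  le_refl a := ⟨le_rfl, by simp⟩
  le_trans a b c := by
    rintro ⟨h, h'⟩ ⟨k, k'⟩
    exact ⟨h.trans k, by rw [← Subobject.ofLE_comp_ofLE _ _ _ h k, Category.assoc, k', h']⟩

lemma dom_le {a b : PartialLift T p f} (h : a ≤ b) : a.dom ≤ b.dom := h.choose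

lemma ofLE_lift {a b : PartialLift T p f} (h : a ≤ b) :
    Subobject.ofLE _ _ (dom_le h) ≫ b.lift = a.lift := h.choose_spec

variable [IsGrothendieckAbelian.{w} C]

instance : Small.{w} (PartialLift T p f) :=
  small_of_injective (β := Σ A : Subobject X, ((A : C) ⟶ Z)) (f := fun a ↦ ⟨a.dom, a.lift⟩)
    (by
      rintro ⟨A, _, g, _⟩ ⟨A', _, g', _⟩ h
      simp only [Sigma.mk.injEq] at h
      obtain ⟨rfl, h⟩ := h
      obtain rfl := eq_of_heq h
      rfl)

variable [IsGrothendieckAbelian.{w} B] [∀ s, PreservesColimitsOfSize.{w, w} (T s)]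

/-- The upper bound is the union of the domains. Since `T t` commutes with this filtered colimit,
both monicity and acyclicity pass to the union. -/
lemma bddAbove_of_isChain {c : Set (PartialLift T p f)} (hc : IsChain (· ≤ ·) c)
    (hc' : c.Nonempty) : BddAbove c := by
  -- The chain is reindexed by a type in universe `w`, so that its union is a colimit the functors
  -- are known to preserve.
  obtain ⟨J, ⟨e₀⟩⟩ := (inferInstance : Small.{w} c).equiv_small
  let e : J ≃ c := e₀.symm
  let : Preorder J := Preorder.lift e
  have : Nonempty J := ⟨e.symm ⟨_, hc'.choose_spec⟩⟩
  have : IsDirectedOrder J := ⟨fun a b ↦ by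
    obtain h | h := hc.total (e a).2 (e b).2
    · exact ⟨b, h, le_rfl⟩
    · exact ⟨a, le_rfl, h⟩⟩
  let S : J ⥤ Subobject X :=
    Monotone.functor (f := fun j ↦ (e j).1.dom) fun a b h ↦ dom_le h
  let A : Subobject X := ⨆ j, S.obj j
  have hA (j) : S.obj j ≤ A := le_iSup S.obj j
  let hcol := Subobject.isColimitCoconeOfLE S A hA rfl
  let s : Cocone (S ⋙ Subobject.underlying) :=
    { pt := Z
      ι :=
        { app j := (e j).1.lift
          naturality j j' φ := by
            have h : j ≤ j' := leOfHom φ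
            exact (ofLE_lift (a := (e j).1) (b := (e j').1) h).trans (Category.comp_id _).symm } }
  let m : PartialLift T p f :=
    { dom := A
      isAcyclicSubobject :=
        { mono t := by
            refine mono_of_isColimit_of_comp_eq_zero (isColimitOfPreserves (T t) hcol) _ ?_
            have hA' (j) : (e j).1.dom ≤ A := hA j
            have key (j) (W : ChainComplex B ℤ) (a : W ⟶ (T t).obj ((e j).1.dom : C))
                (ha : a ≫ (T t).map (Subobject.ofLE _ _ (hA' j)) ≫ (T t).map A.arrow = 0) :
                a ≫ (T t).map (Subobject.ofLE _ _ (hA' j)) = 0 := by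
              have hm := (e j).1.isAcyclicSubobject.mono t
              rw [← Functor.map_comp, Subobject.ofLE_arrow] at ha
              have : a = 0 := by
                rwa [← cancel_mono ((T t).map (e j).1.dom.arrow), zero_comp]
              rw [this, zero_comp]
            exact key
          acyclic t := Acyclic.of_isColimit (isColimitOfPreserves (T t) hcol)
            fun j ↦ (e j).1.isAcyclicSubobject.acyclic t }
      lift := hcol.desc s
      w := hcol.hom_ext fun j ↦ by
        refine (hcol.fac_assoc s j _).trans ((e j).1.w.trans ?_)
        exact (Subobject.ofLE_arrow_assoc (hA j) f).symm }
  refine ⟨m, fun a ha ↦ ?_⟩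
  obtain ⟨j, hj⟩ := e.surjective ⟨a, ha⟩
  have h : (e j).1 ≤ m := ⟨hA j, hcol.fac s j⟩
  rwa [hj] at h

/-- A maximal partial lift is defined on all of `X`: a proper domain could be enlarged by a pushout
of a map against which `p` has the right lifting property, and the lift would extend. -/
lemma exists_lift {Q : C} (hQ : ∀ (A : Subobject X) (_ : IsAcyclicSubobject T A) (_ : A ≠ ⊤),
      ∃ (A' : Subobject X) (h : A < A'), IsAcyclicSubobject T A' ∧
        (boundedMonoQuasiIso T Q).pushouts (Subobject.ofLE A A' h.le))
    (hp : (boundedMonoQuasiIso T Q).rlp p) : ∃ g : X ⟶ Z, g ≫ p = f := by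
  have hT (t) := PreservesColimitsOfSize.preservesFiniteColimits.{w, w} (T t)
  have : Nonempty (PartialLift T p f) :=
    ⟨{  dom := ⊥
        isAcyclicSubobject :=
          { mono t := ((isZero_zero C).of_iso Subobject.botCoeIsoZero |> (T t).map_isZero).mono _
            acyclic t := .of_isZero
              ((T t).map_isZero ((isZero_zero C).of_iso Subobject.botCoeIsoZero)) }
        lift := 0
        w := by simp }⟩
  obtain ⟨m, hm⟩ := zorn_le_nonempty (α := PartialLift T p f) fun c ↦ bddAbove_of_isChain
  by_cases h : m.dom = ⊤
  · have := (Subobject.isIso_arrow_iff_eq_top m.dom).2 h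
    exact ⟨inv m.dom.arrow ≫ m.lift, by simp [m.w]⟩
  · obtain ⟨A, hA, hA', hA''⟩ := hQ m.dom m.isAcyclicSubobject h
    have sq : CommSq m.lift (Subobject.ofLE _ _ hA.le) p (A.arrow ≫ f) := ⟨by simp [m.w]⟩
    have := MorphismProperty.pushouts_le_llp_rlp _ _ hA'' _ hp
    let m' : PartialLift T p f := ⟨A, hA', sq.lift, sq.fac_right⟩
    have h₁ : m ≤ m' := ⟨hA.le, sq.fac_left⟩
    exact (hA.not_ge (dom_le (hm h₁))).elim

end PartialLift

variable {T} [IsGrothendieckAbelian.{w} C]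

/-- The sources have fewer than `κ` subobjects, so maps out of them commute with `κ`-long chains of
monomorphisms. This is why the maps of the generating set are required to be monic themselves, and
not only after applying the `T s`. -/
instance (Q : C) : MorphismProperty.HasSmallObjectArgument.{w} (boundedMonoQuasiIso T Q) := by
  obtain ⟨κ, hκ', hκ⟩ := HasCardinalLT.exists_regular_cardinal.{w}
    (Σ R : Subobject Q, Subobject (cokernel R.arrow))
  have : Fact κ.IsRegular := ⟨hκ'⟩
  have : Nonempty κ.ord.ToType := by simpa using hκ'.ne_zero
  have := WellFoundedLT.toOrderBot κ.ord.ToType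
  exact ⟨κ, inferInstance, inferInstance,
    { preservesColimit {A B X Y} i hi f hf := by
        let hf' : (MorphismProperty.monomorphisms C).TransfiniteCompositionOfShape
            κ.ord.ToType f :=
          { toTransfiniteCompositionOfShape := hf.toTransfiniteCompositionOfShape
            map_mem j hj := by
              have := (hf.attachCells j hj).pushouts_coproducts
              simp only [MorphismProperty.ofHoms_homFamily] at this
              refine (?_ : _ ≤ MorphismProperty.monomorphisms C) _ this
              simp only [MorphismProperty.pushouts_le_iff, MorphismProperty.coproducts_le_iff]
              exact boundedMonoQuasiIso_le_monomorphisms T Q }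
        have (j j' : κ.ord.ToType) (φ : j ⟶ j') : Mono (hf'.F.map φ) := hf'.mem_map φ
        apply IsGrothendieckAbelian.preservesColimit_coyoneda_obj_of_mono (Y := hf'.F) (κ := κ)
        obtain ⟨R, R', _⟩ := hi
        exact hκ.of_injective (fun A ↦ (⟨R, A⟩ : Σ R : Subobject Q, Subobject (cokernel R.arrow)))
          fun A A' h ↦ by simpa using h }⟩

variable [IsGrothendieckAbelian.{w} B] [∀ s, PreservesColimitsOfSize.{w, w} (T s)]

/-- By the small object argument, the left-hand class consists of retracts of transfinite
compositions of pushouts of coproducts of generators. Each `T s` commutes with the colimits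
involved, and monomorphic quasi-isomorphisms are stable under all these operations. -/
lemma llp_rlp_boundedMonoQuasiIso_le (Q : C) :
    (boundedMonoQuasiIso T Q).rlp.llp ≤ jointlyMonoQuasiIso T := by
  rw [MorphismProperty.llp_rlp_of_hasSmallObjectArgument]
  intro X Y f hf s
  have := PreservesColimitsOfSize.preservesFiniteColimits (T s)
  have h₁ : boundedMonoQuasiIso T Q ≤ (monoQuasiIso B _).inverseImage (T s) :=
    fun _ _ f hf ↦ boundedMonoQuasiIso_le T Q f hf s
  have h₂ : MorphismProperty.coproducts.{w} (boundedMonoQuasiIso T Q) ≤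
      (monoQuasiIso B _).inverseImage (T s) := by
    intro _ _ f hf
    rw [MorphismProperty.coproducts_iff] at hf
    obtain ⟨J, ⟨X₁, X₂, c₁, c₂, hc₁, hc₂, f, hf⟩⟩ := hf
    exact MorphismProperty.IsStableUnderColimitsOfShape.condition (W := monoQuasiIso B _) _ _ _ _
      (isColimitOfPreserves (T s) hc₁) (isColimitOfPreserves (T s) hc₂)
      (Functor.whiskerRight f (T s)) (fun j ↦ h₁ _ (hf j)) _
      (fun j ↦ by simp [← Functor.map_comp])
  have h₃ : (MorphismProperty.coproducts.{w} (boundedMonoQuasiIso T Q)).pushouts ≤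
      (monoQuasiIso B _).inverseImage (T s) := by
    rintro _ _ _ ⟨_, _, _, _, _, h, sq⟩

    exact (monoQuasiIso B _).of_isPushout (sq.map (T s)) (h₂ _ h)
  have h₄ : MorphismProperty.transfiniteCompositions.{w}
      (MorphismProperty.coproducts.{w} (boundedMonoQuasiIso T Q)).pushouts ≤
      (monoQuasiIso B _).inverseImage (T s) := by
    intro _ _ f hf
    rw [MorphismProperty.transfiniteCompositions_iff] at hf
    obtain ⟨J, _, _, _, _, hf⟩ := hf
    have : PreservesWellOrderContinuousOfShape J (T s) := { }
    exact MorphismProperty.transfiniteCompositionsOfShape_le (monoQuasiIso B _) J _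
      (MorphismProperty.transfiniteCompositionsOfShape_map_of_preserves J (T s) f
        (MorphismProperty.transfiniteCompositionsOfShape_monotone J h₃ _ hf))
  exact MorphismProperty.retracts_le_iff.2 h₄ _ hf

/-- Every object has a precover by objects all of whose images under a family of
cocontinuous functors are acyclic. -/
theorem exists_isPrecover_jointlyAcyclic (Y : C) :
    ∃ (X : C) (p : X ⟶ Y), IsPrecover (jointlyAcyclic T) p := by
  have hT (s) := PreservesColimitsOfSize.preservesFiniteColimits.{w, w} (T s)
  obtain ⟨Q, hQ⟩ := exists_larger_acyclicSubobject T
  -- The first factor `0 ⟶ fac.Z` becomes a quasi-isomorphism under each `T s`, so `fac.Z` is in the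
  -- class; the second factor has the lifting property needed for Zorn's argument.
  let fac := MorphismProperty.factorizationData (boundedMonoQuasiIso T Q).rlp.llp
    (boundedMonoQuasiIso T Q).rlp (0 : (0 : C) ⟶ Y)
  refine ⟨fac.Z, fac.p, fun s ↦ ?_, fun X hX f ↦ PartialLift.exists_lift (hQ X hX) fac.hp⟩
  have h : QuasiIso ((T s).map fac.i) := (llp_rlp_boundedMonoQuasiIso_le Q _ fac.hi s).2
  exact fun i ↦ (quasiIsoAt_iff_exactAt ((T s).map fac.i) i
    (Acyclic.of_isZero ((T s).map_isZero (isZero_zero C)) i)).1 inferInstance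

end

end CategoryTheory

end

/-! ### From precovers to covers -/

noncomputable section

namespace CategoryTheory

/-- Choose a preimage for each of the fewer than `κ` values and take an upper bound of these
preimages. -/
lemma exists_forall_le_of_hasCardinalLT {J : Type w} [Preorder J] {S : Type*} [Preorder S]
    {κ : Cardinal.{w}} [Fact κ.IsRegular] [IsCardinalFiltered J κ] (hS : HasCardinalLT S κ)
    {f : J → S} (hf : Monotone f) : ∃ j₀, ∀ j, f j ≤ f j₀ := by
  have hr : HasCardinalLT (Set.range f) κ := hS.of_injective _ Subtype.val_injective
  choose g hg using fun s : Set.range f ↦ s.2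
  refine ⟨IsCardinalFiltered.max g hr, fun j ↦ ?_⟩
  exact (hg ⟨f j, j, rfl⟩).ge.trans (hf (leOfHom (IsCardinalFiltered.toMax g hr _)))

section

variable {E : Type u'} [Category.{v'} E] {C : Type u} [Category.{v} C] [Abelian C]
  [IsGrothendieckAbelian.{w} C] [HasFilteredColimitsOfSize.{w, w} E] (U : E ⥤ C)
  [PreservesFilteredColimitsOfSize.{w, w} U]

lemma hasIterationOfShape_of_hasFilteredColimits (J : Type w) [LinearOrder J] [Nonempty J] :
    HasIterationOfShape J E where
  hasColimitsOfShape_of_isSuccLimit j hj := by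
    have := hj.nonempty_Iio.to_subtype
    infer_instance

/-- A sequence of iterations, indexed by a regular cardinal, of a choice of morphisms to a fixed
object. -/
lemma exists_iteration (T : E) (s : ∀ X, X ⟶ T) (κ : Cardinal.{w}) [Fact κ.IsRegular] :
    ∃ (F : κ.ord.ToType ⥤ E) (_ : F.IsWellOrderContinuous) (_ : ∀ j, Nonempty (T ⟶ F.obj j)),
      ∀ j, ∃ e : T ≅ F.obj (Order.succ j), F.map (homOfLE (Order.le_succ j)) =
        s (F.obj j) ≫ e.hom := by
  have hκ : κ.IsRegular := Fact.out
  have : Nonempty κ.ord.ToType := by simpa using hκ.ne_zero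
  have := WellFoundedLT.toOrderBot κ.ord.ToType
  have := Cardinal.noMaxOrder hκ.aleph0_le
  have := hasIterationOfShape_of_hasFilteredColimits (E := E) κ.ord.ToType
  let Φ : SmallObject.SuccStruct E := ⟨T, fun _ ↦ T, s⟩
  exact ⟨Φ.iterationFunctor _, inferInstance, fun j ↦ ⟨(Φ.ιIterationFunctor _).app j⟩,
    fun j ↦ ⟨(Φ.iterationFunctorObjSuccIso j (not_isMax j)).symm,
      Φ.iterationFunctor_map_succ j (not_isMax j)⟩⟩

/-- Otherwise each `X` receiving a map from `T` has a map `s X : X ⟶ T` that is not monic under `U`.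
Iterate these maps `κ` times. Kernels out of successor stages, which are copies of `T`, stabilize,
so at a suitable limit stage the next transition map is monic after all. -/
lemma exists_forall_mono_map (T : E) (hT : ∀ X, Nonempty (X ⟶ T)) :
    ∃ D, Nonempty (T ⟶ D) ∧ ∀ g : D ⟶ T, Mono (U.map g) := by
  by_contra! H
  have H' (X : E) : ∃ s : X ⟶ T, Nonempty (T ⟶ X) → ¬ Mono (U.map s) := by
    by_cases h : Nonempty (T ⟶ X)
    · obtain ⟨s, hs⟩ := H X h
      exact ⟨s, fun _ ↦ hs⟩
    · exact ⟨(hT X).some, fun h' ↦ (h h').elim⟩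
  choose s hs using H'
  -- The summand `ℕ` makes `κ` uncountable, so that the sequence `d` below is bounded in `κ`.
  obtain ⟨κ, hκ, hκ'⟩ := HasCardinalLT.exists_regular_cardinal.{w}
    (Subobject (U.obj T) ⊕ ULift.{w} ℕ)
  have : Fact κ.IsRegular := ⟨hκ⟩
  have := Cardinal.noMaxOrder hκ.aleph0_le
  have hκ₁ : HasCardinalLT (Subobject (U.obj T)) κ := hκ'.of_injective _ Sum.inl_injective
  have hκ₂ : HasCardinalLT ℕ κ := hκ'.of_injective (Sum.inr ∘ ULift.up)
    (Sum.inr_injective.comp ULift.up_injective)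
  obtain ⟨F, _, hF, hF'⟩ := exists_iteration T s κ
  let J := κ.ord.ToType
  have stab (i : J) : ∃ j, ∀ (k : J) (hk : Order.succ i ≤ k) (W : C)
      (a : W ⟶ U.obj (F.obj (Order.succ i))) (_ : a ≫ U.map (F.map (homOfLE hk)) = 0)
      (l : J) (_ : j ≤ l) (hl : Order.succ i ≤ l), a ≫ U.map (F.map (homOfLE hl)) = 0 := by
    obtain ⟨e, -⟩ := hF' i
    have h₁ : HasCardinalLT (Subobject (U.obj (F.obj (Order.succ i)))) κ :=
      hκ₁.of_injective _ (Subobject.mapIsoToOrderIso (U.mapIso e)).symm.injective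
    let f (j : J) : Subobject (U.obj (F.obj (Order.succ i))) :=
      kernelSubobject (U.map (F.map (homOfLE (le_max_left (Order.succ i) j))))
    have hf' {k l : J} (hk : Order.succ i ≤ k) (hl : Order.succ i ≤ l) (hkl : k ≤ l) {W : C}
        (a : W ⟶ U.obj (F.obj (Order.succ i))) (ha : a ≫ U.map (F.map (homOfLE hk)) = 0) :
        a ≫ U.map (F.map (homOfLE hl)) = 0 := by
      have : F.map (homOfLE hl) = F.map (homOfLE hk) ≫ F.map (homOfLE hkl) := by
        rw [← F.map_comp, homOfLE_comp]
      rw [this, U.map_comp, reassoc_of% ha, zero_comp]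
    have hf : Monotone f := fun j k hjk ↦ le_kernelSubobject _ _
      (hf' _ _ (max_le_max_left _ hjk) _ (kernelSubobject_arrow_comp _))
    obtain ⟨j, hj⟩ := exists_forall_le_of_hasCardinalLT h₁ hf
    refine ⟨j, fun k hk W a ha l hjl hl ↦ ?_⟩
    have h₂ : (f k).Factors a := by
      rw [kernelSubobject_factors_iff]
      exact hf' hk _ (le_max_right _ _) a ha
    have h₃ := (kernelSubobject_factors_iff _ _).1 (Subobject.factors_of_le a (hj k) h₂)
    exact hf' _ _ (max_le hl hjl) a h₃
  choose g hg using stab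
  have : Nonempty J := by simpa [J] using hκ.ne_zero
  -- A closing-off sequence: `g (d n)` is a stage where the kernels out of stage `succ (d n)` have
  -- stabilized, and the double successor makes the supremum `δ` a limit lying above each `succ (d
  -- n)`.
  let d (n : ℕ) : J := Nat.rec (Classical.arbitrary J)
    (fun _ i ↦ max (Order.succ (Order.succ i)) (g i)) n
  have hd (n) : d (n + 1) = max (Order.succ (Order.succ (d n))) (g (d n)) := rfl
  have hd' : ∃ δ : J, ∀ n, d n ≤ δ :=
    ⟨IsCardinalFiltered.max d hκ₂, fun n ↦ leOfHom (IsCardinalFiltered.toMax d hκ₂ n)⟩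
  let δ : J := WellFounded.min (r := (· < ·)) wellFounded_lt {δ : J | ∀ n, d n ≤ δ} hd'
  have hδ₁ (n) : d n ≤ δ :=
    WellFounded.min_mem (r := (· < ·)) wellFounded_lt {δ : J | ∀ n, d n ≤ δ} hd' n
  have hδ₂ (j) (hj : j < δ) : ∃ n, j < d n := by
    by_contra! h
    exact WellFounded.not_lt_min (r := (· < ·)) wellFounded_lt {δ : J | ∀ n, d n ≤ δ} (x := j) h hj
  have hδ₃ (n) : Order.succ (d n) < δ := by
    refine lt_of_lt_of_le ?_ (hδ₁ (n + 1))
    rw [hd]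
    exact lt_of_lt_of_le (Order.lt_succ _) (le_max_left _ _)
  have hδ : Order.IsSuccLimit δ := by
    refine ⟨fun h ↦ ?_, fun j hj ↦ ?_⟩
    · exact ((hδ₃ 0).not_ge (h (hδ₃ 0).le)).elim
    · obtain ⟨n, hn⟩ := hδ₂ j hj.lt
      have := hj.2 (lt_of_lt_of_le hn (Order.le_succ _))
      exact this (hδ₃ n)
  refine hs (F.obj δ) (hF δ) ?_
  have := hδ.nonempty_Iio.to_subtype
  have hc := isColimitOfPreserves U (F.isColimitOfIsWellOrderContinuous δ hδ)
  have key : Mono (U.map (F.map (homOfLE (Order.le_succ δ)))) := by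
    refine mono_of_isColimit_of_comp_eq_zero hc _ ?_
    have key' (j : J) (hj : j < δ) (W : C) (a : W ⟶ U.obj (F.obj j))
        (ha : a ≫ U.map (F.map (homOfLE hj.le)) ≫ U.map (F.map (homOfLE (Order.le_succ δ))) = 0) :
        a ≫ U.map (F.map (homOfLE hj.le)) = 0 := by
      obtain ⟨n, hn⟩ := hδ₂ j hj
      have h₁ : j ≤ Order.succ (d n) := hn.le.trans (Order.le_succ _)
      have h₂ : F.map (homOfLE hj.le) = F.map (homOfLE h₁) ≫ F.map (homOfLE (hδ₃ n).le) := by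
        rw [← F.map_comp, homOfLE_comp]
      rw [← U.map_comp, ← F.map_comp, homOfLE_comp] at ha
      have h₃ : F.map (homOfLE (hj.le.trans (Order.le_succ δ))) =
          F.map (homOfLE h₁) ≫ F.map (homOfLE ((hδ₃ n).le.trans (Order.le_succ δ))) := by
        rw [← F.map_comp, homOfLE_comp]
      rw [h₃, U.map_comp, ← Category.assoc] at ha
      have := hg (d n) _ _ _ _ ha δ (le_trans (le_max_right _ _) (hδ₁ (n + 1))) (hδ₃ n).le
      rw [h₂, U.map_comp, ← Category.assoc, this]
    exact fun j ↦ key' j.1 j.2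
  obtain ⟨e, he⟩ := hF' δ
  rw [he, U.map_comp] at key
  exact mono_of_mono _ (U.map e.hom)

/-- If there is a weakly terminal object, there is one all of whose endomorphisms are
isomorphisms. -/
theorem exists_weaklyTerminal_isIso [U.ReflectsIsomorphisms]
    (T : E) (hT : ∀ X, Nonempty (X ⟶ T)) :
    ∃ D : E, (∀ X, Nonempty (X ⟶ D)) ∧ ∀ g : D ⟶ D, IsIso g := by
  obtain ⟨D, ⟨t⟩, hD⟩ := exists_forall_mono_map U T hT
  have hD' {X : E} (f : D ⟶ X) : Mono (U.map f) := by
    have := hD (f ≫ (hT X).some)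
    rw [U.map_comp] at this
    exact mono_of_mono _ (U.map (hT X).some)
  refine ⟨D, fun X ↦ ⟨(hT X).some ≫ t⟩, fun g ↦ ?_⟩
  by_contra hg
  have hg' : ¬ Epi (U.map g) := fun h ↦ hg (by
    have := hD' g
    have := isIso_of_mono_of_epi (U.map g)
    exact isIso_of_reflects_iso g U)
  obtain ⟨κ, hκ, hκ'⟩ := HasCardinalLT.exists_regular_cardinal.{w} (Subobject (U.obj D))
  have : Fact κ.IsRegular := ⟨hκ⟩
  have := Cardinal.noMaxOrder hκ.aleph0_le
  have : Nonempty κ.ord.ToType := by simpa using hκ.ne_zero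
  -- Every transition map into a successor stage ends with the non-epimorphic `g`, while every map
  -- out of `D` is monic under `U`. The successor stages thus give `κ` distinct subobjects of `U.obj
  -- D`, too many.
  obtain ⟨F, _, hF, hF'⟩ := exists_iteration D (fun X ↦ ((hT X).some ≫ t) ≫ g) κ
  let J := κ.ord.ToType
  let φ := (hT (colimit F)).some ≫ t
  have hm (i : J) {Z : E} (f : F.obj (Order.succ i) ⟶ Z) : Mono (U.map f) := by
    obtain ⟨e, -⟩ := hF' i
    have := hD' (e.hom ≫ f)
    rw [U.map_comp] at this
    have : Mono (U.map e.inv ≫ U.map e.hom ≫ U.map f) := mono_comp _ _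
    rwa [← U.map_comp_assoc, e.inv_hom_id, U.map_id, Category.id_comp] at this
  have := fun i ↦ hm i (colimit.ι F _ ≫ φ)
  let S (i : J) : Subobject (U.obj D) := Subobject.mk (U.map (colimit.ι F (Order.succ i) ≫ φ))
  have hS' (i j : J) (h : i < j) : S i ≠ S j := fun hij ↦ by
    have hlt : Order.succ i ≤ j := Order.succ_le_of_lt h
    obtain ⟨e, he⟩ := hF' j
    have h₁ : U.map (F.map (homOfLE (hlt.trans (Order.le_succ j)))) =
        (Subobject.isoOfMkEqMk _ _ hij).hom := by
      rw [← cancel_mono (U.map (colimit.ι F (Order.succ j) ≫ φ)), ← U.map_comp, colimit.w_assoc]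
      exact (Subobject.ofMkLEMk_comp hij.le).symm
    have h₂ : Epi (U.map (F.map (homOfLE (hlt.trans (Order.le_succ j))))) := by
      rw [h₁]; infer_instance
    have h₃ : Epi (U.map (F.map (homOfLE (hlt.trans (Order.le_succ j))) ≫ e.inv)) := by
      rw [U.map_comp]
      exact epi_comp _ _
    have h₄ : F.map (homOfLE (hlt.trans (Order.le_succ j))) ≫ e.inv =
        (F.map (homOfLE hlt) ≫ (hT _).some ≫ t) ≫ g := by
      rw [← homOfLE_comp hlt (Order.le_succ j), F.map_comp, he]
      simp
    rw [h₄, U.map_comp] at h₃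
    exact hg' (epi_of_epi (U.map (F.map (homOfLE hlt) ≫ (hT _).some ≫ t)) (U.map g))
  have hS : Function.Injective S := fun i j hij ↦ by
    obtain h | rfl | h := lt_trichotomy i j
    · exact (hS' i j h hij).elim
    · rfl
    · exact (hS' j i h hij.symm).elim
  have := hκ'.of_injective S hS
  rw [hasCardinalLT_iff_cardinal_mk_lt] at this
  simp [J] at this

end

section

variable {C : Type u} [Category.{v} C] [Abelian C] [IsGrothendieckAbelian.{w} C]
  (K : ObjectProperty C)

/-- If a class `K` of objects of a Grothendieck abelian category is closed under filtered colimits,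
every object which has a `K`-precover has a `K`-cover. -/
theorem exists_isCover_of_isPrecover
    (hK : ∀ (J : Type w) [SmallCategory J] [IsFiltered J] (F : J ⥤ C) (c : Cocone F)
      (_ : IsColimit c) (_ : ∀ j, K (F.obj j)), K c.pt)
    {X Y : C} (p : X ⟶ Y) (hp : IsPrecover K p) : ∃ (F : C) (p : F ⟶ Y), IsCover K p := by
  -- In the category of maps to `Y` from objects of `K`, a precover is a weakly terminal object, and
  -- a cover is one whose endomorphisms are all invertible. Closure of `K` under filtered colimits
  -- gives this category its filtered colimits.
  let P : ObjectProperty (Over Y) := K.inverseImage (Over.forget Y)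
  have hP (J : Type w) [SmallCategory J] [IsFiltered J] : P.IsClosedUnderColimitsOfShape J :=
    ⟨by
      rintro X ⟨h⟩
      exact hK J _ _ (isColimitOfPreserves (Over.forget Y) h.isColimit) h.prop_diag_obj⟩
  have : HasFilteredColimitsOfSize.{w, w} P.FullSubcategory :=
    ⟨fun J _ _ ↦ inferInstance⟩
  let U : P.FullSubcategory ⥤ C := P.ι ⋙ Over.forget Y
  have : PreservesFilteredColimitsOfSize.{w, w} U :=
    ⟨fun J _ _ ↦ inferInstanceAs (PreservesColimitsOfShape J (P.ι ⋙ Over.forget Y))⟩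
  obtain ⟨D, hD, hD'⟩ := exists_weaklyTerminal_isIso U ⟨Over.mk p, hp.mem⟩ fun Z ↦ by
    obtain ⟨g, hg⟩ := hp.exists_lift _ Z.2 Z.1.hom
    exact ⟨ObjectProperty.homMk (Over.homMk g hg)⟩
  refine ⟨D.1.left, D.1.hom, ⟨D.2, fun F' hF' f ↦ ?_⟩, fun g hg ↦ ?_⟩
  · obtain ⟨t⟩ := hD ⟨Over.mk f, hF'⟩
    exact ⟨t.hom.left, Over.w t.hom⟩
  · have := hD' (ObjectProperty.homMk (Over.homMk g hg))
    exact inferInstanceAs (IsIso (U.map (ObjectProperty.homMk (Over.homMk g hg) : D ⟶ D)))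

end

section

variable {C : Type u} [Category.{w} C] [Abelian C] [IsGrothendieckAbelian.{w} C]
  {B : Type u'} [Category.{v'} B] [Abelian B] [IsGrothendieckAbelian.{w} B] {σ : Type w}
  (T : σ → C ⥤ ChainComplex B ℤ) [∀ s, PreservesColimitsOfSize.{w, w} (T s)]

/-- The objects all of whose images under a family of cocontinuous functors are acyclic form
a covering class. -/
theorem isCoveringClass_jointlyAcyclic : IsCoveringClass (jointlyAcyclic T) := fun Y ↦ by
  obtain ⟨X, p, hp⟩ := exists_isPrecover_jointlyAcyclic (T := T) Y
  exact exists_isCover_of_isPrecover (jointlyAcyclic T) (fun J _ _ F c hc h s ↦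
    HomologicalComplex.Acyclic.of_isColimit (isColimitOfPreserves (T s) hc) fun j ↦ h j s) p hp

end

end CategoryTheory

end

/-! ### Total complexes and reduction to a set of test complexes -/

noncomputable section

namespace HomologicalComplex₂

variable {B : Type u'} [Category.{v'} B] [Preadditive B] {I₁ I₂ I₁₂ : Type*}
  {c₁ : ComplexShape I₁} {c₂ : ComplexShape I₂} (c₁₂ : ComplexShape I₁₂)
  [TotalComplexShape c₁ c₂ c₁₂] [DecidableEq I₁₂]
  [∀ K : HomologicalComplex₂ B c₁ c₂, K.HasTotal c₁₂]

/-- The degree `(i₁, i₂)` part of a bicomplex. -/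
abbrev evalEval (B : Type u') [Category.{v'} B] [Preadditive B] (c₁ : ComplexShape I₁)
    (c₂ : ComplexShape I₂) (i₁ : I₁) (i₂ : I₂) : HomologicalComplex₂ B c₁ c₂ ⥤ B :=
  HomologicalComplex.eval _ c₁ i₁ ⋙ HomologicalComplex.eval _ c₂ i₂

/-- The inclusions of the summands of the total complex, as a natural transformation. -/
def ιTotalNatTrans (i₁ : I₁) (i₂ : I₂) (n : I₁₂) (h : ComplexShape.π c₁ c₂ c₁₂ (i₁, i₂) = n) :
    evalEval B c₁ c₂ i₁ i₂ ⟶ totalFunctor B c₁ c₂ c₁₂ ⋙ HomologicalComplex.eval _ _ n where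
  app K := K.ιTotal c₁₂ i₁ i₂ n h
  naturality _ _ f := (ιTotal_map _ _ f c₁₂ i₁ i₂ n h).symm

/-- A degreewise colimit of bicomplexes is preserved by the total complex. -/
def isColimitTotal {J : Type*} [Category* J] {K : J ⥤ HomologicalComplex₂ B c₁ c₂}
    {c : Cocone K} (hc : ∀ i₁ i₂, IsColimit ((evalEval B c₁ c₂ i₁ i₂).mapCocone c)) :
    IsColimit ((totalFunctor B c₁ c₂ c₁₂).mapCocone c) := by
  refine HomologicalComplex.isColimitOfEval _ _ fun n ↦ ?_
  let S (s : Cocone ((K ⋙ totalFunctor B c₁ c₂ c₁₂) ⋙ HomologicalComplex.eval _ _ n))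
      (i₁ : I₁) (i₂ : I₂) (h : ComplexShape.π c₁ c₂ c₁₂ (i₁, i₂) = n) :
      Cocone (K ⋙ evalEval B c₁ c₂ i₁ i₂) :=
    { pt := s.pt
      ι := Functor.whiskerLeft K (ιTotalNatTrans c₁₂ i₁ i₂ n h) ≫ s.ι }
  let D (s : Cocone ((K ⋙ totalFunctor B c₁ c₂ c₁₂) ⋙ HomologicalComplex.eval _ _ n)) :
      (c.pt.total c₁₂).X n ⟶ s.pt :=
    totalDesc c.pt fun i₁ i₂ h ↦ (hc i₁ i₂).desc (S s i₁ i₂ h)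
  refine { desc := D, fac := fun s j ↦ ?_, uniq := fun s m hm ↦ ?_ }
  · refine total.hom_ext c₁₂ fun i₁ i₂ h ↦ ?_
    refine (ιTotal_map_assoc _ _ (c.ι.app j) c₁₂ i₁ i₂ n h _).trans ?_
    refine (_ ≫= ι_totalDesc _ _ i₁ i₂ h).trans ?_
    exact (hc i₁ i₂).fac (S s i₁ i₂ h) j
  · refine total.hom_ext c₁₂ fun i₁ i₂ h ↦ ?_
    refine Eq.trans ?_ (ι_totalDesc _ _ i₁ i₂ h).symm
    refine (hc i₁ i₂).uniq (S s i₁ i₂ h) _ fun j ↦ ?_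
    refine (ιTotal_map_assoc _ _ (c.ι.app j) c₁₂ i₁ i₂ n h _).symm.trans ?_
    exact _ ≫= hm j

end HomologicalComplex₂

namespace HomologicalComplex

variable {A₁ : Type*} [Category* A₁] [HasZeroMorphisms A₁] {A₂ : Type*} [Category* A₂]
  [HasZeroMorphisms A₂] {B : Type u'} [Category.{v'} B] [Preadditive B]
  (F : A₁ ⥤ A₂ ⥤ B) [F.PreservesZeroMorphisms] [∀ M, (F.obj M).PreservesZeroMorphisms]
  {I₁ I₂ I₁₂ : Type*}
  (c₁ : ComplexShape I₁) (c₂ : ComplexShape I₂) (c₁₂ : ComplexShape I₁₂)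
  [TotalComplexShape c₁ c₂ c₁₂] [DecidableEq I₁₂]
  [∀ K : HomologicalComplex₂ B c₁ c₂, K.HasTotal c₁₂]

/-- The total complex of `F(E, X)`, as a bifunctor in the complexes `E` and `X`. -/
def mapBifunctorFunctor :
    HomologicalComplex A₁ c₁ ⥤ HomologicalComplex A₂ c₂ ⥤ HomologicalComplex B c₁₂ :=
  F.mapBifunctorHomologicalComplex c₁ c₂ ⋙
    (Functor.whiskeringRight _ _ _).obj (HomologicalComplex₂.totalFunctor B c₁ c₂ c₁₂)

variable {J : Type*} [Category* J]

lemma preservesColimitsOfShape_mapBifunctorFunctor_obj [HasColimitsOfShape J A₂]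
    [∀ M, PreservesColimitsOfShape J (F.obj M)] (E : HomologicalComplex A₁ c₁) :
    PreservesColimitsOfShape J ((mapBifunctorFunctor F c₁ c₂ c₁₂).obj E) where
  preservesColimit := ⟨fun {c} hc ↦ ⟨by
    refine HomologicalComplex₂.isColimitTotal c₁₂
      (c := ((F.mapBifunctorHomologicalComplex c₁ c₂).obj E).mapCocone c) fun i₁ i₂ ↦ ?_
    exact isColimitOfPreserves (HomologicalComplex.eval _ c₂ i₂ ⋙ F.obj (E.X i₁)) hc⟩⟩

lemma preservesColimitsOfShape_mapBifunctorFunctor_flip_obj [HasColimitsOfShape J A₁]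
    [∀ M, PreservesColimitsOfShape J (F.flip.obj M)] (X : HomologicalComplex A₂ c₂) :
    PreservesColimitsOfShape J ((mapBifunctorFunctor F c₁ c₂ c₁₂).flip.obj X) where
  preservesColimit := ⟨fun {c} hc ↦ ⟨by
    refine HomologicalComplex₂.isColimitTotal c₁₂
      (c := ((F.mapBifunctorHomologicalComplex c₁ c₂).flip.obj X).mapCocone c) fun i₁ i₂ ↦ ?_
    exact isColimitOfPreserves (HomologicalComplex.eval _ c₁ i₁ ⋙ F.flip.obj (X.X i₂)) hc⟩⟩

end HomologicalComplex

namespace HomologicalComplex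

/-- A filtered colimit of complexes is acyclic if the canonical maps into it vanish in homology,
for instance because they factor through acyclic complexes. -/
lemma Acyclic.of_isColimit_of_homologyMap_eq_zero {B : Type u'} [Category.{v'} B] [Abelian B]
    [IsGrothendieckAbelian.{w} B] {ι : Type*} {c : ComplexShape ι} {J : Type w} [SmallCategory J]
    [IsFiltered J] {K : J ⥤ HomologicalComplex B c} {cc : Cocone K} (hcc : IsColimit cc)
    (h : ∀ j i, homologyMap (cc.ι.app j) i = 0) : cc.pt.Acyclic := fun i ↦ by
  rw [exactAt_iff_mono_fromOpcycles]
  let τ : K ⋙ opcyclesFunctor B c i ⟶ K ⋙ eval B c (c.next i) :=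
    { app j := (K.obj j).fromOpcycles i (c.next i)
      naturality j j' f := opcyclesMap_fromOpcycles _ _ _ }
  have hS : (ShortComplex.mk _ _ (kernel.condition τ)).Exact :=
    ShortComplex.exact_of_f_is_kernel _ (kernelIsKernel τ)
  refine (colim.exact_mapShortComplex hS (colimit.isColimit (kernel τ))
    (isColimitOfPreserves (opcyclesFunctor B c i) hcc)
    (isColimitOfPreserves (eval B c (c.next i)) hcc) 0 (cc.pt.fromOpcycles i (c.next i))
    (fun j ↦ ?_) (fun j ↦ ?_)).mono_g rfl
  · have hj : (kernel.ι τ).app j ≫ (K.obj j).fromOpcycles i (c.next i) = 0 :=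
      NatTrans.congr_app (kernel.condition τ) j
    obtain ⟨l, hl⟩ := KernelFork.IsLimit.lift' ((K.obj j).homologyIsKernel i _ rfl) _ hj
    have hl' : l ≫ (K.obj j).homologyι i ≫ opcyclesMap (cc.ι.app j) i = 0 := by
      rw [← homologyι_naturality, h, zero_comp, comp_zero]
    refine comp_zero.trans (Eq.symm ?_)
    change (kernel.ι τ).app j ≫ opcyclesMap (cc.ι.app j) i = 0
    exact (hl.symm =≫ _).trans ((Category.assoc _ _ _).trans hl')
  · exact opcyclesMap_fromOpcycles _ _ _

lemma homologyMap_eq_zero_of_factors {B : Type u'} [Category.{v'} B] [Abelian B]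
    {ι : Type*} {c : ComplexShape ι} {K L M : HomologicalComplex B c} (hL : L.Acyclic)
    (f : K ⟶ L) (g : L ⟶ M) (i : ι) : homologyMap (f ≫ g) i = 0 := by
  rw [homologyMap_comp, ((exactAt_iff_isZero_homology _ _).1 (hL i)).eq_of_tgt
    (homologyMap f i) 0, zero_comp]

end HomologicalComplex

section

variable {C : Type u} [Category.{v} C] [Abelian C] [IsGrothendieckAbelian.{w} C]

/-- Every object is the filtered union of subobjects of bounded size. -/
lemma exists_isFiltered_iSup_eq_top (C : Type u) [Category.{v} C] [Abelian C]
    [IsGrothendieckAbelian.{w} C] : ∃ Q : C, ∀ X : C, ∃ (J : Type w) (_ : SmallCategory J)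
    (_ : IsFiltered J) (S : J ⥤ Subobject X), ⊤ = (⨆ j, S.obj j) ∧
      ∀ j, IsQuotientOf Q (S.obj j : C) := by
  classical
  let G : C := separator C
  refine ⟨∐ fun _ : ULift.{w} ℕ ↦ G, fun X ↦ ?_⟩
  let A (f : Shrink.{w} (G ⟶ X)) : Subobject X := imageSubobject ((equivShrink _).symm f)
  let S : Finset (Shrink.{w} (G ⟶ X)) → Subobject X := fun s ↦ ⨆ f : s, A f
  have hS : Monotone S := fun s t h ↦ iSup_le fun f ↦ le_iSup (fun f : t ↦ A f) ⟨f.1, h f.2⟩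
  refine ⟨_, _, inferInstance, hS.functor, (top_le_iff.1 ?_).symm, fun s ↦ ?_⟩
  · rw [← Subobject.iSup_mk_image_eq_top (isSeparator_separator C)]
    exact iSup_le fun f ↦ (le_iSup (fun g : ({f} : Finset _) ↦ A g)
      ⟨f, Finset.mem_singleton_self f⟩).trans (le_iSup S {f})
  · exact (IsQuotientOf.sigma_of_injective (fun x : s ↦ ULift.up (s.equivFin x : ℕ))
      (fun x y h ↦ s.equivFin.injective (Fin.ext (ULift.up_injective h))) G).trans
        (IsQuotientOf.iSup fun f ↦ IsQuotientOf.imageSubobject _)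

end

section

variable {A : Type u} [Category.{w} A] [Abelian A] [IsGrothendieckAbelian.{w} A]

open HomologicalComplex

/-- Every acyclic complex is a filtered union of subobjects contained in acyclic subcomplexes of
bounded size. -/
lemma exists_acyclic_of_isQuotientOf (A : Type u) [Category.{w} A] [Abelian A]
    [IsGrothendieckAbelian.{w} A] : ∃ Q : ChainComplex A ℤ, ∀ E : ChainComplex A ℤ, E.Acyclic →
    ∃ (J : Type w) (_ : SmallCategory J) (_ : IsFiltered J) (S : J ⥤ Subobject E),
      ⊤ = (⨆ j, S.obj j) ∧ ∀ j, ∃ N, S.obj j ≤ N ∧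
        IsQuotientOf Q (N : ChainComplex A ℤ) ∧ (N : ChainComplex A ℤ).Acyclic := by
  obtain ⟨Q, hQ⟩ := exists_isFiltered_iSup_eq_top (ChainComplex A ℤ)
  -- With the identity as only functor, Löwenheim–Skolem produces small acyclic subcomplexes of `E`.
  obtain ⟨Q', hQ'⟩ := exists_subobject_mono_opcyclesMap (σ := PUnit.{w + 1})
    (fun _ ↦ 𝟭 (ChainComplex A ℤ)) Q
  refine ⟨Q', fun E hE ↦ ?_⟩
  obtain ⟨J, _, _, S, hS, h⟩ := hQ E
  refine ⟨J, _, inferInstance, S, hS, fun j ↦ ?_⟩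
  obtain ⟨N, hN, hN', hN''⟩ := hQ' E _ (h j)
  have (i : ℤ) : Mono (opcyclesMap N.arrow i) := (hN'' ⟨⟩).2 i
  exact ⟨N, hN, hN', hE.of_mono_opcyclesMap N.arrow⟩

/-- For bifunctors, the acyclicity of `T E X` for all acyclic `E` may be tested on a set of acyclic
complexes `E`. -/
lemma exists_forall_acyclic_iff {D : Type*} [Category* D] {B : Type u'} [Category.{v'} B]
    [Abelian B] [IsGrothendieckAbelian.{w} B] (T : ChainComplex A ℤ ⥤ D ⥤ ChainComplex B ℤ)
    [∀ X, PreservesFilteredColimitsOfSize.{w, w} (T.flip.obj X)] :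
    ∃ (σ : Type w) (E : σ → ChainComplex A ℤ), (∀ s, (E s).Acyclic) ∧
      ∀ X, (∀ s, ((T.obj (E s)).obj X).Acyclic) →
        ∀ E : ChainComplex A ℤ, E.Acyclic → ((T.obj E).obj X).Acyclic := by
  obtain ⟨Q, hQ⟩ := exists_acyclic_of_isQuotientOf A
  let σ' := { R : Subobject Q // (cokernel R.arrow).Acyclic }
  refine ⟨Shrink.{w} σ', fun s ↦ cokernel ((equivShrink σ').symm s).1.arrow,
    fun s ↦ ((equivShrink σ').symm s).2, fun X hX E hE ↦ ?_⟩
  obtain ⟨J, _, _, S, hS, h⟩ := hQ E hE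
  choose N hN hN' hN'' using h
  let e : ((⊤ : Subobject E) : ChainComplex A ℤ) ≅ E := asIso (⊤ : Subobject E).arrow
  refine Acyclic.of_iso ((T.flip.obj X).mapIso e) ?_
  -- The acyclic `N j` need not form a directed diagram, so the colimit is taken over the pieces
  -- `S.obj j`. After applying `T`, their maps to the colimit vanish in homology because they factor
  -- through the acyclic image of `N j`.
  refine Acyclic.of_isColimit_of_homologyMap_eq_zero (isColimitOfPreserves (T.flip.obj X)
    (Subobject.isColimitCoconeOfLE S ⊤ (fun _ ↦ le_top) hS)) fun j i ↦ ?_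
  have hT : ((T.flip.obj X).obj (N j : ChainComplex A ℤ)).Acyclic := by
    obtain ⟨R, ⟨e⟩⟩ := (hN' j).exists_iso_cokernel
    have hR : (cokernel R.arrow).Acyclic := (hN'' j).of_iso e.symm
    obtain ⟨s, hs⟩ := (equivShrink σ').symm.surjective ⟨R, hR⟩
    have hs' : ((equivShrink σ').symm s).1 = R := congr_arg Subtype.val hs
    subst hs'
    exact Acyclic.of_iso ((T.flip.obj X).mapIso e) (hX s)
  have fac : Subobject.ofLE _ _ (hN j) ≫ Subobject.ofLE _ ⊤ le_top =
      (Subobject.coconeOfLE S ⊤ (fun _ ↦ le_top)).ι.app j := Subobject.ofLE_comp_ofLE _ _ _ _ _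
  have := homologyMap_eq_zero_of_factors hT ((T.flip.obj X).map (Subobject.ofLE _ _ (hN j)))
    ((T.flip.obj X).map (Subobject.ofLE _ ⊤ le_top)) i
  rw [← Functor.map_comp, fac] at this
  exact this



/-- The class of complexes `X` such that `F(E, X)` is acyclic for every acyclic complex `E` is a
covering class. -/
theorem isCoveringClass_mapBifunctor_acyclic
    {A₂ : Type u'} [Category.{w} A₂] [Abelian A₂] [IsGrothendieckAbelian.{w} A₂]
    {B : Type*} [Category* B] [Abelian B] [IsGrothendieckAbelian.{w} B]
    (F : A ⥤ A₂ ⥤ B) [F.PreservesZeroMorphisms] [∀ M, (F.obj M).PreservesZeroMorphisms]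
    [∀ M, PreservesColimitsOfSize.{w, w} (F.obj M)]
    [∀ M, PreservesFilteredColimitsOfSize.{w, w} (F.flip.obj M)]
    [∀ (E : ChainComplex A ℤ) (X : ChainComplex A₂ ℤ),
      HasMapBifunctor E X F (ComplexShape.down ℤ)] :
    IsCoveringClass fun X : ChainComplex A₂ ℤ ↦ ∀ E : ChainComplex A ℤ, E.Acyclic →
      (mapBifunctor E X F (ComplexShape.down ℤ)).Acyclic := by
  have (K : HomologicalComplex₂ B (ComplexShape.down ℤ) (ComplexShape.down ℤ)) :
      K.HasTotal (ComplexShape.down ℤ) := fun _ ↦ inferInstance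
  let T := mapBifunctorFunctor F (ComplexShape.down ℤ) (ComplexShape.down ℤ) (ComplexShape.down ℤ)
  have (X : ChainComplex A₂ ℤ) : PreservesFilteredColimitsOfSize.{w, w} (T.flip.obj X) :=
    ⟨fun J _ _ ↦ preservesColimitsOfShape_mapBifunctorFunctor_flip_obj F _ _ _ X⟩
  have (E : ChainComplex A ℤ) : PreservesColimitsOfSize.{w, w} (T.obj E) :=
    ⟨preservesColimitsOfShape_mapBifunctorFunctor_obj F _ _ _ E⟩
  obtain ⟨σ, E, hE, h⟩ := exists_forall_acyclic_iff T
  have H : jointlyAcyclic (fun s ↦ T.obj (E s)) =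
      fun X : ChainComplex A₂ ℤ ↦ ∀ E : ChainComplex A ℤ, E.Acyclic →
        (mapBifunctor E X F (ComplexShape.down ℤ)).Acyclic := by
    ext X
    exact ⟨h X, fun h s ↦ h _ (hE s)⟩
  rw [← H]
  exact isCoveringClass_jointlyAcyclic _

end
end

/-! ### K-flat complexes in a closed symmetric monoidal Grothendieck category -/

noncomputable section

/-- Complexes which are K-flat in a closed symmetric monoidal Grothendieck category form a covering
class. -/
theorem isCoveringClass_kFlat (G : Type u) [Category.{v} G] [Abelian G]
    [IsGrothendieckAbelian.{v} G] [MonoidalCategory G] [SymmetricCategory G] [MonoidalClosed G] :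
    IsCoveringClass (kFlat G) := by
  have := monoidalPreadditive_of_closed G
  have (M : G) : PreservesColimitsOfSize.{v, v} ((curriedTensor G).obj M) :=
    inferInstanceAs (PreservesColimitsOfSize.{v, v} (tensorLeft M))
  have (M : G) : PreservesFilteredColimitsOfSize.{v, v} ((curriedTensor G).flip.obj M) := by
    have : PreservesColimitsOfSize.{v, v} ((curriedTensor G).flip.obj M) :=
      preservesColimits_of_natIso (BraidedCategory.tensorLeftIsoTensorRight M)
    exact ⟨fun J _ _ ↦ inferInstance⟩
  have (E X : ChainComplex G ℤ) := hasMapBifunctor_of_countable E X (curriedTensor G)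
  exact isCoveringClass_mapBifunctor_acyclic (curriedTensor G)

end

/-! ### Sheaves of modules form a Grothendieck category -/

noncomputable section

namespace AlgebraicGeometry.Scheme.Modules

variable (X : Scheme.{w})

instance preservesFiniteLimits_modulesSheafification :
    PreservesFiniteLimits (modulesSheafification X) :=
  inferInstanceAs (PreservesFiniteLimits
    (PresheafOfModules.sheafification.{w} (𝟙 X.ringCatSheaf.obj)))

/-- Sheafification of presheaves of modules is left adjoint to the inclusion. -/
def modulesSheafificationAdjunction : modulesSheafification X ⊣ toPresheafOfModules X :=
  PresheafOfModules.sheafificationAdjunction (𝟙 X.ringCatSheaf.obj)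

instance : (modulesSheafification X).IsLeftAdjoint :=
  (modulesSheafificationAdjunction X).isLeftAdjoint

/-- The forgetful functor to presheaves of abelian groups reflects isomorphisms and is compatible
with finite limits and colimits, so exactness is inherited. It then passes to sheaves because
sheafification is exact. -/
lemma hasExactColimitsOfShape_presheafOfModules (J : Type w) [SmallCategory J] [IsFiltered J] :
    HasExactColimitsOfShape J X.PresheafOfModules :=
  have : HasExactColimitsOfShape J ((TopologicalSpace.Opens X)ᵒᵖ ⥤ AddCommGrpCat.{w}) :=
    inferInstance
  have : PreservesFiniteLimits (PresheafOfModules.toPresheaf.{w} X.ringCatSheaf.obj) :=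
    inferInstance
  have : ReflectsFiniteLimits (PresheafOfModules.toPresheaf.{w} X.ringCatSheaf.obj) :=
    ⟨fun _ _ _ ↦ reflectsLimitsOfShape_of_reflectsIsomorphisms⟩
  HasExactColimitsOfShape.domain_of_functor J
    (PresheafOfModules.toPresheaf.{w} X.ringCatSheaf.obj)

/-- The sheaf of modules `E_U` such that `Hom(E_U, M)` identifies to the sections of `M` on `U`. -/
def freeOn (U : X.Opens) : X.Modules :=
  (modulesSheafification X).obj ((PresheafOfModules.free X.ringCatSheaf.obj).obj (yoneda.obj U))

variable {X}

/-- Morphisms from `freeOn X U` to `M` identify to sections of `M` on `U`. -/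
def freeOnEquiv {U : X.Opens} {M : X.Modules} : (freeOn X U ⟶ M) ≃ Γ(M, U) :=
  ((modulesSheafificationAdjunction X).homEquiv _ _).trans PresheafOfModules.freeYonedaEquiv

lemma freeOnEquiv_comp {U : X.Opens} {M N : X.Modules} (f : freeOn X U ⟶ M) (g : M ⟶ N) :
    freeOnEquiv (f ≫ g) = g.app U (freeOnEquiv f) := by
  refine (congr_arg PresheafOfModules.freeYonedaEquiv
    ((modulesSheafificationAdjunction X).homEquiv_naturality_right f g)).trans ?_
  rfl

lemma isSeparating_freeOn : ObjectProperty.IsSeparating (.ofObj (freeOn X)) := by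
  intro M N f g h
  refine hom_ext f g fun U ↦ ?_
  ext s
  obtain ⟨φ, rfl⟩ := freeOnEquiv.surjective s
  rw [← freeOnEquiv_comp, ← freeOnEquiv_comp, h _ ⟨U⟩ φ]

instance : IsGrothendieckAbelian.{w} X.Modules where
  ab5OfSize := ⟨fun J _ _ ↦
    have := hasExactColimitsOfShape_presheafOfModules X J
    have : HasColimitsOfShape J X.PresheafOfModules := inferInstance
    (modulesSheafificationAdjunction X).hasExactColimitsOfShape J⟩
  hasSeparator := ⟨_, isSeparating_freeOn.isSeparator_coproduct⟩

end AlgebraicGeometry.Scheme.Modules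
end

/-! ### The tensor product of sheaves of modules is cocontinuous -/

noncomputable section

open scoped TensorProduct

namespace CategoryTheory

/-- If a functor `T` inverts the unit of a reflective localization `L ⊣ R`, then `R ⋙ T` preserves
the colimits which are preserved by `T`. -/
lemma Adjunction.preservesColimitsOfShape_comp_of_isIso_map_unit {C D E : Type*} [Category* C]
    [Category* D] [Category* E] {L : C ⥤ D} {R : D ⥤ C} (adj : L ⊣ R) [R.Full] [R.Faithful]
    (T : C ⥤ E) (J : Type*) [Category* J] [HasColimitsOfShape J C] [PreservesColimitsOfShape J T]
    [∀ P, IsIso (T.map (adj.unit.app P))] : PreservesColimitsOfShape J (R ⋙ T) where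
  preservesColimit {K} := by
    have := adj.leftAdjoint_preservesColimits
    let e : (K ⋙ R) ⋙ L ≅ K := Functor.isoWhiskerLeft K (asIso adj.counit)
    let e' : T ≅ L ⋙ R ⋙ T := NatIso.ofComponents (fun P ↦ asIso (T.map (adj.unit.app P)))
      fun f ↦ (T.map_comp _ _).symm.trans
        ((T.congr_map (adj.unit.naturality f)).trans (T.map_comp _ _))
    have hc := colimit.isColimit (K ⋙ R)
    have : PreservesColimit ((K ⋙ R) ⋙ L) (R ⋙ T) :=
      preservesColimit_of_preserves_colimit_cocone (isColimitOfPreserves L hc)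
        (IsColimit.mapCoconeEquiv e' (isColimitOfPreserves T hc))
    exact preservesColimit_of_iso_diagram (R ⋙ T) e

end CategoryTheory



namespace TensorProduct

variable {R M P Q : Type*} [CommRing R] [AddCommGroup M] [Module R M] [AddCommGroup P]
  [Module R P] [AddCommGroup Q] [Module R Q]

/-- `M` is a quotient of the free module on its own elements, and tensoring with `Q` is right exact.
-/
lemma exists_eq_sum_of_linearCombination_rTensor_eq_zero (w : (M →₀ R) ⊗[R] Q)
    (hw : (Finsupp.linearCombination R (id : M → M)).rTensor Q w = 0) :
    ∃ (k : ℕ) (κ : Fin k → M →₀ R) (y : Fin k → Q), w = ∑ j, κ j ⊗ₜ[R] y j ∧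
      ∀ j, Finsupp.linearCombination R (id : M → M) (κ j) = 0 := by
  have hex : Function.Exact
      ((LinearMap.ker (Finsupp.linearCombination R (id : M → M))).subtype.rTensor Q)
      ((Finsupp.linearCombination R (id : M → M)).rTensor Q) :=
    rTensor_exact Q (LinearMap.exact_subtype_ker_map _)
      (Finsupp.linearCombination_id_surjective R M)
  obtain ⟨v, rfl⟩ := (hex w).1 hw
  obtain ⟨k, κ, y, rfl⟩ := TensorProduct.exists_sum_tmul_eq v
  exact ⟨k, fun j ↦ κ j, y, by simp, fun j ↦ (κ j).2⟩

lemma exists_finsupp_eq_sum (z : M ⊗[R] P) : ∃ p : M →₀ P, z = ∑ m ∈ p.support, m ⊗ₜ[R] p m := by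
  obtain ⟨p, hp⟩ := exists_finsupp_left z
  exact ⟨p, hp⟩

/-- If `z ∈ M ⊗ P` vanishes in `M ⊗ Q`, the relations in `Q` which witness this. -/
lemma exists_of_lTensor_eq_zero (f : P →ₗ[R] Q) (z : M ⊗[R] P) (hz : f.lTensor M z = 0) :
    ∃ (S : Finset M) (p : M → P) (k : ℕ) (a : M → Fin k → R) (y : Fin k → Q),
      z = ∑ m ∈ S, m ⊗ₜ[R] p m ∧ (∀ m, f (p m) = ∑ j, a m j • y j) ∧
        ∀ j, ∑ m ∈ S, a m j • m = 0 := by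
  classical
  obtain ⟨p, rfl⟩ := exists_finsupp_eq_sum z
  obtain ⟨k, κ, y, hw, hκ⟩ := exists_eq_sum_of_linearCombination_rTensor_eq_zero
    (∑ m ∈ p.support, Finsupp.single m (1 : R) ⊗ₜ[R] f (p m)) (by simpa using hz)
  have key (m : M) : f (p m) = ∑ j, κ j m • y j := by
    have h := DFunLike.congr_fun (congr_arg (finsuppScalarLeft R Q M) hw) m
    simp only [map_sum, Finsupp.finsetSum_apply, finsuppScalarLeft_apply_tmul_apply] at h
    refine Eq.trans ?_ h
    by_cases hm : m ∈ p.support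
    · rw [Finset.sum_eq_single m (fun m' _ hm' ↦ by
        rw [Finsupp.single_eq_of_ne' hm', zero_smul]) (fun h ↦ (h hm).elim),
        Finsupp.single_eq_same, one_smul]
    · rw [Finset.sum_eq_zero fun m' hm' ↦ by
        rw [Finsupp.single_eq_of_ne' (fun h : m' = m ↦ hm (h ▸ hm')), zero_smul],
        Finsupp.notMem_support_iff.1 hm, map_zero]
  refine ⟨p.support ∪ Finset.univ.biUnion fun j ↦ (κ j).support, p, k,
    fun m j ↦ κ j m, y, ?_, key, fun j ↦ ?_⟩
  · exact Finset.sum_subset Finset.subset_union_left fun m _ hm ↦ by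
      rw [Finsupp.notMem_support_iff.1 hm, TensorProduct.tmul_zero]
  · have h := hκ j
    rw [Finsupp.linearCombination_apply, Finsupp.sum] at h
    refine Eq.trans (Finset.sum_subset ?_ fun m _ hm ↦ ?_).symm h
    · exact (Finset.subset_biUnion_of_mem (fun j ↦ (κ j).support)
        (Finset.mem_univ j)).trans Finset.subset_union_right
    · exact (congr_arg (· • m) (Finsupp.notMem_support_iff.1 hm)).trans (zero_smul R m)

end TensorProduct

lemma CategoryTheory.GrothendieckTopology.finset_inf_mem {C : Type*} [Category* C]
    (J : GrothendieckTopology C) {X : C} {ι : Type*} (s : Finset ι) (F : ι → Sieve X)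
    (hF : ∀ i ∈ s, F i ∈ J X) : s.inf F ∈ J X := by
  classical
  induction s using Finset.induction_on with
  | empty => exact J.top_mem X
  | insert i s _ ih =>
    rw [Finset.inf_insert]
    exact J.intersection_covering (hF i (Finset.mem_insert_self i s))
      (ih fun j hj ↦ hF j (Finset.mem_insert_of_mem hj))

namespace PresheafOfModules

variable {C : Type*} [Category* C] {J : GrothendieckTopology C} {R : Cᵒᵖ ⥤ CommRingCat.{w}}
  (M : PresheafOfModules.{w} (R ⋙ forget₂ _ RingCat))
  {P Q : PresheafOfModules.{w} (R ⋙ forget₂ _ RingCat)} (f : P ⟶ Q)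

/-- The restriction maps of a presheaf of modules. -/
def res {U V : Cᵒᵖ} (i : U ⟶ V) : M.obj U →+ M.obj V := (M.presheaf.map i).hom

lemma res_smul {U V : Cᵒᵖ} (i : U ⟶ V) (r : R.obj U) (m : M.obj U) :
    M.res i (r • m) = R.map i r • M.res i m :=
  M.map_smul i r m

lemma res_comp {U V W : Cᵒᵖ} (i : U ⟶ V) (j : V ⟶ W) (m : M.obj U) :
    M.res (i ≫ j) m = M.res j (M.res i m) :=
  M.presheaf.map_comp_apply i j m

lemma app_res {U V : Cᵒᵖ} (i : U ⟶ V) (m : P.obj U) :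
    f.app V (P.res i m) = Q.res i (f.app U m) :=
  naturality_apply f i m

lemma res_sum_tmul {U V : Cᵒᵖ} (i : U ⟶ V) {ι : Type*} (S : Finset ι) (m : ι → M.obj U)
    (p : ι → P.obj U) : (M ⊗ P).res i (∑ x ∈ S, m x ⊗ₜ[R.obj U] p x) =
      ∑ x ∈ S, M.res i (m x) ⊗ₜ[R.obj V] P.res i (p x) :=
  map_sum ((M ⊗ P).res i) _ _

lemma isLocallySurjective_whiskerLeft
    [Presheaf.IsLocallySurjective J ((toPresheaf _).map f)] :
    Presheaf.IsLocallySurjective J ((toPresheaf _).map (M ◁ f)) where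
  imageSieve_mem {U} z := by
    change TensorProduct (R.obj (.op U)) (M.obj (.op U)) (Q.obj (.op U)) at z
    obtain ⟨k, m, q, rfl⟩ := TensorProduct.exists_sum_tmul_eq z
    refine J.superset_covering ?_ (J.finset_inf_mem Finset.univ
      (fun j : Fin k ↦ Presheaf.imageSieve ((toPresheaf _).map f) (q j))
        fun j _ ↦ Presheaf.imageSieve_mem J ((toPresheaf _).map f) (U := .op U) (q j))
    intro V i hi
    have hi' (j : Fin k) : ∃ p : P.obj (.op V), f.app _ p = Q.res i.op (q j) :=
      (Finset.inf_le (f := fun j : Fin k ↦ Presheaf.imageSieve ((toPresheaf _).map f) (q j))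
        (Finset.mem_univ j)) _ hi
    choose p hp using hi'
    refine ⟨∑ j, M.res i.op (m j) ⊗ₜ[R.obj (.op V)] p j, ?_⟩
    refine Eq.trans ?_ (M.res_sum_tmul i.op Finset.univ m q).symm
    refine (map_sum ((f.app (.op V)).hom.lTensor (M.obj (.op V))) _ _).trans ?_
    exact Finset.sum_congr rfl fun j _ ↦
      congr_arg (M.res i.op (m j) ⊗ₜ[R.obj (.op V)] ·) (hp j)

/-- By the equational criterion, `z = ∑ m ⊗ p m` with `f (p m) = ∑ a m j • y j` and `∑ a m j • m =
0`. Locally `y j = f (x j)`, by local surjectivity; then, on a further cover, `p m = ∑ a m j • x j`,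
by local injectivity. So `z` restricts to `∑ j, (∑ m, a m j • m) ⊗ x j = 0`. -/
lemma exists_mem_of_whiskerLeft_app_eq_zero
    [Presheaf.IsLocallySurjective J ((toPresheaf _).map f)]
    [Presheaf.IsLocallyInjective J ((toPresheaf _).map f)] {U : C} (z : (M ⊗ P).obj (.op U))
    (hz : (M ◁ f).app (.op U) z = 0) :
    ∃ S ∈ J U, ∀ ⦃V : C⦄ (i : V ⟶ U), S i → (M ⊗ P).res i.op z = 0 := by
  obtain ⟨S, p, k, a, y, rfl, hp, ha⟩ :=
    TensorProduct.exists_of_lTensor_eq_zero (R := R.obj (.op U)) (f.app (.op U)).hom z hz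
  let S₁ : Sieve U := Finset.univ.inf
    fun j : Fin k ↦ Presheaf.imageSieve ((toPresheaf _).map f) (y j)
  have hS₁ : S₁ ∈ J U := J.finset_inf_mem _ _ fun j _ ↦
    Presheaf.imageSieve_mem J ((toPresheaf _).map f) (U := .op U) (y j)
  let Z : Sieve U := Presheaf.equalizerSieve (F := (M ⊗ P).presheaf) (X := .op U)
    (∑ m ∈ S, m ⊗ₜ[R.obj (.op U)] p m : TensorProduct (R.obj (.op U)) _ _) 0
  have hZ {V : C} (i : V ⟶ U) : Z i ↔ (M ⊗ P).res i.op (∑ m ∈ S, m ⊗ₜ[R.obj (.op U)] p m) = 0 := by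
    change _ = (M ⊗ P).res i.op 0 ↔ _
    rw [map_zero]
    rfl
  refine ⟨Z, J.transitive hS₁ _ fun V i hi ↦ ?_, fun V i hi ↦ (hZ i).1 hi⟩
  have hi' (j : Fin k) : ∃ x : P.obj (.op V), f.app _ x = Q.res i.op (y j) :=
    (Finset.inf_le (f := fun j : Fin k ↦ Presheaf.imageSieve ((toPresheaf _).map f) (y j))
      (Finset.mem_univ j)) _ hi
  choose x hx using hi'
  let x' (m : M.obj (.op U)) : P.obj (.op V) :=
    ∑ j, (R.map i.op (a m j) : R.obj (.op V)) • x j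
  have hx' (m : M.obj (.op U)) : f.app _ (P.res i.op (p m)) = f.app _ (x' m) := by
    rw [app_res]
    refine (congr_arg (Q.res i.op) (hp m)).trans ?_
    refine (map_sum (Q.res i.op) _ _).trans
      (Eq.trans ?_ (map_sum (f.app (.op V)).hom _ _).symm)
    refine Finset.sum_congr rfl fun j _ ↦ ?_
    refine (Q.res_smul i.op (a m j) (y j)).trans ?_
    rw [← hx]
    exact ((f.app (.op V)).hom.map_smul (R.map i.op (a m j)) (x j)).symm
  refine J.superset_covering ?_ (J.finset_inf_mem S
    (fun m ↦ Presheaf.equalizerSieve (F := P.presheaf) (X := .op V) (P.res i.op (p m)) (x' m))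
      fun m _ ↦ Presheaf.equalizerSieve_mem J ((toPresheaf _).map f) (X := .op V) _ _ (hx' m))
  intro W l hl
  have hl' (m : M.obj (.op U)) (hm : m ∈ S) :
      P.res l.op (P.res i.op (p m)) = P.res l.op (x' m) :=
    (Finset.inf_le (f := fun m ↦ Presheaf.equalizerSieve (F := P.presheaf) (X := .op V)
      (P.res i.op (p m)) (x' m)) hm) _ hl
  refine (hZ _).2 ?_
  refine (M.res_sum_tmul (l ≫ i).op S id p).trans ?_
  have h (m : M.obj (.op U)) (hm : m ∈ S) : P.res (l ≫ i).op (p m) =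
      ∑ j, (R.map (l ≫ i).op (a m j) : R.obj (.op W)) • P.res l.op (x j) := by
    refine (P.res_comp i.op l.op (p m)).trans ((hl' m hm).trans ?_)
    refine (map_sum (P.res l.op) _ _).trans (Finset.sum_congr rfl fun j _ ↦ ?_)
    refine (P.res_smul l.op _ _).trans ?_
    congr 1
    exact (R.map_comp_apply i.op l.op (a m j)).symm
  rw [Finset.sum_congr rfl fun m hm ↦ congr_arg _ (h m hm)]
  simp only [TensorProduct.tmul_sum, TensorProduct.tmul_smul, id]
  rw [Finset.sum_comm]
  refine Finset.sum_eq_zero fun j _ ↦ ?_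
  simp only [TensorProduct.smul_tmul', ← TensorProduct.sum_tmul, ← res_smul, ← map_sum]
  rw [ha, map_zero, TensorProduct.zero_tmul]
  rfl

lemma isLocallyInjective_whiskerLeft
    [Presheaf.IsLocallySurjective J ((toPresheaf _).map f)]
    [Presheaf.IsLocallyInjective J ((toPresheaf _).map f)] :
    Presheaf.IsLocallyInjective J ((toPresheaf _).map (M ◁ f)) where
  equalizerSieve_mem {U} z z' h := by
    have hz : (M ◁ f).app (.op U.unop) ((show (M ⊗ P).obj U from z) -
        (show (M ⊗ P).obj U from z')) = 0 := by
      rw [map_sub]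
      exact sub_eq_zero.2 h
    obtain ⟨S, hS, h⟩ := M.exists_mem_of_whiskerLeft_app_eq_zero (J := J) f _ hz
    refine J.superset_covering (fun V i hi ↦ ?_) hS
    have := h i hi
    rw [map_sub] at this
    exact sub_eq_zero.1 this

lemma preservesColimitsOfShape_tensorLeft (K : Type w) [SmallCategory K] :
    PreservesColimitsOfShape K (tensorLeft M) where
  preservesColimit := ⟨fun {c} hc ↦ ⟨evaluationJointlyReflectsColimits _ _ fun U ↦ by
    exact isColimitOfPreserves (evaluation (R ⋙ forget₂ _ RingCat) U ⋙
      tensorLeft (C := ModuleCat (R.obj U)) (M.obj U)) hc⟩⟩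

end PresheafOfModules

namespace AlgebraicGeometry.Scheme.Modules

variable {X : Scheme.{w}}

lemma isIso_modulesSheafification_map {P Q : X.PresheafOfModules} (f : P ⟶ Q)
    [Presheaf.IsLocallySurjective (Opens.grothendieckTopology X)
      ((PresheafOfModules.toPresheaf _).map f)]
    [Presheaf.IsLocallyInjective (Opens.grothendieckTopology X)
      ((PresheafOfModules.toPresheaf _).map f)] : IsIso ((modulesSheafification X).map f) := by
  have h : (Opens.grothendieckTopology X).W ((PresheafOfModules.toPresheaf _).map f) :=
    (Opens.grothendieckTopology X).W_of_isLocallyBijective _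
  rw [GrothendieckTopology.W_iff] at h
  refine (isIso_iff_of_reflects_iso _ (SheafOfModules.toSheaf X.ringCatSheaf)).1 ?_
  exact h

/-- The unit of sheafification is locally bijective, and tensoring with `M` preserves this. Hence
the sheaf tensor product inherits cocontinuity from the presheaf tensor product. -/
instance isIso_presheafTensor_unit (M P : X.PresheafOfModules) :
    IsIso (((presheafTensor X).obj M ⋙ modulesSheafification X).map
      ((modulesSheafificationAdjunction X).unit.app P)) := by
  let η := (modulesSheafificationAdjunction X).unit.app P
  have h : (Opens.grothendieckTopology X).W ((PresheafOfModules.toPresheaf _).map η) :=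
    GrothendieckTopology.W_toSheafify _ _
  rw [GrothendieckTopology.W_iff_isLocallyBijective] at h
  have h₁ : Presheaf.IsLocallySurjective (Opens.grothendieckTopology X)
    ((PresheafOfModules.toPresheaf (X.presheaf ⋙ forget₂ CommRingCat RingCat)).map η) := h.2
  have h₂ : Presheaf.IsLocallyInjective (Opens.grothendieckTopology X)
    ((PresheafOfModules.toPresheaf (X.presheaf ⋙ forget₂ CommRingCat RingCat)).map η) := h.1
  have h₃ := PresheafOfModules.isLocallySurjective_whiskerLeft
    (J := Opens.grothendieckTopology X) (R := X.presheaf) M η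
  have h₄ := PresheafOfModules.isLocallyInjective_whiskerLeft
    (J := Opens.grothendieckTopology X) (R := X.presheaf) M η
  exact @isIso_modulesSheafification_map X _ _ (((presheafTensor X).obj M).map η) h₃ h₄

instance (M : X.Modules) : PreservesColimitsOfSize.{w, w} ((sheafTensor X).obj M) where
  preservesColimitsOfShape {J _} := by
    let T := (presheafTensor X).obj ((toPresheafOfModules X).obj M)
    have : PreservesColimitsOfShape J T :=
      PresheafOfModules.preservesColimitsOfShape_tensorLeft (R := X.presheaf) _ J
    exact (modulesSheafificationAdjunction X).preservesColimitsOfShape_comp_of_isIso_map_unit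
      (T ⋙ modulesSheafification X) J

/-- The symmetry of the tensor product of sheaves of modules. -/
def sheafTensorFlipObjIso (M : X.Modules) : (sheafTensor X).obj M ≅ (sheafTensor X).flip.obj M :=
  letI e : (presheafTensor X).obj ((toPresheafOfModules X).obj M) ≅
      (presheafTensor X).flip.obj ((toPresheafOfModules X).obj M) :=
    BraidedCategory.tensorLeftIsoTensorRight (C := _root_.PresheafOfModules.{w}
      (X.presheaf ⋙ forget₂ CommRingCat RingCat)) ((toPresheafOfModules X).obj M)
  letI e' := Functor.isoWhiskerLeft (toPresheafOfModules X)
    (Functor.isoWhiskerRight e (modulesSheafification X))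
  { hom := { app := e'.hom.app, naturality _ _ f := e'.hom.naturality f }
    inv := { app := e'.inv.app, naturality _ _ f := e'.inv.naturality f }
    hom_inv_id := e'.hom_inv_id
    inv_hom_id := e'.inv_hom_id }

instance (M : X.Modules) : PreservesColimitsOfSize.{w, w} ((sheafTensor X).flip.obj M) :=
  preservesColimits_of_natIso (sheafTensorFlipObjIso M)

end AlgebraicGeometry.Scheme.Modules
end

/-! ### Quasi-coherence tested on affine open subsets -/

noncomputable section

namespace AlgebraicGeometry

namespace Scheme.Modules

variable {X : Scheme.{w}}

/-- Transport of a presentation along an isomorphism of sheaves of modules. -/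
def presentationOfIso {M N : X.Modules} (e : M ≅ N) (p : M.Presentation) : N.Presentation :=
  @SheafOfModules.Presentation.ofIsIso.{w, w, w} _ _ _ _ _ _ M N e.hom
    (show IsIso e.hom from inferInstance) p

lemma nonempty_presentation_of_isQuasicoherent {R : CommRingCat.{w}} (M : (Spec R).Modules)
    (hM : M.IsQuasicoherent) : Nonempty M.Presentation := by
  have : IsIso M.fromTildeΓ := (isQuasicoherent_iff_isIso_fromTildeΓ M).1 hM
  exact ⟨presentationOfIso (asIso M.fromTildeΓ)
    (presentationTilde _ .univ (by simp) _ (Submodule.span_eq _))⟩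

instance isOpenImmersion_fromSpec {U : X.Opens} (hU : IsAffineOpen U) :
    IsOpenImmersion hU.fromSpec := hU.isOpenImmersion_fromSpec

/-- On a spectrum a quasi-coherent sheaf has a global presentation. It is transported to the slice
`M.over U`, and the affine open subsets cover `X`. -/
lemma isQuasicoherent_of_restrict_fromSpec (M : X.Modules)
    (h : ∀ (U : X.Opens) (hU : IsAffineOpen U),
      (M.restrict hU.fromSpec).IsQuasicoherent) :
    M.IsQuasicoherent := by
  have hover (U : X.affineOpens) : (M.over U.1).IsQuasicoherent := by
    obtain ⟨p⟩ := nonempty_presentation_of_isQuasicoherent _ (h U.1 U.2)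
    have hU : IsAffineOpen U.1 := U.2
    let e : (M.restrict hU.fromSpec).restrict hU.isoSpec.hom ≅ M.restrict U.1.ι :=
      (restrictFunctorComp hU.isoSpec.hom hU.fromSpec).symm.app M ≪≫
        (restrictFunctorCongr hU.isoSpec_hom_fromSpec).app M
    let p₁ : SheafOfModules.Presentation (M.restrict U.1.ι) :=
      presentationOfIso e (presentationRestrict hU.isoSpec.hom p)
    let p₂ : SheafOfModules.Presentation ((overEquiv U.1).functor.obj (M.over U.1)) :=
      presentationOfIso ((overFunctorEquiv U.1).symm.app M) p₁
    let F : SheafOfModules.{w} (U.1 : Scheme.{w}).ringCatSheaf ⥤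
        SheafOfModules.{w} (X.ringCatSheaf.over U.1) := (overEquiv U.1).inverse
    have : PreservesColimitsOfSize.{w, w} F :=
      (overEquiv U.1).symm.toAdjunction.leftAdjoint_preservesColimits
    let e₂ : (overEquiv U.1).inverse.obj (.unit (U.1 : Scheme.{w}).ringCatSheaf) ≅
        .unit (X.ringCatSheaf.over U.1) :=
      (overEquiv U.1).inverse.mapIso ((restrictUnitIso U.1.ι).symm ≪≫
        (overFunctorEquiv U.1).symm.app _) ≪≫ ((overEquiv U.1).unitIso.app _).symm
    let p₃ := p₂.map F e₂.symm
    exact (SheafOfModules.Presentation.ofIsIso.{w, w, w} ((overEquiv U.1).unitIso.app _).inv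
      p₃).isQuasicoherent
  refine SheafOfModules.IsQuasicoherent.of_coversTop M (fun U : X.affineOpens ↦ U.1) ?_
  exact (Opens.coversTop_iff X _).2 (iSup_affineOpens_eq_top X)

end Scheme.Modules

end AlgebraicGeometry

end

noncomputable section

namespace AlgebraicGeometry

namespace Scheme.Modules

/-- The elementwise form of: the restriction map `M(U) ⟶ M(V)` is a localization at `f`. -/
structure LocalizesAt {X : Scheme.{w}} (M : X.Modules) {U V : X.Opens} (i : V ⟶ U) (f : Γ(X, U)) :
    Prop where
  exists_map_eq (s : Γ(M, V)) :
    ∃ (n : ℕ) (t : Γ(M, U)), M.presheaf.map i.op t = X.presheaf.map i.op (f ^ n) • s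
  exists_smul_eq_zero (t : Γ(M, U)) (ht : M.presheaf.map i.op t = 0) : ∃ n : ℕ, f ^ n • t = 0

/-- Quasi-coherence on a spectrum means that sections on each basic open subset are the localization
of the global ones. Invertibility of `f` there is automatic, so only the two conditions of
`LocalizesAt` remain. -/
lemma isQuasicoherent_iff_localizesAt_Spec {R : CommRingCat.{w}} (M : (Spec R).Modules) :
    M.IsQuasicoherent ↔ ∀ f : R, M.LocalizesAt (PrimeSpectrum.basicOpen f).leTop
      ((Scheme.ΓSpecIso R).inv f) := by
  rw [isQuasicoherent_iff_isIso_fromTildeΓ, isIso_fromTildeΓ_iff_isLocalizing]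
  let φ (f : R) := ((modulesSpecToSheaf.obj M).obj.map
    (PrimeSpectrum.basicOpen f).leTop.op).hom
  have smul_top (f : R) (n : ℕ) (x : Γ(M, ⊤)) : f ^ n • x = (Scheme.ΓSpecIso R).inv f ^ n • x := by
    have : (Spec R).presheaf.map (homOfLE (le_refl ⊤)).op ((Scheme.ΓSpecIso R).inv (f ^ n)) =
        (Scheme.ΓSpecIso R).inv f ^ n :=
      (congr($((Spec R).presheaf.map_id (.op ⊤)) ((Scheme.ΓSpecIso R).inv (f ^ n)))).trans
        (map_pow (Scheme.ΓSpecIso R).inv.hom f n)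
    exact congr($this • x)
  have smul_map (V : (Spec R).Opens) (f : R) (n : ℕ) (x : Γ(M, V)) :
      f ^ n • x = (Spec R).presheaf.map V.leTop.op ((Scheme.ΓSpecIso R).inv f ^ n) • x := by
    rw [← map_pow]
    rfl
  refine forall_congr' fun f ↦ ⟨fun h ↦ ?_, fun h ↦ ?_⟩
  · have hf : IsLocalizedModule.Away f (φ f) := h
    refine ⟨fun s ↦ ?_, fun t ht ↦ ?_⟩
    · obtain ⟨n, y, hy⟩ := hf.surj _ _ s
      exact ⟨n, y, hy.symm.trans (smul_map (PrimeSpectrum.basicOpen f) f n s)⟩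
    · obtain ⟨⟨_, n, rfl⟩, hn⟩ := (IsLocalizedModule.eq_zero_iff (.powers f) (φ f)).mp ht
      exact ⟨n, (smul_top f n t).symm.trans hn⟩
  · refine IsLocalizedModule.Away.mk_of_addCommGroup
      (isUnit_algebraMap_end_of_le_basicOpen f le_rfl) (fun s ↦ ?_) fun t ht ↦ ?_
    · obtain ⟨n, t, hy⟩ := h.exists_map_eq s
      exact ⟨n, t, (smul_map (PrimeSpectrum.basicOpen f) f n s).trans hy.symm⟩
    · obtain ⟨n, hn⟩ := h.exists_smul_eq_zero t ht
      exact ⟨n, (smul_top f n t).trans hn⟩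

variable {X : Scheme.{w}}

lemma localizesAt_congr (M : X.Modules) {U V W V' : X.Opens} (hW : W = U) (hV : V' = V)
    (i : V ⟶ U) (i' : V' ⟶ W) (j : W ⟶ U) (f : Γ(X, U)) :
    M.LocalizesAt i' (X.presheaf.map j.op f) ↔ M.LocalizesAt i f := by
  subst hW hV
  obtain rfl : j = 𝟙 _ := Subsingleton.elim _ _
  obtain rfl : i = i' := Subsingleton.elim _ _
  have : X.presheaf.map (𝟙 W).op f = f := congr($(X.presheaf.map_id (.op W)) f)
  rw [this]

lemma localizesAt_restrict_iff {Y : Scheme.{w}} (g : Y ⟶ X) [IsOpenImmersion g] (M : X.Modules)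
    {U V : Y.Opens} (i : V ⟶ U) (f : Γ(Y, U)) :
    (M.restrict g).LocalizesAt i f ↔
      M.LocalizesAt (g.opensFunctor.map i) ((g.appIso U).inv f) := by
  have h₁ (n : ℕ) (x : Γ(M.restrict g, U)) :
      (f ^ n • x : Γ(M.restrict g, U)) =
        ((g.appIso U).inv f ^ n • (show Γ(M, g ''ᵁ U) from x) :) := by
    rw [← map_pow]
    rfl
  have h₂ (n : ℕ) (x : Γ(M.restrict g, V)) :
      (Y.presheaf.map i.op (f ^ n) • x : Γ(M.restrict g, V)) =
        (X.presheaf.map (g.opensFunctor.map i).op ((g.appIso U).inv f ^ n) •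
          (show Γ(M, g ''ᵁ V) from x) :) := by
    rw [← map_pow]
    have : (g.appIso V).inv (Y.presheaf.map i.op (f ^ n)) =
      X.presheaf.map (g.opensFunctor.map i).op ((g.appIso U).inv (f ^ n)) :=
        congr($(g.appIso_inv_naturality i.op) (f ^ n))
    exact congr($this • (show Γ(M, g ''ᵁ V) from x))
  constructor
  · rintro ⟨h, h'⟩
    refine ⟨fun s ↦ ?_, fun t ht ↦ ?_⟩
    · obtain ⟨n, t, ht⟩ := h s
      exact ⟨n, t, ht.trans (h₂ n s)⟩
    · obtain ⟨n, hn⟩ := h' t ht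
      exact ⟨n, (h₁ n t).symm.trans hn⟩
  · rintro ⟨h, h'⟩
    refine ⟨fun s ↦ ?_, fun t ht ↦ ?_⟩
    · obtain ⟨n, t, ht⟩ := h s
      exact ⟨n, t, ht.trans (h₂ n s).symm⟩
    · obtain ⟨n, hn⟩ := h' t ht
      exact ⟨n, (h₁ n t).trans hn⟩

lemma isQuasicoherent_restrict_fromSpec_iff (M : X.Modules) {U : X.Opens} (hU : IsAffineOpen U) :
    (M.restrict hU.fromSpec).IsQuasicoherent ↔
      ∀ f : Γ(X, U), M.LocalizesAt (homOfLE (X.basicOpen_le f)) f := by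
  rw [isQuasicoherent_iff_localizesAt_Spec]
  refine forall_congr' fun f ↦ ?_
  refine (localizesAt_restrict_iff hU.fromSpec M _ _).trans ?_
  have hW : hU.fromSpec ''ᵁ ⊤ = U :=
    (Scheme.Hom.image_top_eq_opensRange _).trans hU.opensRange_fromSpec
  have : (hU.fromSpec.appIso ⊤).inv ((Scheme.ΓSpecIso Γ(X, U)).inv f) =
      X.presheaf.map (homOfLE hW.le).op f := by
    have h : (Scheme.ΓSpecIso Γ(X, U)).inv =
        hU.fromSpec.appLE U ⊤ hU.fromSpec_preimage_self.ge := by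
      rw [Scheme.Hom.appLE, hU.fromSpec_app_self, Category.assoc, ← Functor.map_comp]
      exact ((_ ≫= (Spec Γ(X, U)).presheaf.map_id _).trans (Category.comp_id _)).symm
    rw [h]
    exact congr($(hU.fromSpec.appLE_appIso_inv hU.fromSpec_preimage_self.ge) f)
  rw [this]
  exact localizesAt_congr M hW (hU.fromSpec_image_basicOpen f) _ _ _ _

lemma isQuasicoherent_iff (M : X.Modules) :
    M.IsQuasicoherent ↔ ∀ (U : X.Opens) (_ : IsAffineOpen U) (f : Γ(X, U)),
      M.LocalizesAt (homOfLE (X.basicOpen_le f)) f :=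
  ⟨fun _ _ hU ↦ (isQuasicoherent_restrict_fromSpec_iff M hU).1 inferInstance,
    fun h ↦ isQuasicoherent_of_restrict_fromSpec M fun U hU ↦
      (isQuasicoherent_restrict_fromSpec_iff M hU).2 (h U hU)⟩

end Scheme.Modules

end AlgebraicGeometry

end

/-! ### Closure properties of quasi-coherent sheaves -/

noncomputable section

namespace AlgebraicGeometry

namespace Scheme.Modules

variable {X : Scheme.{w}}

lemma app_map {M N : X.Modules} (φ : M ⟶ N) {U V : X.Opens} (i : V ⟶ U) (s : Γ(M, U)) :
    φ.app V (M.presheaf.map i.op s) = N.presheaf.map i.op (φ.app U s) :=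
  congr($(φ.mapPresheaf.naturality i.op) s)

lemma app_injective_of_mono {M N : X.Modules} (φ : M ⟶ N) [Mono φ] (U : X.Opens) :
    Function.Injective (φ.app U) := by
  intro s t h
  obtain ⟨s, rfl⟩ := freeOnEquiv.surjective s
  obtain ⟨t, rfl⟩ := freeOnEquiv.surjective t
  rw [← freeOnEquiv_comp, ← freeOnEquiv_comp, freeOnEquiv.apply_eq_iff_eq, cancel_mono] at h
  rw [h]

lemma exists_app_eq_of_isLimit {M N : X.Modules} {φ : M ⟶ N} {k : KernelFork φ}
    (hk : IsLimit k) (U : X.Opens) (s : Γ(M, U)) (hs : φ.app U s = 0) :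
    ∃ t : Γ(k.pt, U), k.ι.app U t = s := by
  obtain ⟨s, rfl⟩ := freeOnEquiv.surjective s
  have : s ≫ φ = 0 := by
    refine freeOnEquiv.injective ?_
    rw [freeOnEquiv_comp, hs, ← comp_zero (f := 𝟙 (freeOn X U)), freeOnEquiv_comp]
    rfl
  refine ⟨freeOnEquiv (KernelFork.IsLimit.lift' hk s this).1, ?_⟩
  rw [← freeOnEquiv_comp, (KernelFork.IsLimit.lift' hk s this).2]

lemma localizesAt_of_isLimit {M N : X.Modules} {φ : M ⟶ N} {k : KernelFork φ} (hk : IsLimit k)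
    {U V : X.Opens} (i : V ⟶ U) (f : Γ(X, U)) (hM : M.LocalizesAt i f) (hN : N.LocalizesAt i f) :
    LocalizesAt k.pt i f := by
  have : Mono k.ι := Fork.IsLimit.mono hk
  constructor
  · intro s
    obtain ⟨n, t, ht⟩ := hM.exists_map_eq (k.ι.app V s)
    have h0 : N.presheaf.map i.op (φ.app U t) = 0 := by
      have : φ.app V (k.ι.app V s) = 0 := congr($(k.condition).app V s)
      rw [← app_map, ht, Hom.app_smul, this, smul_zero]
    -- The exponent `n` clears the denominator in `M`, and `m` kills the remaining image in `N`;
    -- together they move the section into the kernel.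
    obtain ⟨m, hm⟩ := hN.exists_smul_eq_zero _ h0
    obtain ⟨t', ht'⟩ := exists_app_eq_of_isLimit hk U (f ^ m • t)
      ((Hom.app_smul φ _ _).trans hm)
    refine ⟨m + n, t', app_injective_of_mono k.ι V ?_⟩
    rw [app_map, ht', map_smul, ht, Hom.app_smul, pow_add, map_mul, mul_smul]
  · intro t ht
    have h0 : M.presheaf.map i.op (k.ι.app U t) = 0 := by rw [← app_map, ht, map_zero]
    obtain ⟨n, hn⟩ := hM.exists_smul_eq_zero _ h0
    refine ⟨n, app_injective_of_mono k.ι U ?_⟩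
    rw [Hom.app_smul, hn, map_zero]

variable (X) in
/-- The quasi-coherent sheaves, among all sheaves of modules. -/
abbrev quasicoherent : ObjectProperty X.Modules := fun M ↦ SheafOfModules.IsQuasicoherent M

instance : (quasicoherent X).IsClosedUnderKernels where
  kernels_le := by
    rintro _ ⟨φ, k, hk, hM, hN⟩
    exact (isQuasicoherent_iff _).2 fun U hU f ↦ localizesAt_of_isLimit hk _ f
      ((isQuasicoherent_iff _).1 hM U hU f) ((isQuasicoherent_iff _).1 hN U hU f)

/-- On a spectrum the quasi-coherent sheaves are the essential image of `tilde`, which is fully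
faithful and a left adjoint. -/
lemma isClosedUnderColimitsOfShape_quasicoherent_Spec (R : CommRingCat.{w}) (J : Type*)
    [Category* J] [HasColimitsOfShape J (ModuleCat.{w} R)] :
    (quasicoherent (Spec R)).IsClosedUnderColimitsOfShape J := by
  have : PreservesColimitsOfShape J (tilde.functor R) :=
    (tilde.adjunction (R := R)).leftAdjoint_preservesColimits.preservesColimitsOfShape
  have : (tilde.functor R).essImage.IsClosedUnderColimitsOfShape J := inferInstance
  rwa [essImage_tilde] at this

lemma isClosedUnderColimitsOfShape_quasicoherent (J : Type*) [Category* J]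
    (h : ∀ R : CommRingCat.{w}, HasColimitsOfShape J (ModuleCat.{w} R)) :
    (quasicoherent X).IsClosedUnderColimitsOfShape J where
  colimitsOfShape_le := by
    rintro M ⟨p⟩
    refine isQuasicoherent_of_restrict_fromSpec M fun U hU ↦ ?_
    have : PreservesColimitsOfShape J (restrictFunctor hU.fromSpec) := inferInstance
    have := isClosedUnderColimitsOfShape_quasicoherent_Spec Γ(X, U) J
    refine (quasicoherent (Spec Γ(X, U))).prop_of_isColimit
      (isColimitOfPreserves (restrictFunctor hU.fromSpec) p.isColimit) fun j ↦ ?_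
    have := p.prop_diag_obj j
    exact isQuasicoherent_restrictFunctor hU.fromSpec (p.diag.obj j)

instance (J : Type w) [SmallCategory J] : (quasicoherent X).IsClosedUnderColimitsOfShape J :=
  isClosedUnderColimitsOfShape_quasicoherent J fun _ ↦ inferInstance

instance : (quasicoherent X).IsClosedUnderColimitsOfShape WalkingParallelPair :=
  isClosedUnderColimitsOfShape_quasicoherent _ fun _ ↦ inferInstance

instance : (quasicoherent X).IsClosedUnderFiniteCoproducts where
  isClosedUnderColimitsOfShape _ _ :=
    isClosedUnderColimitsOfShape_quasicoherent _ fun _ ↦ inferInstance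

instance : (quasicoherent X).IsClosedUnderCokernels where
  cokernels_le := by
    rintro _ ⟨φ, k, hk, hM, hN⟩
    exact (quasicoherent X).prop_of_isColimit hk (by rintro (_ | _) <;> assumption)

instance : (quasicoherent X).IsClosedUnderIsomorphisms :=
  inferInstanceAs (SheafOfModules.isQuasicoherent X.ringCatSheaf).IsClosedUnderIsomorphisms

instance : (quasicoherent X).ContainsZero where
  exists_zero := ⟨⊥_ X.Modules, (isZero_zero _).of_iso HasZeroObject.zeroIsoInitial.symm,
    (quasicoherent X).prop_initial⟩

instance : (quasicoherent X).IsClosedUnderFiniteProducts where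
  isClosedUnderLimitsOfShape J _ := ⟨by
    rintro M ⟨p⟩
    have := Abelian.hasFiniteBiproducts (C := X.Modules)
    let F (j : J) : X.Modules := p.diag.obj ⟨j⟩
    let e : p.diag ≅ Discrete.functor F := Discrete.natIso fun _ ↦ Iso.refl _
    let e' : ∐ F ≅ M := (biproduct.isoCoproduct F).symm ≪≫ biproduct.isoProduct F ≪≫
      (HasLimit.isoOfNatIso e).symm ≪≫ (limit.isLimit p.diag).conePointUniqueUpToIso p.isLimit
    exact (quasicoherent X).prop_of_iso e'
      ((quasicoherent X).prop_coproduct fun j ↦ p.prop_diag_obj ⟨j⟩)⟩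

end Scheme.Modules

end AlgebraicGeometry

namespace AlgebraicGeometry

variable (X : Scheme.{w})

instance : Abelian (QCoh X) :=
  inferInstanceAs (Abelian (Scheme.Modules.quasicoherent X).FullSubcategory)

instance : PreservesFiniteLimits (Scheme.Modules.quasicoherent X).ι :=
  have := (Scheme.Modules.quasicoherent X).preservesKernels_ι
  Functor.preservesFiniteLimits_of_preservesKernels _

instance : PreservesFiniteColimits (Scheme.Modules.quasicoherent X).ι :=
  have := (Scheme.Modules.quasicoherent X).preservesCokernels_ι
  Functor.preservesFiniteColimits_of_preservesCokernels _

instance : HasColimitsOfSize.{w, w} (QCoh X) where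
  has_colimits_of_shape J _ :=
    inferInstanceAs (HasColimitsOfShape J (Scheme.Modules.quasicoherent X).FullSubcategory)

instance : PreservesColimitsOfSize.{w, w} (Scheme.Modules.quasicoherent X).ι where
  preservesColimitsOfShape := inferInstance

instance : AB5OfSize.{w, w} (QCoh X) where
  ofShape J _ _ := HasExactColimitsOfShape.domain_of_functor J (Scheme.Modules.quasicoherent X).ι

end AlgebraicGeometry

end

/-! ### Quasi-coherent subsheaves from submodules on affine open subsets -/

noncomputable section

namespace AlgebraicGeometry.Scheme.Modules

variable {X : Scheme.{w}}

lemma section_ext_of_isAffineOpen (M : X.Modules) {U : X.Opens} (s t : Γ(M, U))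
    (h : ∀ (V : X.Opens) (_ : IsAffineOpen V) (i : V ⟶ U),
      M.presheaf.map i.op s = M.presheaf.map i.op t) : s = t := by
  refine TopCat.Sheaf.eq_of_locally_eq' ⟨_, M.isSheaf⟩
    (fun V : { V : X.Opens // IsAffineOpen V ∧ V ≤ U } ↦ V.1) U (fun V ↦ homOfLE V.2.2) ?_ s t
    fun V ↦ h V.1 V.2.1 _
  intro x hx
  obtain ⟨_, ⟨V, hV, rfl⟩, hxV, hVU⟩ := X.isBasis_affineOpens.exists_subset_of_mem_open hx U.2
  exact TopologicalSpace.Opens.mem_iSup.2 ⟨⟨V, hV, hVU⟩, hxV⟩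

lemma hom_ext_of_isAffineOpen {M N : X.Modules} {φ ψ : M ⟶ N}
    (h : ∀ (U : X.Opens) (_ : IsAffineOpen U) (s : Γ(M, U)), φ.app U s = ψ.app U s) : φ = ψ := by
  refine hom_ext φ ψ fun U ↦ ?_
  ext s
  refine section_ext_of_isAffineOpen N _ _ fun V hV i ↦ ?_
  rw [← app_map, ← app_map, h V hV]

section Subsheaf

variable {M : X.Modules} (N : _root_.PresheafOfModules.Submodule M.val)

/-- A family of submodules of the sections of a sheaf of modules is local if membership may be
checked on an open cover. -/
def IsLocalSubmodule : Prop :=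
  ∀ (U : X.Opens) (s : Γ(M, U)), (∀ x ∈ U, ∃ (V : X.Opens) (i : V ⟶ U), x ∈ V ∧
    M.presheaf.map i.op s ∈ N.obj (.op V)) → s ∈ N.obj (.op U)

variable {N} (hN : IsLocalSubmodule N)

/-- The sheaf of modules given by a local family of submodules. -/
def subsheaf : X.Modules where
  val := N.toPresheafOfModules
  isSheaf := by
    let G : Subfunctor (M.presheaf ⋙ CategoryTheory.forget AddCommGrpCat) :=
      { obj U := (N.obj U : Set (M.val.obj U))
        map f _ hx := N.map_mem f hx }
    have hM : Presieve.IsSheaf (Opens.grothendieckTopology X)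
        (M.presheaf ⋙ CategoryTheory.forget AddCommGrpCat) :=
      (isSheaf_iff_isSheaf_of_type _ _).1
        ((TopCat.Presheaf.isSheaf_iff_isSheaf_comp (CategoryTheory.forget AddCommGrpCat) _).1
          M.isSheaf)
    have hG : Presieve.IsSheaf (Opens.grothendieckTopology X) G.toFunctor :=
      (G.isSheaf_iff hM).2 fun U s hs ↦ hN U.unop s fun x hx ↦ by
        obtain ⟨V, i, hi, hxV⟩ := hs x hx
        exact ⟨V, i, hxV, hi⟩
    exact (TopCat.Presheaf.isSheaf_iff_isSheaf_comp (CategoryTheory.forget AddCommGrpCat) _).2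
      ((isSheaf_iff_isSheaf_of_type _ _).2 hG)

/-- The inclusion of `subsheaf`. -/
def subsheafι : subsheaf hN ⟶ M := ⟨N.ι⟩

lemma subsheafι_app_mem (U : X.Opens) (s : Γ(subsheaf hN, U)) :
    (subsheafι hN).app U s ∈ N.obj (.op U) :=
  s.2

lemma exists_subsheafι_app_eq (U : X.Opens) (s : Γ(M, U)) (hs : s ∈ N.obj (.op U)) :
    ∃ t : Γ(subsheaf hN, U), (subsheafι hN).app U t = s :=
  ⟨⟨s, hs⟩, rfl⟩

lemma subsheafι_app_injective (U : X.Opens) : Function.Injective ((subsheafι hN).app U) :=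
  fun _ _ h ↦ Subtype.ext h

end Subsheaf

end AlgebraicGeometry.Scheme.Modules

end

noncomputable section

namespace AlgebraicGeometry.Scheme.Modules

variable {X : Scheme.{w}}

lemma map_map (M : X.Modules) {U V W : X.Opens} (i : V ⟶ U) (j : W ⟶ V) (s : Γ(M, U)) :
    M.presheaf.map j.op (M.presheaf.map i.op s) = M.presheaf.map (j ≫ i).op s :=
  congr($(M.presheaf.map_comp i.op j.op) s).symm

/-- A family of submodules of the sections of `M` on affine open subsets which is compatible
with restrictions and localizations. -/
structure QuasicoherentSubmodule (M : X.Modules) where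
  /-- the submodule of the sections on an affine open subset -/
  obj (U : X.affineOpens) : Submodule Γ(X, U.1) Γ(M, U.1)
  map_mem {U V : X.affineOpens} (i : V.1 ⟶ U.1) {s : Γ(M, U.1)} (hs : s ∈ obj U) :
    M.presheaf.map i.op s ∈ obj V
  exists_map_eq {U : X.affineOpens} (f : Γ(X, U.1)) {s : Γ(M, X.basicOpen f)}
    (hs : s ∈ obj (X.affineBasicOpen f)) :
    ∃ (n : ℕ) (t : Γ(M, U.1)), t ∈ obj U ∧ M.presheaf.map (homOfLE (X.basicOpen_le f)).op t =
      X.presheaf.map (homOfLE (X.basicOpen_le f)).op (f ^ n) • s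

namespace QuasicoherentSubmodule

variable {M : X.Modules} (N : QuasicoherentSubmodule M)

/-- The sections whose restrictions to affine open subsets belong to the given submodules. -/
def extend : _root_.PresheafOfModules.Submodule M.val where
  obj W :=
    { carrier := {s : Γ(M, W.unop) |
        ∀ (V : X.affineOpens) (i : V.1 ⟶ W.unop), M.presheaf.map i.op s ∈ N.obj V}
      zero_mem' V i := by
        have : M.presheaf.map i.op 0 = 0 := map_zero _
        exact this ▸ zero_mem _
      add_mem' {a b} ha hb V i := by
        have : M.presheaf.map i.op (a + b) = M.presheaf.map i.op a + M.presheaf.map i.op b :=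
          map_add _ a b
        exact this ▸ add_mem (ha V i) (hb V i)
      smul_mem' r a ha V i := (M.map_smul i r a) ▸ Submodule.smul_mem _ _ (ha V i) }
  map {W W'} g s hs V i := by
    have : M.presheaf.map (i ≫ g.unop).op s = M.presheaf.map i.op (M.presheaf.map g s) :=
      congr($(M.presheaf.map_comp g i.op) s)
    exact this ▸ hs V (i ≫ g.unop)

lemma mem_extend_iff {U : X.affineOpens} (s : Γ(M, U.1)) :
    s ∈ N.extend.obj (.op U.1) ↔ s ∈ N.obj U := by
  refine ⟨fun h ↦ ?_, fun h V i ↦ N.map_mem i h⟩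
  have : M.presheaf.map (𝟙 U.1).op s = s := congr($(M.presheaf.map_id (.op U.1)) s)
  exact this ▸ h U (𝟙 U.1)

lemma exists_pow_smul_mem (hM : M.IsQuasicoherent) {U : X.affineOpens} (f : Γ(X, U.1))
    (s : Γ(M, U.1)) (hs : M.presheaf.map (homOfLE (X.basicOpen_le f)).op s ∈
      N.obj (X.affineBasicOpen f)) : ∃ n : ℕ, f ^ n • s ∈ N.obj U := by
  obtain ⟨n, t, ht, h⟩ := N.exists_map_eq f hs
  obtain ⟨m, hm⟩ := ((isQuasicoherent_iff M).1 hM U.1 U.2 f).exists_smul_eq_zero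
    (f ^ n • s - t) (by rw [map_sub, map_smul, h, sub_self])
  refine ⟨m + n, ?_⟩
  rw [smul_sub, sub_eq_zero, ← mul_smul, ← pow_add] at hm
  exact hm ▸ Submodule.smul_mem _ _ ht

/-- On an affine `V`, the functions multiplying the section into `N.obj V` form an ideal. Local
membership puts into it a power of some `f` not vanishing at a given point, so the ideal is the unit
ideal. -/
lemma isLocalSubmodule_extend (hM : M.IsQuasicoherent) : IsLocalSubmodule N.extend := by
  intro U s h V i
  let I : Ideal Γ(X, V.1) := (N.obj V).comap (LinearMap.toSpanSingleton _ _ (M.presheaf.map i.op s))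
  have hI : Ideal.span (I : Set Γ(X, V.1)) = ⊤ := by
    rw [← V.2.iSup_basicOpen_eq_self_iff]
    refine le_antisymm (iSup_le fun f ↦ X.basicOpen_le _) fun x hx ↦ ?_
    obtain ⟨W, j, hxW, hW⟩ := h x (i.le hx)
    obtain ⟨f, hf, hxf⟩ := V.2.exists_basicOpen_le ⟨x, hxW⟩ hx
    have h₁ : M.presheaf.map (homOfLE (X.basicOpen_le f)).op (M.presheaf.map i.op s) ∈
        N.obj (X.affineBasicOpen f) := by
      rw [map_map]
      have := hW (X.affineBasicOpen f) (homOfLE hf)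
      rwa [map_map] at this
    obtain ⟨n, hn⟩ := N.exists_pow_smul_mem hM f _ h₁
    refine TopologicalSpace.Opens.mem_iSup.2 ⟨⟨f ^ (n + 1), ?_⟩, ?_⟩
    · change f ^ (n + 1) • M.presheaf.map i.op s ∈ N.obj V
      rw [pow_succ', mul_smul]
      exact Submodule.smul_mem _ _ hn
    · rwa [X.basicOpen_pow _ n.succ_pos]
  have h1 : (1 : Γ(X, V.1)) ∈ I := by
    rw [← Ideal.eq_top_iff_one, ← hI, Ideal.span_eq]
  exact one_smul Γ(X, V.1) (M.presheaf.map i.op s) ▸ h1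

/-- The quasi-coherent subsheaf attached to a compatible family of submodules of sections on affine
open subsets. -/
def sheaf (hM : M.IsQuasicoherent) : X.Modules := subsheaf (N.isLocalSubmodule_extend hM)

/-- The inclusion of the subsheaf. -/
def sheafι (hM : M.IsQuasicoherent) : N.sheaf hM ⟶ M := subsheafι _

variable (hM : M.IsQuasicoherent)

lemma sheafι_app_injective (U : X.Opens) : Function.Injective ((N.sheafι hM).app U) :=
  subsheafι_app_injective _ U

lemma sheafι_app_mem (U : X.affineOpens) (s : Γ(N.sheaf hM, U.1)) :
    (N.sheafι hM).app U.1 s ∈ N.obj U :=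
  (N.mem_extend_iff _).1 (subsheafι_app_mem (N.isLocalSubmodule_extend hM) U.1 s)

lemma exists_sheafι_app_eq (U : X.affineOpens) (s : Γ(M, U.1)) (hs : s ∈ N.obj U) :
    ∃ t : Γ(N.sheaf hM, U.1), (N.sheafι hM).app U.1 t = s :=
  exists_subsheafι_app_eq (N.isLocalSubmodule_extend hM) U.1 s ((N.mem_extend_iff s).2 hs)

lemma isQuasicoherent_sheaf : (N.sheaf hM).IsQuasicoherent := by
  refine (isQuasicoherent_iff _).2 fun U hU f ↦ ⟨fun s ↦ ?_, fun t ht ↦ ?_⟩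
  · obtain ⟨n, z, hz, h⟩ := N.exists_map_eq (U := ⟨U, hU⟩) f
      (N.sheafι_app_mem hM (X.affineBasicOpen (U := ⟨U, hU⟩) f) s)
    obtain ⟨t, rfl⟩ := N.exists_sheafι_app_eq hM ⟨U, hU⟩ z hz
    refine ⟨n, t, N.sheafι_app_injective hM _ ?_⟩
    rw [app_map, Hom.app_smul]
    exact h
  · obtain ⟨n, hn⟩ := ((isQuasicoherent_iff M).1 hM U hU f).exists_smul_eq_zero
      ((N.sheafι hM).app U t) (by rw [← app_map, ht, map_zero])
    exact ⟨n, N.sheafι_app_injective hM _ (by rw [Hom.app_smul, hn, map_zero])⟩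

end QuasicoherentSubmodule

end AlgebraicGeometry.Scheme.Modules

end

/-! ### A generator for quasi-coherent sheaves -/

noncomputable section

namespace AlgebraicGeometry.Scheme.Modules

variable {X : Scheme.{w}}

lemma exists_map_eq_of_mem_span {M : X.Modules} {U V : X.Opens} (i : V ⟶ U) (f : Γ(X, U))
    (hf : ∀ r : Γ(X, V), ∃ (b : Γ(X, U)) (m : ℕ),
      r * X.presheaf.map i.op (f ^ m) = X.presheaf.map i.op b)
    (S : Set Γ(M, U)) (T : Set Γ(M, V))
    (h : ∀ t ∈ T, ∃ n : ℕ, ∃ s ∈ S, M.presheaf.map i.op s = X.presheaf.map i.op (f ^ n) • t)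
    (t : Γ(M, V)) (ht : t ∈ Submodule.span Γ(X, V) T) :
    ∃ (n : ℕ) (s : Γ(M, U)), s ∈ Submodule.span Γ(X, U) S ∧
      M.presheaf.map i.op s = X.presheaf.map i.op (f ^ n) • t := by
  induction ht using Submodule.span_induction with
  | mem x hx =>
    obtain ⟨n, s, hs, h⟩ := h x hx
    exact ⟨n, s, Submodule.subset_span hs, h⟩
  | zero => exact ⟨0, 0, zero_mem _, by rw [map_zero, smul_zero]⟩
  | add x y _ _ hx hy =>
    obtain ⟨n, a, ha, hx⟩ := hx
    obtain ⟨m, b, hb, hy⟩ := hy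
    refine ⟨n + m, f ^ m • a + f ^ n • b,
      add_mem (Submodule.smul_mem _ _ ha) (Submodule.smul_mem _ _ hb), ?_⟩
    rw [map_add, map_smul, map_smul, hx, hy, ← mul_smul, ← mul_smul, ← map_mul, ← map_mul,
      ← pow_add, ← pow_add, smul_add, add_comm m n]
  | smul r x _ hx =>
    obtain ⟨n, a, ha, hx⟩ := hx
    obtain ⟨b, m, hb⟩ := hf r
    refine ⟨m + n, b • a, Submodule.smul_mem _ _ ha, ?_⟩
    rw [map_smul, hx, ← hb, ← mul_smul, ← mul_smul, pow_add, map_mul]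
    congr 1
    ring

/-- Formal generators of the smallest compatible family of submodules containing a section on
`U₀`: they are obtained from this section by restrictions to smaller affine open subsets, and by
extending multiples of sections on basic open subsets. -/
inductive SaturationIndex (U₀ : X.affineOpens) : X.affineOpens → Type w
  | base : SaturationIndex U₀ U₀
  | res {U V : X.affineOpens} (i : V.1 ⟶ U.1) (g : SaturationIndex U₀ U) : SaturationIndex U₀ V
  | lift {U : X.affineOpens} (f : Γ(X, U.1)) (g : SaturationIndex U₀ (X.affineBasicOpen f)) :
      SaturationIndex U₀ U

variable {M : X.Modules} (hM : M.IsQuasicoherent) {U₀ : X.affineOpens} (s : Γ(M, U₀.1))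

/-- The section of `M` attached to a formal generator. -/
def saturationSection : ∀ {U : X.affineOpens}, SaturationIndex U₀ U → Γ(M, U.1)
  | _, .base => s
  | _, .res i g => M.presheaf.map i.op (saturationSection g)
  | U, .lift f g => (((isQuasicoherent_iff M).1 hM U.1 U.2 f).exists_map_eq
      (saturationSection g)).choose_spec.choose

/-- The compatible family of submodules generated by a section. -/
def saturation : QuasicoherentSubmodule M where
  obj U := Submodule.span _ (Set.range (saturationSection hM s (U := U)))
  map_mem {U V} i t ht := by
    induction ht using Submodule.span_induction with
    | mem x hx =>
      obtain ⟨g, rfl⟩ := hx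
      exact Submodule.subset_span ⟨.res i g, rfl⟩
    | zero => exact (map_zero (M.presheaf.map i.op).hom).symm ▸ zero_mem _
    | add x y _ _ hx hy => exact (map_add (M.presheaf.map i.op).hom x y).symm ▸ add_mem hx hy
    | smul r x _ hx => exact (map_smul M i r x).symm ▸ Submodule.smul_mem _ _ hx
  exists_map_eq {U} f t ht := by
    refine exists_map_eq_of_mem_span _ f (fun r ↦ ?_) _ _ ?_ t ht
    · have := U.2.isLocalization_basicOpen f
      obtain ⟨⟨b, _, m, rfl⟩, hb⟩ := IsLocalization.surj (Submonoid.powers f) r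
      exact ⟨b, m, hb⟩
    · rintro _ ⟨g, rfl⟩
      exact ⟨_, _, ⟨.lift f g, rfl⟩, (((isQuasicoherent_iff M).1 hM U.1 U.2 f).exists_map_eq
        (saturationSection hM s g)).choose_spec.choose_spec⟩

lemma saturationSection_mem {U : X.affineOpens} (g : SaturationIndex U₀ U) :
    saturationSection hM s g ∈ (saturation hM s).obj U :=
  Submodule.subset_span ⟨g, rfl⟩

variable (U₀) in
/-- The sheaf of modules covering all quasi-coherent sheaves generated by a section on `U₀`. -/
def saturationCover : X.Modules :=
  ∐ fun g : Σ U, SaturationIndex U₀ U ↦ freeOn X g.1.1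

/-- The formal generators depend on `U₀` only, so one sheaf covers the saturations of all sections
on `U₀` of all quasi-coherent sheaves. On affine open subsets their sections span the saturation,
and a morphism is determined by its values there. -/
lemma isQuotientOf_saturationCover :
    IsQuotientOf (saturationCover U₀) ((saturation hM s).sheaf hM) := by
  have (g : Σ U, SaturationIndex U₀ U) := (saturation hM s).exists_sheafι_app_eq hM g.1 _
    (saturationSection_mem hM s g.2)
  choose t ht using this
  let p : saturationCover U₀ ⟶ (saturation hM s).sheaf hM :=
    Limits.Sigma.desc fun g ↦ freeOnEquiv.symm (t g)
  have hp (g : Σ U, SaturationIndex U₀ U) :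
      Limits.Sigma.ι (fun g : Σ U, SaturationIndex U₀ U ↦ freeOn X g.1.1) g ≫ p =
        freeOnEquiv.symm (t g) := Limits.Sigma.ι_desc _ _
  refine ⟨p, ⟨fun {L} a b hab ↦ ?_⟩⟩
  have key (g : Σ U, SaturationIndex U₀ U) : a.app g.1.1 (t g) = b.app g.1.1 (t g) := by
    have : freeOnEquiv.symm (t g) ≫ a = freeOnEquiv.symm (t g) ≫ b := by
      rw [← hp]
      exact (Category.assoc _ _ _).trans ((_ ≫= hab).trans (Category.assoc _ _ _).symm)
    have := congr_arg freeOnEquiv this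
    rwa [freeOnEquiv_comp, freeOnEquiv_comp, Equiv.apply_symm_apply] at this
  refine hom_ext_of_isAffineOpen fun U hU x ↦ ?_
  have hx := (saturation hM s).sheafι_app_mem hM ⟨U, hU⟩ x
  generalize hy : ((saturation hM s).sheafι hM).app U x = y at hx
  induction hx using Submodule.span_induction generalizing x with
  | mem y hy' =>
    obtain ⟨g, rfl⟩ := hy'
    obtain rfl : t ⟨⟨U, hU⟩, g⟩ = x :=
      (saturation hM s).sheafι_app_injective hM U ((ht ⟨⟨U, hU⟩, g⟩).trans hy.symm)
    exact key ⟨⟨U, hU⟩, g⟩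
  | zero =>
    obtain rfl : x = 0 := (saturation hM s).sheafι_app_injective hM U (by rw [hy, map_zero])
    rw [map_zero, map_zero]
  | add y z hy' hz' h h' =>
    obtain ⟨y, rfl⟩ := (saturation hM s).exists_sheafι_app_eq hM ⟨U, hU⟩ y hy'
    obtain ⟨z, rfl⟩ := (saturation hM s).exists_sheafι_app_eq hM ⟨U, hU⟩ z hz'
    obtain rfl : x = y + z := (saturation hM s).sheafι_app_injective hM U (by rw [hy, map_add])
    rw [map_add, map_add, h y rfl, h' z rfl]
  | smul r y hy' h =>
    obtain ⟨y, rfl⟩ := (saturation hM s).exists_sheafι_app_eq hM ⟨U, hU⟩ y hy'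
    obtain rfl : x = r • y :=
      (saturation hM s).sheafι_app_injective hM U (by rw [hy, Hom.app_smul])
    rw [Hom.app_smul, Hom.app_smul, h y rfl]

end AlgebraicGeometry.Scheme.Modules

namespace AlgebraicGeometry

open Scheme.Modules

variable (X : Scheme.{w})

/-- A small type of quasi-coherent sheaves separating all quasi-coherent sheaves. -/
def QCoh.GeneratorIndex : Type w :=
  Σ U : X.affineOpens, Shrink.{w} { R : Subobject (saturationCover U) //
    quasicoherent X (cokernel R.arrow) }

variable {X} in
/-- The quasi-coherent sheaf attached to an element of `GeneratorIndex`. -/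
def QCoh.generator (i : QCoh.GeneratorIndex X) : QCoh X :=
  ⟨cokernel ((equivShrink _).symm i.2).1.arrow, ((equivShrink _).symm i.2).2⟩

/-- Distinct morphisms differ on some section over an affine open subset. The saturation of this
section is a quasi-coherent subsheaf containing it, and is isomorphic to one of the chosen
quotients. -/
lemma QCoh.isSeparating_generator :
    ObjectProperty.IsSeparating (.ofObj (QCoh.generator (X := X))) := by
  intro M N f g h
  refine ObjectProperty.hom_ext _ (hom_ext_of_isAffineOpen fun U hU s ↦ ?_)
  let U₀ : X.affineOpens := ⟨U, hU⟩
  obtain ⟨R, ⟨e⟩⟩ := (isQuotientOf_saturationCover M.2 (U₀ := U₀) s).exists_iso_cokernel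
  let r : { R : Subobject (saturationCover U₀) // quasicoherent X (cokernel R.arrow) } :=
    ⟨R, (quasicoherent X).prop_of_iso e.symm
      ((saturation M.2 (U₀ := U₀) s).isQuasicoherent_sheaf M.2)⟩
  let i : QCoh.GeneratorIndex X := ⟨U₀, equivShrink _ r⟩
  let e₁ : (QCoh.generator i).obj ≅ cokernel R.arrow :=
    eqToIso (congr_arg (fun r : { R : Subobject (saturationCover U₀) //
      quasicoherent X (cokernel R.arrow) } ↦ cokernel r.1.arrow)
      ((equivShrink _).symm_apply_apply r))
  let q : (QCoh.generator i).obj ⟶ M.obj :=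
    (e₁ ≪≫ e).hom ≫ (saturation M.2 (U₀ := U₀) s).sheafι M.2
  have hq := congr_arg (quasicoherent X).ι.map (h _ ⟨i⟩ (ObjectProperty.homMk q))
  obtain ⟨t, ht⟩ := (saturation M.2 (U₀ := U₀) s).exists_sheafι_app_eq M.2 U₀ s
    (saturationSection_mem M.2 (U₀ := U₀) s .base)
  have hq' : (saturation M.2 (U₀ := U₀) s).sheafι M.2 ≫ f.hom =
      (saturation M.2 (U₀ := U₀) s).sheafι M.2 ≫ g.hom := by
    rw [← cancel_epi (e₁ ≪≫ e).hom]
    exact (Category.assoc _ _ _).symm.trans (hq.trans (Category.assoc _ _ _))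
  rw [← ht]
  exact congr($(hq').app U t)

instance : IsGrothendieckAbelian.{w} (QCoh X) where
  hasSeparator := ⟨_, (QCoh.isSeparating_generator X).isSeparator_coproduct⟩

end AlgebraicGeometry

end

/-! ### K-flat complexes of quasi-coherent sheaves -/

noncomputable section

namespace AlgebraicGeometry

variable (X : Scheme.{w})

open Scheme.Modules

/-- The tensor product of quasi-coherent sheaves, as a bifunctor to sheaves of modules. -/
def quasicoherentTensor : QCoh X ⥤ QCoh X ⥤ X.Modules :=
  (quasicoherent X).ι ⋙ sheafTensor X ⋙ (Functor.whiskeringLeft _ _ _).obj (quasicoherent X).ι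

instance : (quasicoherentTensor X).PreservesZeroMorphisms where
  map_zero M N := by
    ext K : 2
    have h : (sheafTensor X).map ((quasicoherent X).ι.map (0 : M ⟶ N)) = 0 := by
      rw [Functor.map_zero, Functor.map_zero]
    exact congr_app h _

instance (M : QCoh X) : ((quasicoherentTensor X).obj M).PreservesZeroMorphisms :=
  inferInstanceAs ((quasicoherent X).ι ⋙ (sheafTensor X).obj M.obj).PreservesZeroMorphisms

instance (M : QCoh X) : PreservesColimitsOfSize.{w, w} ((quasicoherentTensor X).obj M) :=
  inferInstanceAs (PreservesColimitsOfSize.{w, w}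
    ((quasicoherent X).ι ⋙ (sheafTensor X).obj M.obj))

instance (M : QCoh X) : PreservesColimitsOfSize.{w, w} ((quasicoherentTensor X).flip.obj M) :=
  inferInstanceAs (PreservesColimitsOfSize.{w, w}
    ((quasicoherent X).ι ⋙ (sheafTensor X).flip.obj M.obj))

instance (M : QCoh X) : PreservesFilteredColimitsOfSize.{w, w}
    ((quasicoherentTensor X).flip.obj M) where
  preserves_filtered_colimits _ := inferInstance

instance (E F : ChainComplex (QCoh X) ℤ) :
    HomologicalComplex.HasMapBifunctor E F (quasicoherentTensor X) (ComplexShape.down ℤ) :=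
  hasMapBifunctor_of_countable E F (quasicoherentTensor X)

lemma acyclic_underlyingComplex_iff (E : ChainComplex (QCoh X) ℤ) :
    (underlyingComplex E).Acyclic ↔ E.Acyclic :=
  forall_congr' fun i ↦
    ShortComplex.exact_map_iff_of_faithful (E.sc i) (quasicoherent X).ι

/-- The general theorem allows a bifunctor with values in another Grothendieck category. Taking
values in all sheaves of modules makes it unnecessary to know that tensor products of quasi-coherent
sheaves are quasi-coherent. -/
lemma isCoveringClass_kFlatQCoh : IsCoveringClass (kFlatQCoh X) := by
  have h := isCoveringClass_mapBifunctor_acyclic (quasicoherentTensor X)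
  suffices kFlatQCoh X = _ from this ▸ h
  ext F
  refine forall_congr' fun E ↦ ?_
  rw [acyclic_underlyingComplex_iff]
  rfl

end AlgebraicGeometry

end

theorem corollary4p3 :
    (∀ (G : Type u) [Category.{v} G] [Abelian G] [IsGrothendieckAbelian.{v} G]
      [MonoidalCategory G] [SymmetricCategory G] [MonoidalClosed G],
      IsCoveringClass (kFlat G)) ∧
    (∀ X : AlgebraicGeometry.Scheme.{w}, IsCoveringClass (kFlatQCoh X)) :=
  ⟨fun G _ _ _ _ _ _ ↦ isCoveringClass_kFlat G,
    fun X ↦ AlgebraicGeometry.isCoveringClass_kFlatQCoh X⟩
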